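/- **Riemannian Goldberg–Sachs theorem for topological massive gravity.** Let $(M,g)$ be an oriented smooth 3-dimensional Riemannian manifold with volume form $e_{abc}$ (normalised by $e_{abc}e^{abc}=6$) and Levi-Civita connection $\nabla$. With the conventions $R_{abd}{}^{c}V^{d}=(\nabla_a\nabla_b-\nabla_b\nabla_a)V^{c}$, $R_{ab}=R_{acb}{}^{c}$, $R=g^{ab}R_{ab}$, put $$\Phi_{ab}=R_{ab}-\tfrac13Rg_{ab},\quad P_{ab}=-\Phi_{ab}-\tfrac1{12}Rg_{ab},\quad A_{abc}=\nabla_bP_{ca}-\nabla_cP_{ba},\quad (*A)_{ab}=\tfrac12 e_b{}^{cd}A_{acd}.$$ Suppose that $g$ solves the topological massive gravity equations $$R_{ab}-\tfrac12Rg_{ab}+\Lambda g_{ab}=\tfrac1m(*A)_{ab}$$ for some real constants $m\neq0$ and $\Lambda$. At a point, a frame $(k,\ell,n)$ of the complexified tangent space is called adapted if $g_{ab}=2k_{(a}\ell_{b)}-2n_an_b$. Then $\Phi(z)=\tfrac12\Phi_{ab}\xi^a\xi^b$ with $\xi=k+2zn+z^2\ell$ is a polynomial of degree at most $4$ in $z$,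 regarded as a quartic form on $\mathbb{CP}^1$ (so that $z=\infty$ may be a root). The tracefree Ricci tensor $\Phi_{ab}$ is *algebraically special* at the point if this quartic has a multiple root ($\Phi_{ab}=0$ is included), and of *Petrov type D* if the quartic is non-zero and has two distinct double roots. A *shear-free congruence of geodesics* is a smooth line field on $M$ which near each point is spanned by a smooth unit vector field $u^a$ with $u^b\nabla_bu^a=0$ and $$\nabla_{(a}u_{b)}-\tfrac12(g_{ab}-u_au_b)\nabla^cu_c-(u^c\nabla_cu_{(a})u_{b)}=0.$$ Then: 1. If $(M,g)$ admits a shear-free congruence of geodesics, then $\Phi_{ab}$ is algebraically special at every point of $M$. 2. If $\Phi_{ab}$ does not vanish identically on any connected component of $M$, then $(M,g)$ admits a shear-free congruence of geodesics if and only if $\Phi_{ab}$ is algebraically special at every point of $M$, and this is the case if and only if $\Phi_{ab}$ is of Petrov type D at every point of $M$. -/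

import Mathlib

open scoped Manifold ContDiff Topology

namespace TMG

/-- Three-dimensional Euclidean space, the model space of the manifolds below. -/
abbrev E3 : Type := EuclideanSpace ℝ (Fin 3)

/-! ### Tensor calculus in local coordinates

In this section `G` is the matrix `g_{ab}` of the components of a metric, as a function of
the coordinates. Indices of tensors are written in the same order as in index notation. -/

noncomputable section

open Polynomial

/-- The partial derivative `∂_a f`. -/
def pd (a : Fin 3) (f : E3 → ℝ) (x : E3) : ℝ :=
  fderiv ℝ f x (EuclideanSpace.single a 1)

/-- The Christoffel symbols `Γ^c_{ab}` of the Levi-Civita connection: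
`Γ^c_{ab} = (1/2) g^{cd} (∂_a g_{bd} + ∂_b g_{ad} - ∂_d g_{ab})`. -/
def christoffel (G : E3 → Matrix (Fin 3) (Fin 3) ℝ) (c a b : Fin 3) (x : E3) : ℝ :=
  (1 / 2) * ∑ d, (G x)⁻¹ c d *
    (pd a (fun y => G y b d) x + pd b (fun y => G y a d) x - pd d (fun y => G y a b) x)

/-- The covariant derivative `∇_a V^b` of a vector field. -/
def covDerivVec (G : E3 → Matrix (Fin 3) (Fin 3) ℝ) (V : Fin 3 → E3 → ℝ)
    (a b : Fin 3) (x : E3) : ℝ :=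
  pd a (V b) x + ∑ d, christoffel G b a d x * V d x

/-- The covariant derivative `∇_c T_{ab}` of a covariant tensor field of valence two. -/
def covDerivTwo (G : E3 → Matrix (Fin 3) (Fin 3) ℝ) (T : Fin 3 → Fin 3 → E3 → ℝ)
    (c a b : Fin 3) (x : E3) : ℝ :=
  pd c (T a b) x - ∑ d, christoffel G d c a x * T d b x - ∑ d, christoffel G d c b x * T a d x

/-- The Riemann tensor `R_{abd}^c`, with the sign convention
`R_{abd}^c V^d = ∇_a ∇_b V^c - ∇_b ∇_a V^c`. -/
def riemann (G : E3 → Matrix (Fin 3) (Fin 3) ℝ) (a b d c : Fin 3) (x : E3) : ℝ :=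
  pd a (christoffel G c b d) x - pd b (christoffel G c a d) x
    + ∑ e, christoffel G c a e x * christoffel G e b d x
    - ∑ e, christoffel G c b e x * christoffel G e a d x

/-- The Ricci tensor `R_{ab} = R_{acb}^c`. -/
def ricci (G : E3 → Matrix (Fin 3) (Fin 3) ℝ) (a b : Fin 3) (x : E3) : ℝ :=
  ∑ c, riemann G a c b c x

/-- The Ricci scalar `R = g^{ab} R_{ab}`. -/
def scalarCurv (G : E3 → Matrix (Fin 3) (Fin 3) ℝ) (x : E3) : ℝ :=
  ∑ a, ∑ b, (G x)⁻¹ a b * ricci G a b x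

/-- The tracefree Ricci tensor `Φ_{ab} = R_{ab} - (1/3) R g_{ab}`. -/
def tracefreeRicci (G : E3 → Matrix (Fin 3) (Fin 3) ℝ) (a b : Fin 3) (x : E3) : ℝ :=
  ricci G a b x - (1 / 3) * scalarCurv G x * G x a b

/-- The Schouten (or Rho) tensor `P_{ab} = - Φ_{ab} - (1/12) R g_{ab}`. -/
def schouten (G : E3 → Matrix (Fin 3) (Fin 3) ℝ) (a b : Fin 3) (x : E3) : ℝ :=
  - tracefreeRicci G a b x - (1 / 12) * scalarCurv G x * G x a b

/-- The Cotton tensor `A_{abc} = 2 ∇_{[b} P_{c]a} = ∇_b P_{ca} - ∇_c P_{ba}`. -/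
def cotton (G : E3 → Matrix (Fin 3) (Fin 3) ℝ) (a b c : Fin 3) (x : E3) : ℝ :=
  covDerivTwo G (schouten G) b c a x - covDerivTwo G (schouten G) c b a x

/-- The Hodge dual `(*A)_{ab} = (1/2) e_b^{cd} A_{acd}` of the Cotton tensor, where `vol` are
the components `e_{abc}` of the volume form. -/
def dualCotton (G : E3 → Matrix (Fin 3) (Fin 3) ℝ) (vol : Fin 3 → Fin 3 → Fin 3 → E3 → ℝ)
    (a b : Fin 3) (x : E3) : ℝ :=
  (1 / 2) * ∑ c, ∑ d, ∑ p, ∑ q, vol b p q x * (G x)⁻¹ p c * (G x)⁻¹ q d * cotton G a c d x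

/-! ### Algebraic classification of the tracefree Ricci tensor at a point -/

/-- The complex bilinear extension `B_{ab} v^a w^b` of a real bilinear form. -/
def cbil (B : Matrix (Fin 3) (Fin 3) ℝ) (v w : Fin 3 → ℂ) : ℂ :=
  ∑ a, ∑ b, (B a b : ℂ) * v a * w b

/-- `(k, l, n)` is an adapted frame of the complexified tangent space for the metric `g`:
`g_{ab} = 2 k_{(a} l_{b)} - 2 n_a n_b`. -/
structure IsAdaptedFrame (g : Matrix (Fin 3) (Fin 3) ℝ) (k l n : Fin 3 → ℂ) : Prop where
  kk : cbil g k k = 0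
  ll : cbil g l l = 0
  kl : cbil g k l = 1
  kn : cbil g k n = 0
  ln : cbil g l n = 0
  nn : cbil g n n = -(1 / 2)

/-- The null vector `ξ^a(z) = k^a + 2 z n^a + z^2 l^a`, whose components are polynomials
in `z`. -/
def nullVec (k l n : Fin 3 → ℂ) (a : Fin 3) : ℂ[X] :=
  C (k a) + 2 * X * C (n a) + X ^ 2 * C (l a)

/-- The quartic polynomial `Φ(z) = (1/2) Φ_{ab} ξ^a(z) ξ^b(z)`, whose roots are the principal
null directions of `Φ_{ab}`. -/
def ricciPoly (Phi : Matrix (Fin 3) (Fin 3) ℝ) (k l n : Fin 3 → ℂ) : ℂ[X] :=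
  C (1 / 2) * ∑ a, ∑ b, C (Phi a b : ℂ) * nullVec k l n a * nullVec k l n b

/-- `Φ_{ab}` is algebraically special: it has a multiple principal null direction, that is, in a
suitable adapted frame the quartic polynomial has a multiple root. (This holds for `Φ_{ab} = 0`.)
-/
def IsAlgSpecial (g Phi : Matrix (Fin 3) (Fin 3) ℝ) : Prop :=
  ∃ k l n, IsAdaptedFrame g k l n ∧ ∃ z : ℂ, (X - C z) ^ 2 ∣ ricciPoly Phi k l n

/-- `Φ_{ab}` is of Petrov type D: it is non-zero and has two distinct principal null directions
of multiplicity two. (The frame is chosen such that both are at finite values of `z`; as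
`Φ_{ab}` is real and `g` positive definite, they are complex conjugates of each other.) -/
def IsPetrovD (g Phi : Matrix (Fin 3) (Fin 3) ℝ) : Prop :=
  ∃ k l n, IsAdaptedFrame g k l n ∧
    ∃ z w c : ℂ, z ≠ w ∧ c ≠ 0 ∧
      ricciPoly Phi k l n = C c * (X - C z) ^ 2 * (X - C w) ^ 2

/-! ### Shear-free and geodesic unit vector fields in local coordinates -/

/-- The lowered covariant derivative `∇_a u_b = g_{bc} ∇_a u^c`. -/
def covDerivLow (G : E3 → Matrix (Fin 3) (Fin 3) ℝ) (u : Fin 3 → E3 → ℝ)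
    (a b : Fin 3) (x : E3) : ℝ :=
  ∑ c, G x b c * covDerivVec G u a c x

/-- `u_a = g_{ab} u^b`. -/
def lower (G : E3 → Matrix (Fin 3) (Fin 3) ℝ) (u : Fin 3 → E3 → ℝ) (a : Fin 3) (x : E3) : ℝ :=
  ∑ b, G x a b * u b x

/-- The divergence `∇^c u_c`. -/
def divergence (G : E3 → Matrix (Fin 3) (Fin 3) ℝ) (u : Fin 3 → E3 → ℝ) (x : E3) : ℝ :=
  ∑ c, covDerivVec G u c c x

/-- The acceleration `u^c ∇_c u_a`. -/
def acceleration (G : E3 → Matrix (Fin 3) (Fin 3) ℝ) (u : Fin 3 → E3 → ℝ)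
    (a : Fin 3) (x : E3) : ℝ :=
  ∑ c, u c x * covDerivLow G u c a x

/-- A unit vector field is geodesic at `x`: `u^b ∇_b u^a = 0`. -/
def IsGeodesicAt (G : E3 → Matrix (Fin 3) (Fin 3) ℝ) (u : Fin 3 → E3 → ℝ) (x : E3) : Prop :=
  ∀ a, ∑ b, u b x * covDerivVec G u b a x = 0

/-- A unit vector field is shear-free at `x`:
`∇_{(a} u_{b)} - (1/2) h_{ab} ∇^c u_c - (u^c ∇_c u_{(a}) u_{b)} = 0` with
`h_{ab} = g_{ab} - u_a u_b`; equivalently, the Lie derivative of `h_{ab}` along `u^a` is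
proportional to `h_{ab}`. -/
def IsShearFreeAt (G : E3 → Matrix (Fin 3) (Fin 3) ℝ) (u : Fin 3 → E3 → ℝ) (x : E3) : Prop :=
  ∀ a b,
    (1 / 2) * (covDerivLow G u a b x + covDerivLow G u b a x)
      - (1 / 2) * (G x a b - lower G u a x * lower G u b x) * divergence G u x
      - (1 / 2) * (acceleration G u a x * lower G u b x + acceleration G u b x * lower G u a x)
      = 0

/-! ### Objects on a manifold -/

section Manifold

variable {M : Type*} [TopologicalSpace M] [ChartedSpace E3 M] [IsManifold (𝓡 3) ∞ M]

/-- The coordinate vector `∂_a` of the chart `e` at the point with coordinates `x`. -/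
def coordVec (e : OpenPartialHomeomorph M E3) (x : E3) (a : Fin 3) :
    TangentSpace (𝓡 3) (e.symm x) :=
  mfderiv (𝓡 3) (𝓡 3) e.symm x (EuclideanSpace.single a 1 : E3)

/-- A smooth Riemannian metric on `M`. -/
abbrev Metric (M : Type*) [TopologicalSpace M] [ChartedSpace E3 M] [IsManifold (𝓡 3) ∞ M] :
    Type _ :=
  Bundle.ContMDiffRiemannianMetric (𝓡 3) ∞ E3 (fun p : M => TangentSpace (𝓡 3) p)

/-- The components `g_{ab}` of the metric in the chart `e`. -/
def metricComp (g : Metric M) (e : OpenPartialHomeomorph M E3) (x : E3) :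
    Matrix (Fin 3) (Fin 3) ℝ :=
  Matrix.of fun a b => g.inner (e.symm x) (coordVec e x a) (coordVec e x b)

/-- An orientation of `(M, g)`, given by a smooth volume form `e_{abc}` normalised to take the
values `±1` on orthonormal frames. -/
structure VolumeForm (g : Metric M) where
  /-- The value of the volume form at a point. -/
  form : ∀ p : M, (TangentSpace (𝓡 3) p) [⋀^Fin 3]→ₗ[ℝ] ℝ
  normalised : ∀ (p : M) (v : Fin 3 → TangentSpace (𝓡 3) p),
    (∀ i j, g.inner p (v i) (v j) = if i = j then 1 else 0) → |form p v| = 1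
  smooth : ∀ e ∈ IsManifold.maximalAtlas (𝓡 3) ∞ M,
    ContDiffOn ℝ ∞ (fun x => form (e.symm x) (coordVec e x)) e.target

/-- The components `e_{abc}` of the volume form in the chart `e`. -/
def volComp {g : Metric M} (vol : VolumeForm g) (e : OpenPartialHomeomorph M E3)
    (a b c : Fin 3) (x : E3) : ℝ :=
  vol.form (e.symm x) ![coordVec e x a, coordVec e x b, coordVec e x c]

/-- The components `Φ_{ab}` of the tracefree Ricci tensor in the chart `e`. -/
def tracefreeRicciComp (g : Metric M) (e : OpenPartialHomeomorph M E3) (x : E3) :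
    Matrix (Fin 3) (Fin 3) ℝ :=
  Matrix.of fun a b => tracefreeRicci (metricComp g e) a b x

/-- The topological massive gravity equations with parameter `m` and cosmological constant `Λ`:
`R_{ab} - (1/2) R g_{ab} + Λ g_{ab} = (1/m) (*A)_{ab}`, in every chart. -/
def SolvesTMG (g : Metric M) (vol : VolumeForm g) (m Λ : ℝ) : Prop :=
  ∀ e ∈ IsManifold.maximalAtlas (𝓡 3) ∞ M, ∀ x ∈ e.target, ∀ a b : Fin 3,
    ricci (metricComp g e) a b x
        - (1 / 2) * scalarCurv (metricComp g e) x * metricComp g e x a b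
        + Λ * metricComp g e x a b
      = (1 / m) * dualCotton (metricComp g e) (volComp vol e) a b x

/-- The tracefree Ricci tensor vanishes at `p`. -/
def TracefreeRicciVanishesAt (g : Metric M) (p : M) : Prop :=
  ∀ e ∈ IsManifold.maximalAtlas (𝓡 3) ∞ M, p ∈ e.source → tracefreeRicciComp g e (e p) = 0

/-- The tracefree Ricci tensor is algebraically special at `p`. -/
def AlgSpecialAt (g : Metric M) (p : M) : Prop :=
  ∀ e ∈ IsManifold.maximalAtlas (𝓡 3) ∞ M, p ∈ e.source →
    IsAlgSpecial (metricComp g e (e p)) (tracefreeRicciComp g e (e p))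

/-- The tracefree Ricci tensor is of Petrov type D at `p`. -/
def PetrovDAt (g : Metric M) (p : M) : Prop :=
  ∀ e ∈ IsManifold.maximalAtlas (𝓡 3) ∞ M, p ∈ e.source →
    IsPetrovD (metricComp g e (e p)) (tracefreeRicciComp g e (e p))

/-- The components `u^a` of a vector field in the chart `e`. -/
def vecComp (u : ∀ q : M, TangentSpace (𝓡 3) q) (e : OpenPartialHomeomorph M E3)
    (a : Fin 3) (x : E3) : ℝ :=
  let v : E3 := mfderiv (𝓡 3) (𝓡 3) e (e.symm x) (u (e.symm x))
  v a

/-- `L` is a congruence of (unoriented) curves, given by their tangent lines, which is shear-free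
and geodesic: around each point `L` is spanned by a smooth unit vector field which is shear-free
and geodesic. -/
def IsShearFreeGeodesicCongruence (g : Metric M)
    (L : ∀ p : M, Submodule ℝ (TangentSpace (𝓡 3) p)) : Prop :=
  ∀ p : M, ∃ U : Set M, IsOpen U ∧ p ∈ U ∧ ∃ u : ∀ q : M, TangentSpace (𝓡 3) q,
    ContMDiffOn (𝓡 3) (𝓡 3).tangent ∞ (fun q => (⟨q, u q⟩ : TangentBundle (𝓡 3) M)) U ∧
    ∀ q ∈ U, g.inner q (u q) (u q) = 1 ∧ L q = Submodule.span ℝ {u q} ∧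
      ∀ e ∈ IsManifold.maximalAtlas (𝓡 3) ∞ M, q ∈ e.source →
        IsGeodesicAt (metricComp g e) (vecComp u e) (e q) ∧
        IsShearFreeAt (metricComp g e) (vecComp u e) (e q)

/-- `(M, g)` admits a shear-free congruence of geodesics. -/
def AdmitsShearFreeGeodesicCongruence (g : Metric M) : Prop :=
  ∃ L : ∀ p : M, Submodule ℝ (TangentSpace (𝓡 3) p), IsShearFreeGeodesicCongruence g L

end Manifold

end

end TMG

/-! Algebra at a point. Let ξ be the complex null vector of a multiple root. Then Φ(ξ, v) = 0 for
all v orthogonal to ξ. Since Φ is real, the conjugate of ξ is a multiple root too, and Φ is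
invariant under rotations of the plane spanned by Re ξ and Im ξ. Hence "algebraically special" means
Φ = φ(3 u u - g) with a unit vector u (`IsUniaxial`), which is type D for φ ≠ 0
(`IsAlgSpecial.exists_isUniaxial`, `IsUniaxial.exists_ricciPoly`).

Field equations. The dual Cotton tensor is trace-free, so the trace of the equations gives R = 6Λ.
What remains is a first-order system, ∇_c Φ_{da} - ∇_d Φ_{ca} = -m e_{cd}^b Φ_{ab}
(`FrameCalculus.curlEquation_of_tmg`).

From a congruence to Φ (`ShearFreeGeodesic.sq_eq_zero`). Take an orthonormal frame with e_2 = u.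
Without shear and acceleration the Ricci identities kill the trace-free part of Φ on the plane
orthogonal to u. The other obstruction is ψ = Φ(u, e_0) + iΦ(u, e_1). The curl equation prescribes
(D_0 + iD_1)ψ and D_2 ψ as multiples of ψ, and the commutator of these two derivatives, with the
curvature inserted, leaves 5ψ² = 0.

From Φ to a congruence (`CurlEquation.typeD`). Where φ ≠ 0 the curl equation says that u is geodesic
and shear-free with twist proportional to m, and that φ is constant along the plane orthogonal to u.
As m ≠ 0 this plane field is not integrable, so φ is locally constant. Since φ² = |Φ|²/6 is
continuous, φ is constant on connected components, so Φ vanishes nowhere on a component where it is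
not identically zero. The axis u is smooth up to sign, and its lines form the congruence.

The differential computations are identities in a commutative ring with derivations. They are later
applied to the ring of smooth functions on an open set of coordinates and evaluated at points. -/

namespace TMG

/-! ### Curvature in an orthonormal frame; shear-free congruences force Φ to be uniaxial. -/

/-- The calculus of an orthonormal frame `e_0, e_1, e_2` of a three-dimensional Riemannian
manifold: the frame derivatives `D i` of functions and the connection coefficients
`γ i j k = g(∇_{e_i} e_j, e_k)`. -/
structure FrameCalculus (A : Type*) [CommRing A] [Algebra ℝ A] where
  /-- The derivative of functions along `e_i`. -/
  D : Fin 3 → Derivation ℝ A A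
  /-- The connection coefficients. -/
  γ : Fin 3 → Fin 3 → Fin 3 → A
  antisymm : ∀ i j k, γ i j k = - γ i k j
  commutator : ∀ i j f, D i (D j f) - D j (D i f) = ∑ k, (γ i j k - γ j i k) * D k f

/-- The Levi-Civita symbol. -/
def eps (R : Type*) [Ring R] (i j k : Fin 3) : R :=
  if (i, j, k) ∈ [((0 : Fin 3), (1 : Fin 3), (2 : Fin 3)), (1, 2, 0), (2, 0, 1)] then 1
  else if (i, j, k) ∈ [((0 : Fin 3), (2 : Fin 3), (1 : Fin 3)), (2, 1, 0), (1, 0, 2)] then -1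
  else 0

namespace FrameCalculus

variable {A : Type*} [CommRing A] [Algebra ℝ A] (F : FrameCalculus A)

/-- The components of the Riemann tensor, `g(R(e_i, e_j) e_k, e_l)`. -/
def riem (i j k l : Fin 3) : A :=
  F.D i (F.γ j k l) - F.D j (F.γ i k l)
    + ∑ m, (F.γ j k m * F.γ i m l - F.γ i k m * F.γ j m l)
    - ∑ m, (F.γ i j m - F.γ j i m) * F.γ m k l

/-- The frame components of the Ricci tensor. -/
def ric (i j : Fin 3) : A := ∑ k, F.riem i k j k

/-- The frame components `∇_c T_{ab}`. -/
def cov (T : Fin 3 → Fin 3 → A) (c a b : Fin 3) : A :=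
  F.D c (T a b) - ∑ m, F.γ c a m * T m b - ∑ m, F.γ c b m * T a m

theorem eq_zero_of_two_mul {x : A} (h : 2 * x = 0) : x = 0 := by
  have h1 : algebraMap ℝ A (1 / 2) * 2 = 1 := by
    rw [show (2 : A) = algebraMap ℝ A 2 from (map_ofNat _ 2).symm, ← map_mul]; norm_num
  linear_combination algebraMap ℝ A (1 / 2) * h - x * h1

theorem γ_diag (i j : Fin 3) : F.γ i j j = 0 :=
  eq_zero_of_two_mul (by linear_combination F.antisymm i j j)

/-- `u = e_2` is geodesic and shear-free. -/
structure ShearFreeGeodesic : Prop where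
  geod : ∀ k, F.γ 2 2 k = 0
  diag : F.γ 1 2 1 = F.γ 0 2 0
  off : F.γ 1 2 0 = - F.γ 0 2 1

/-- The curl equation `∇_c Φ_{da} - ∇_d Φ_{ca} = - m e_{cd}^b Φ_{ab}` for `Φ`, where `R_{ab}` is
the sum of `Φ_{ab}` and a constant multiple of `g_{ab}`. -/
structure CurlEquation (Φ : Fin 3 → Fin 3 → A) (L M : A) : Prop where
  ric_eq : ∀ i j, F.ric i j = Φ i j + if i = j then L else 0
  symm : ∀ i j, Φ i j = Φ j i
  trace : ∑ i, Φ i i = 0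
  curl : ∀ a c d, F.cov Φ c d a - F.cov Φ d c a = - M * ∑ b, eps A c d b * Φ a b
  D_M : ∀ i, F.D i M = 0

variable {F}

/-- The derivative equations for `ψ = Φ(e_2, ·)` in the presence of a shear-free congruence of
geodesics force `ψ` to vanish, up to nilpotents. -/
theorem ShearFreeGeodesic.sq_eq_zero {Φ : Fin 3 → Fin 3 → A} {L M : A}
    (hs : F.ShearFreeGeodesic) (h : F.CurlEquation Φ L M) :
    Φ 0 1 = 0 ∧ Φ 0 0 = Φ 1 1 ∧ 5 * (Φ 2 0 ^ 2 - Φ 2 1 ^ 2) = 0 ∧ 10 * (Φ 2 0 * Φ 2 1) = 0 := by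
  have g0 : ∀ i j, F.γ i j j = 0 := F.γ_diag
  have a1 : ∀ i, F.γ i 1 0 = - F.γ i 0 1 := fun i => F.antisymm i 1 0
  have a2 : ∀ i, F.γ i 0 2 = - F.γ i 2 0 := fun i => F.antisymm i 0 2
  have a3 : ∀ i, F.γ i 1 2 = - F.γ i 2 1 := fun i => F.antisymm i 1 2
  have e1 := hs.geod
  have e2 := hs.diag
  have e3 := hs.off
  have r00 := h.ric_eq 0 0
  have r11 := h.ric_eq 1 1
  have r01 := h.ric_eq 0 1
  have r02 := h.ric_eq 0 2
  have r12 := h.ric_eq 1 2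
  have r20 := h.ric_eq 2 0
  have r21 := h.ric_eq 2 1
  have r10 := h.ric_eq 1 0
  have s01 := h.symm 1 0
  have s02 := h.symm 0 2
  have s12 := h.symm 1 2
  have t := h.trace
  simp [ric, riem, Fin.sum_univ_three, g0, a1, a2, a3, e1, e2, e3, s01, s02, s12] at r00 r11 r01 r02 r12 r20 r21 r10 t
  -- In the absence of shear, expansion and twist enter the 00 and 11 components of the Ricci tensor
  -- equally and the 01 and 10 components oppositely, so their derivatives along e_2 cancel in `r00
  -- - r11` and in `r01 + r10`.
  have hΦ01 : Φ 0 1 = 0 := eq_zero_of_two_mul (by linear_combination -r01 - r10)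
  have hΦ11 : Φ 1 1 = Φ 0 0 := by linear_combination r00 - r11
  have hΦ22 : Φ 2 2 = -(Φ 0 0 + Φ 0 0) := by linear_combination t - hΦ11
  have c := h.curl
  have c010 := c 0 0 1
  have c101 := c 1 0 1
  have c220 := c 2 2 0
  have c221 := c 2 2 1
  have c020 := c 0 2 0
  have c120 := c 1 2 0
  have c021 := c 0 2 1
  have c121 := c 1 2 1
  simp [cov, eps, Fin.sum_univ_three, g0, a1, a2, a3, e1, e2, e3, s01, s02, s12, hΦ01, hΦ11, hΦ22,map_neg, map_add] at c010 c101 c220 c221 c020 c120 c021 c121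
  have k0 := F.commutator 2 0
  have k1 := F.commutator 2 1
  simp [Fin.sum_univ_three, g0, a1, a2, a3, e1, e2, e3] at k0 k1
  set θ := F.γ 0 2 0
  set w := F.γ 0 2 1
  set a := F.γ 0 0 1
  set b := F.γ 1 0 1
  set c' := F.γ 2 0 1
  set p := Φ 2 0
  set q := Φ 2 1
  -- Put ψ = p + iq and δ = D_0 + iD_1. `H1`, `H2` are the real and imaginary parts of δψ = (b -
  -- ia)ψ, and `C0`, `C1` those of D_2 ψ = -(4θ + i(4w + M + c'))ψ. The combinations are those in
  -- which the derivatives of Φ 0 0 cancel; the coefficient 2 comes from Φ 2 2 = -2 Φ 0 0.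
  have H1 : F.D 0 p - F.D 1 q = a * q + b * p := by linear_combination c121 - c020
  have H2 : F.D 0 q + F.D 1 p = b * q - a * p := by linear_combination - c120 - c021
  have C0 : F.D 2 p = -4 * θ * p + (4 * w + M + c') * q := by linear_combination c220 -2 * c101
  have C1 : F.D 2 q = -4 * θ * q - (4 * w + M + c') * p := by linear_combination c221 + 2 * c010
  have h4 : ∀ i, F.D i 4 = 0 := fun i => (F.D i).map_natCast 4
  refine ⟨hΦ01, hΦ11.symm, ?_, ?_⟩
  -- The real part of [D_2, δ]ψ, computed from the equations for ψ and from the commutators `k0`,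
  -- `k1`. The derivatives of the connection coefficients are eliminated by `r02`, `r12`, `r20`,
  -- `r21`, whose right sides are p and q again. This produces the quadratic terms; all others
  -- cancel.
  · have dH := congrArg (F.D 2) H1
    have dC0 := congrArg (F.D 0) C0
    have dC1 := congrArg (F.D 1) C1
    simp [h.D_M, h4] at dH dC0 dC1
    linear_combination -(dH - k0 p + k1 q - dC0 + dC1 + p * r20 - q * r21 + a * C1 + b * C0) - 4 * p * r02 + 4 * q * r12 - 5 * θ * H1 + (2 * c' + 3 * w + M) * H2
  -- The imaginary part of the same integrability condition.
  · have dH := congrArg (F.D 2) H2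
    have dC0 := congrArg (F.D 0) C1
    have dC1 := congrArg (F.D 1) C0
    simp [h.D_M, h4] at dH dC0 dC1
    linear_combination -(dH - k0 q - k1 p - dC0 - dC1 + q * r20 + p * r21 + b * C1 - a * C0) - 4 * p * r12 - 4 * q * r02 - 5 * θ * H2 - (2 * c' + 3 * w + M) * H1

end FrameCalculus
end TMG

/-! ### Type D tensors solving the curl equation, and the field equations in a frame. -/

namespace TMG
namespace FrameCalculus
variable {A : Type*} [CommRing A] [Algebra ℝ A] {F : FrameCalculus A}

theorem eq_zero_of_three_mul {x : A} (h : 3 * x = 0) : x = 0 := by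
  have h1 : algebraMap ℝ A (1 / 3) * 3 = 1 := by
    rw [show (3 : A) = algebraMap ℝ A 3 from (map_ofNat _ 3).symm, ← map_mul]; norm_num
  linear_combination algebraMap ℝ A (1 / 3) * h - x * h1

/-- If `Φ = φ (3 u u - g)` with `φ` invertible solves the curl equation with `m ≠ 0`, then `u` is
shear-free and geodesic, and `φ` is constant. -/
theorem CurlEquation.typeD {Φ : Fin 3 → Fin 3 → A} {L M φ : A} (h : F.CurlEquation Φ L M)
    (hΦ : ∀ i j, Φ i j = φ * (3 * (if i = 2 ∧ j = 2 then 1 else 0) - if i = j then 1 else 0))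
    (hφ : IsUnit φ) (hM : IsUnit M) : F.ShearFreeGeodesic ∧ ∀ i, F.D i φ = 0 := by
  have g0 : ∀ i j, F.γ i j j = 0 := F.γ_diag
  have a1 : ∀ i, F.γ i 1 0 = - F.γ i 0 1 := fun i => F.antisymm i 1 0
  have a2 : ∀ i, F.γ i 0 2 = - F.γ i 2 0 := fun i => F.antisymm i 0 2
  have a3 : ∀ i, F.γ i 1 2 = - F.γ i 2 1 := fun i => F.antisymm i 1 2
  have h00 : Φ 0 0 = -φ := by rw [hΦ]; simp
  have h11 : Φ 1 1 = -φ := by rw [hΦ]; simp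
  have h22 : Φ 2 2 = φ + φ := by rw [hΦ]; simp; ring
  have h01 : Φ 0 1 = 0 := by rw [hΦ]; simp
  have h02 : Φ 0 2 = 0 := by rw [hΦ]; simp
  have h12 : Φ 1 2 = 0 := by rw [hΦ]; simp
  have h10 : Φ 1 0 = 0 := by rw [hΦ]; simp
  have h20 : Φ 2 0 = 0 := by rw [hΦ]; simp
  have h21 : Φ 2 1 = 0 := by rw [hΦ]; simp
  have c := h.curl
  have c010 := c 0 0 1
  have c101 := c 1 0 1
  have c220 := c 2 2 0
  have c221 := c 2 2 1
  have c020 := c 0 2 0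
  have c120 := c 1 2 0
  have c021 := c 0 2 1
  have c121 := c 1 2 1
  have k := F.commutator 0 1 φ
  simp [cov, eps, Fin.sum_univ_three, g0, a1, a2, a3, h00, h11, h22, h01, h02, h12, h10, h20, h21]
    at c010 c101 c220 c221 c020 c120 c021 c121 k
  -- Dividing by φ, the remaining components of the curl equation give the vanishing of the
  -- acceleration and the values -M/3 and M/3 of γ 0 2 1 and γ 1 2 0, so that u has twist but no
  -- off-diagonal shear.
  have d0 : F.D 0 φ = 0 := by linear_combination c101
  have d1 : F.D 1 φ = 0 := by linear_combination c010
  have k20 : F.γ 2 2 0 = 0 := hφ.mul_left_eq_zero.1 (eq_zero_of_three_mul (by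
    linear_combination c220 + 2 * d0))
  have k21 : F.γ 2 2 1 = 0 := hφ.mul_left_eq_zero.1 (eq_zero_of_three_mul (by
    linear_combination c221 + 2 * d1))
  have k01 : 3 * F.γ 0 2 1 + M = 0 := hφ.mul_left_eq_zero.1 (by
    linear_combination -c120)
  have k10 : 3 * F.γ 1 2 0 - M = 0 := hφ.mul_left_eq_zero.1 (by
    linear_combination -c021)
  rw [d0, d1, map_zero, map_zero] at k
  -- By the twist, [e_0, e_1] has e_2-component 2M/3, which is invertible. Since D_0 φ = D_1 φ = 0,
  -- the commutator applied to φ gives D_2 φ = 0.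
  have d2 : F.D 2 φ = 0 := hM.mul_left_eq_zero.1 (eq_zero_of_two_mul (by
    linear_combination -3 * k + F.D 2 φ * (k01 - k10)))
  have k00 : F.γ 0 2 0 = 0 := hφ.mul_left_eq_zero.1 (eq_zero_of_three_mul (by
    linear_combination -c020 - d2))
  have k11 : F.γ 1 2 1 = 0 := hφ.mul_left_eq_zero.1 (eq_zero_of_three_mul (by
    linear_combination -c121 - d2))
  refine ⟨⟨?_, by rw [k00, k11], ?_⟩, ?_⟩
  · intro k; fin_cases k
    exacts [k20, k21, g0 2 2]
  · have := eq_zero_of_three_mul (x := F.γ 1 2 0 + F.γ 0 2 1) (by linear_combination k01 + k10)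
    linear_combination this
  · intro i; fin_cases i
    exacts [d0, d1, d2]

omit [Algebra ℝ A] in
-- The contraction of two Levi-Civita symbols; it inverts the Hodge dual in the field equations.
theorem sum_eps_mul_sum_eps (c d : Fin 3) (X : Fin 3 → Fin 3 → A) :
    ∑ b, eps A c d b * ∑ p, ∑ q, eps A b p q * X p q = X c d - X d c := by
  fin_cases c <;> fin_cases d <;> simp [eps, Fin.sum_univ_three] <;> ring

omit [Algebra ℝ A] in
-- With X = ∇P this says that the dual Cotton tensor has no trace: the total antisymmetrisation of a
-- tensor symmetric in two indices vanishes.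
theorem sum_sum_sum_eps (X : Fin 3 → Fin 3 → Fin 3 → A) (hX : ∀ p q i, X p q i = X p i q) :
    ∑ i, ∑ p, ∑ q, eps A i p q * (X p q i - X q p i) = 0 := by
  simp [eps, Fin.sum_univ_three]
  linear_combination 2 * hX 0 1 2 + 2 * hX 1 2 0 + 2 * hX 2 0 1

theorem cov_symm {T : Fin 3 → Fin 3 → A} (hT : ∀ i j, T i j = T j i) (c a b : Fin 3) :
    F.cov T c a b = F.cov T c b a := by
  simp only [cov, hT a b, fun m => hT m b, fun m => hT a m]
  ring

/-- The metric is parallel: the term in s contributes s (γ c a b + γ c b a), which is zero by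
antisymmetry. -/
theorem cov_add_const {T S : Fin 3 → Fin 3 → A} {s t : A} (hs : ∀ i, F.D i s = 0)
    (ht : ∀ i, F.D i t = 0) (hST : ∀ i j, S i j = t * T i j + if i = j then s else 0)
    (c a b : Fin 3) : F.cov S c a b = t * F.cov T c a b := by
  simp only [cov, hST, map_add, Derivation.leibniz, ht]
  have : F.D c (if a = b then s else 0) = 0 := by split_ifs <;> simp [hs]
  rw [this]
  have := F.antisymm c a b
  simp [mul_add, Finset.sum_add_distrib, Finset.mul_sum, mul_sub, mul_left_comm]
  linear_combination -s * this

/-- The frame form of the topological massive gravity equations implies that the scalar curvature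
is constant and that the tracefree Ricci tensor solves the curl equation. -/
theorem curlEquation_of_tmg (hsymm : ∀ i j, F.ric i j = F.ric j i) {m Λ : ℝ} (hm : m ≠ 0) {s : A}
    (hs : s * s = 1) {P : Fin 3 → Fin 3 → A}
    (hP : ∀ i j, P i j = - F.ric i j
      + if i = j then algebraMap ℝ A (1 / 4) * ∑ k, F.ric k k else 0)
    (h : ∀ i j, F.ric i j
        + (if i = j then algebraMap ℝ A Λ - algebraMap ℝ A (1 / 2) * ∑ k, F.ric k k else 0)
      = algebraMap ℝ A (1 / m) * algebraMap ℝ A (1 / 2) * ∑ p, ∑ q, s * eps A j p q *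
          (F.cov P p q i - F.cov P q p i)) :
    (∑ k, F.ric k k = algebraMap ℝ A (6 * Λ)) ∧
    F.CurlEquation (fun i j => F.ric i j - if i = j then algebraMap ℝ A (2 * Λ) else 0)
      (algebraMap ℝ A (2 * Λ)) (algebraMap ℝ A m * s) := by
  have h2 : algebraMap ℝ A (1 / 2) * 2 = 1 := by
    rw [show (2 : A) = algebraMap ℝ A 2 from (map_ofNat _ 2).symm, ← map_mul]; norm_num
  have h4 : algebraMap ℝ A (1 / 4) * 4 = 1 := by
    rw [show (4 : A) = algebraMap ℝ A 4 from (map_ofNat _ 4).symm, ← map_mul]; norm_num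
  have hm' : algebraMap ℝ A (1 / m) * algebraMap ℝ A m = 1 := by
    rw [← map_mul, one_div_mul_cancel hm, map_one]
  have hD : ∀ i (r : ℝ), F.D i (algebraMap ℝ A r) = 0 := fun i r => (F.D i).map_algebraMap r
  have hΛ2 : algebraMap ℝ A (2 * Λ) = 2 * algebraMap ℝ A Λ := by rw [map_mul, map_ofNat]
  have hΛ6 : algebraMap ℝ A (6 * Λ) = 6 * algebraMap ℝ A Λ := by rw [map_mul, map_ofNat]
  have hPs : ∀ i j, P i j = P j i := fun i j => by rw [hP, hP, hsymm]; simp only [eq_comm]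
  have h' : ∀ i j, ∑ p, ∑ q, s * eps A j p q * (F.cov P p q i - F.cov P q p i)
      = s * ∑ p, ∑ q, eps A j p q * (F.cov P p q i - F.cov P q p i) := fun i j => by
    simp only [Finset.mul_sum, mul_assoc]
  have hR : ∑ k, F.ric k k = algebraMap ℝ A (6 * Λ) := by
    have ht : ∑ i, ∑ p, ∑ q, eps A i p q * (F.cov P p q i - F.cov P q p i) = 0 :=
      sum_sum_sum_eps (F.cov P) (cov_symm hPs)
    -- Set i = j and sum: the right side has no trace, and the left one is R - (3/2)R + 3Λ.
    have e := Finset.sum_congr (rfl : (Finset.univ : Finset (Fin 3)) = _) fun i _ => h i i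
    simp only [h', ← Finset.mul_sum, ht, Finset.sum_add_distrib] at e
    simp at e
    rw [hΛ6]
    rw [show algebraMap ℝ A 2⁻¹ = algebraMap ℝ A (1/2) by norm_num] at e
    linear_combination -2 * e - 3 * (∑ k, F.ric k k) * h2
  refine ⟨hR, fun i j => by simp, fun i j => by rw [hsymm]; simp only [eq_comm], ?_, ?_,
    fun i => ?_⟩
  · rw [Finset.sum_sub_distrib, hR, hΛ6, hΛ2]; simp; ring
  · intro a c d
    set Φ : Fin 3 → Fin 3 → A := fun i j => F.ric i j - if i = j then algebraMap ℝ A (2 * Λ) else 0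
      with hΦ
    -- With R = 6Λ the Schouten tensor is -Φ - (Λ/2)g, and its curl is minus that of Φ.
    have hPΦ : ∀ i j, P i j = -1 * Φ i j + if i = j then algebraMap ℝ A (-Λ / 2) else 0 := by
      intro i j
      have : algebraMap ℝ A (-Λ / 2) = - algebraMap ℝ A Λ * algebraMap ℝ A (1 / 2) := by
        rw [← map_neg, ← map_mul]; congr 1; ring
      rw [hP, hR, hΛ6, this, hΦ, hΛ2]
      by_cases hij : i = j <;> simp only [hij, ↓reduceIte]
      · linear_combination 2 * algebraMap ℝ A Λ * h4 + algebraMap ℝ A Λ *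
          (2 * algebraMap ℝ A (1 / 4) * h2 - algebraMap ℝ A (1 / 2) * h4)
      · ring
    have hc : ∀ c a b, F.cov P c a b = -1 * F.cov Φ c a b :=
      cov_add_const (fun i => hD i _) (fun i => by simp) hPΦ
    have hh : ∀ j, Φ a j = - (algebraMap ℝ A (1 / m) * algebraMap ℝ A (1 / 2) * s) *
        ∑ p, ∑ q, eps A j p q * (F.cov Φ p q a - F.cov Φ q p a) := by
      intro j
      have e := h a j
      rw [h', hR, hΛ6] at e
      have : ∀ p q, eps A j p q * (F.cov P p q a - F.cov P q p a)
          = -1 * (eps A j p q * (F.cov Φ p q a - F.cov Φ q p a)) := fun p q => by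
        rw [hc, hc]; ring
      simp only [this, ← Finset.mul_sum] at e
      rw [hΦ] at e ⊢
      rw [hΛ2] at e ⊢
      by_cases hij : a = j <;> simp only [hij, ↓reduceIte] at e ⊢
      · linear_combination e + 3 * algebraMap ℝ A Λ * h2
      · linear_combination e
    have e2 := sum_eps_mul_sum_eps c d fun p q => F.cov Φ p q a - F.cov Φ q p a
    have e3 : ∑ b, eps A c d b * Φ a b = - (algebraMap ℝ A (1 / m) * algebraMap ℝ A (1 / 2) * s) *
        ∑ b, eps A c d b * ∑ p, ∑ q, eps A b p q * (F.cov Φ p q a - F.cov Φ q p a) := by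
      rw [Finset.mul_sum]
      refine Finset.sum_congr rfl fun b _ => ?_
      conv_lhs => rw [hh b]
      ring
    rw [e3, e2]
    set X := F.cov Φ c d a - F.cov Φ d c a
    set a1 := algebraMap ℝ A (1 / m)
    set a2 := algebraMap ℝ A m
    linear_combination -(a1 * a2 * (algebraMap ℝ A (1 / 2) * 2) * X) * hs - X * hm' - X * a1 * a2 * h2
  -- The sign s of the frame is constant: differentiate s² = 1 and multiply by s.
  · have e := congrArg (F.D i) hs
    simp at e
    have e' : F.D i s = 0 := eq_zero_of_two_mul (by linear_combination s * e - 2 * F.D i s * hs)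
    simp [e', hD]
end FrameCalculus
end TMG

/-! ### From coordinate components to frame components, over an arbitrary ring with derivations. -/

namespace TMG

/-- A metric `G`, its Levi-Civita connection `Γ` (written `Γ c a b` for `Γ^c_{ab}`) and an
orthonormal frame `e` (written `e i a` for `e_i^a`) in coordinates with partial derivatives `∂`. -/
structure CoordFrame (A : Type*) [CommRing A] [Algebra ℝ A] where
  /-- The partial derivatives. -/
  pd : Fin 3 → Derivation ℝ A A
  pd_comm : ∀ a b f, pd a (pd b f) = pd b (pd a f)
  /-- The metric. -/
  G : Fin 3 → Fin 3 → A
  /-- The Christoffel symbols. -/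
  Γ : Fin 3 → Fin 3 → Fin 3 → A
  /-- The frame. -/
  e : Fin 3 → Fin 3 → A
  G_symm : ∀ a b, G a b = G b a
  Γ_symm : ∀ c a b, Γ c a b = Γ c b a
  compat : ∀ c a b, pd c (G a b) = ∑ d, Γ d c a * G d b + ∑ d, Γ d c b * G a d
  orth : ∀ i j, ∑ a, ∑ b, G a b * e i a * e j b = if i = j then 1 else 0
  complete : ∀ a b, ∑ i, e i a * ∑ c, G b c * e i c = if a = b then 1 else 0

namespace CoordFrame

variable {A : Type*} [CommRing A] [Algebra ℝ A] (C : CoordFrame A)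

/-- The dual coframe `θ^i_a`. -/
def coframe (i a : Fin 3) : A := ∑ c, C.G a c * C.e i c

/-- The covariant derivative `∇_a V^b`. -/
def covVec (V : Fin 3 → A) (a b : Fin 3) : A := C.pd a (V b) + ∑ d, C.Γ b a d * V d

/-- The connection form `θ^k(∇_a e_j)`. -/
def conn (a j k : Fin 3) : A := ∑ b, C.coframe k b * C.covVec (C.e j) a b

/-- The connection coefficients `θ^k(∇_{e_i} e_j)`. -/
def γ (i j k : Fin 3) : A := ∑ a, C.e i a * C.conn a j k

/-- The frame derivative. -/
def D (i : Fin 3) : Derivation ℝ A A := ∑ a, C.e i a • C.pd a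

theorem D_apply (i : Fin 3) (f : A) : C.D i f = ∑ a, C.e i a * C.pd a f := by
  simp [D, Fin.sum_univ_three]

theorem coframe_e (i j : Fin 3) : ∑ a, C.coframe i a * C.e j a = if i = j then 1 else 0 := by
  rw [← C.orth i j]
  simp only [coframe, Finset.sum_mul]
  rw [Finset.sum_comm]
  refine Finset.sum_congr rfl fun a _ => Finset.sum_congr rfl fun b _ => ?_
  rw [C.G_symm]

theorem sum_e_coframe (a b : Fin 3) : ∑ i, C.e i a * C.coframe i b = if a = b then 1 else 0 :=
  C.complete a b

/-- Expansion of a vector in the frame. -/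
theorem expand (V : Fin 3 → A) (a : Fin 3) : V a = ∑ i, (∑ b, C.coframe i b * V b) * C.e i a := by
  have h := C.sum_e_coframe a
  have : V a = ∑ b, (if a = b then 1 else 0) * V b := by simp
  rw [this]
  simp only [← h, Finset.sum_mul]
  rw [Finset.sum_comm]
  exact Finset.sum_congr rfl fun i _ => Finset.sum_congr rfl fun b _ => by ring

theorem covVec_e (a j b : Fin 3) : C.covVec (C.e j) a b = ∑ k, C.conn a j k * C.e k b :=
  C.expand (fun b => C.covVec (C.e j) a b) b

/-- Differentiate g(e_j, e_k) = δ_jk and use that the connection is metric. -/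
theorem conn_antisymm (a j k : Fin 3) : C.conn a j k = - C.conn a k j := by
  have h := congrArg (C.pd a) (C.orth j k)
  have h0 : C.pd a (if j = k then 1 else 0) = 0 := by split_ifs <;> simp
  rw [h0] at h
  have s01 := C.G_symm 1 0
  have s02 := C.G_symm 2 0
  have s12 := C.G_symm 2 1
  simp only [map_add, Derivation.leibniz, C.compat, smul_eq_mul, Fin.sum_univ_three, s01, s02, s12] at h
  simp only [conn, coframe, covVec, Fin.sum_univ_three, s01, s02, s12]
  linear_combination h

theorem γ_antisymm (i j k : Fin 3) : C.γ i j k = - C.γ i k j := by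
  simp only [γ, C.conn_antisymm _ j k, mul_neg, Finset.sum_neg_distrib]

/-- The connection has no torsion: the Christoffel terms of ∇_{e_i} e_j - ∇_{e_j} e_i cancel and the
bracket is left. -/
theorem D_e (i j b : Fin 3) :
    C.D i (C.e j b) - C.D j (C.e i b) = ∑ k, (C.γ i j k - C.γ j i k) * C.e k b := by
  have h : ∀ i j, ∑ k, C.γ i j k * C.e k b = ∑ a, C.e i a * C.covVec (C.e j) a b := fun i j => by
    simp only [γ, C.covVec_e, Finset.sum_mul, Finset.mul_sum]
    rw [Finset.sum_comm]
    simp only [mul_assoc]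
  simp only [sub_mul, Finset.sum_sub_distrib, h, covVec, D_apply, Fin.sum_univ_three]
  rw [C.Γ_symm b 1 0, C.Γ_symm b 2 0, C.Γ_symm b 2 1]
  ring

theorem commutator (i j : Fin 3) (f : A) :
    C.D i (C.D j f) - C.D j (C.D i f) = ∑ k, (C.γ i j k - C.γ j i k) * C.D k f := by
  have h : ∑ k, (C.γ i j k - C.γ j i k) * C.D k f
      = ∑ b, (C.D i (C.e j b) - C.D j (C.e i b)) * C.pd b f := by
    simp only [C.D_e, D_apply C _ f, Finset.sum_mul, Finset.mul_sum]
    rw [Finset.sum_comm]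
    simp only [mul_assoc]
  rw [h]
  simp only [D_apply, map_add, Derivation.leibniz, smul_eq_mul, Fin.sum_univ_three,
    C.pd_comm 1 0, C.pd_comm 2 0, C.pd_comm 2 1]
  ring

/-- The frame calculus of an orthonormal frame in coordinates. -/
def frameCalculus : FrameCalculus A where
  D := C.D
  γ := C.γ
  antisymm := C.γ_antisymm
  commutator := C.commutator

/-- The Riemann tensor `R_{abd}^c`. -/
def riemann (a b d c : Fin 3) : A :=
  C.pd a (C.Γ c b d) - C.pd b (C.Γ c a d) + ∑ e, C.Γ c a e * C.Γ e b d - ∑ e, C.Γ c b e * C.Γ e a d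

/-- The Ricci tensor. -/
def ricci (a b : Fin 3) : A := ∑ c, C.riemann a c b c

theorem ricci_identity (V : Fin 3 → A) (a b c : Fin 3) :
    (C.pd a (C.covVec V b c) + ∑ d, C.Γ c a d * C.covVec V b d)
      - (C.pd b (C.covVec V a c) + ∑ d, C.Γ c b d * C.covVec V a d)
      = ∑ d, C.riemann a b d c * V d := by
  simp only [covVec, riemann, map_add, Derivation.leibniz, smul_eq_mul,
    Fin.sum_univ_three, C.pd_comm a b]
  ring

/-- Cartan's second structure equation: apply the Ricci identity to e_j and expand each covariant
derivative in the frame. -/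
theorem riemann_conn (a b j k : Fin 3) :
    ∑ c, C.coframe k c * ∑ d, C.riemann a b d c * C.e j d
      = C.pd a (C.conn b j k) - C.pd b (C.conn a j k)
        + ∑ m, (C.conn b j m * C.conn a m k - C.conn a j m * C.conn b m k) := by
  have h1 : ∀ a b c, C.pd a (C.covVec (C.e j) b c) + ∑ d, C.Γ c a d * C.covVec (C.e j) b d
      = ∑ k, (C.pd a (C.conn b j k) + ∑ m, C.conn b j m * C.conn a m k) * C.e k c := by
    intro a b c
    have h2 : ∑ k, (∑ m, C.conn b j m * C.conn a m k) * C.e k c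
        = ∑ m, C.conn b j m * C.covVec (C.e m) a c := by
      simp only [C.covVec_e, Finset.sum_mul, Finset.mul_sum]
      rw [Finset.sum_comm]
      simp only [mul_assoc]
    simp only [add_mul, Finset.sum_add_distrib, h2]
    simp only [C.covVec_e b j, map_sum, Derivation.leibniz, smul_eq_mul]
    simp only [covVec, Fin.sum_univ_three]
    ring
  have h3 : ∀ c, ∑ d, C.riemann a b d c * C.e j d
      = ∑ l, (C.pd a (C.conn b j l) - C.pd b (C.conn a j l)
        + ∑ m, (C.conn b j m * C.conn a m l - C.conn a j m * C.conn b m l)) * C.e l c := by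
    intro c
    rw [← C.ricci_identity, h1, h1, ← Finset.sum_sub_distrib]
    refine Finset.sum_congr rfl fun l _ => ?_
    rw [Finset.sum_sub_distrib]; ring
  have h4 : ∀ (X : Fin 3 → A), ∑ c, C.coframe k c * ∑ l, X l * C.e l c = X k := by
    intro X
    have : ∑ c, C.coframe k c * ∑ l, X l * C.e l c = ∑ l, X l * ∑ c, C.coframe k c * C.e l c := by
      simp only [Finset.mul_sum]; rw [Finset.sum_comm]
      exact Finset.sum_congr rfl fun _ _ => Finset.sum_congr rfl fun _ _ => by ring
    rw [this]; simp [coframe_e]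
  simp only [h3]
  exact h4 _

/-- Contracting the structure equation with e_i and e_j moves the frame vectors inside the
derivatives; the error is their bracket, which is the last sum in `FrameCalculus.riem`. -/
theorem riemann_frame (i j k l : Fin 3) :
    ∑ a, ∑ b, C.e i a * C.e j b * ∑ c, C.coframe l c * ∑ d, C.riemann a b d c * C.e k d
      = C.frameCalculus.riem i j k l := by
  have hD : ∀ i j, C.D i (C.γ j k l)
      = ∑ b, C.D i (C.e j b) * C.conn b k l + ∑ b, C.e j b * C.D i (C.conn b k l) := by
    intro i j
    simp only [γ, map_sum, Derivation.leibniz, smul_eq_mul, ← Finset.sum_add_distrib]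
    exact Finset.sum_congr rfl fun _ _ => by ring
  have hb : ∑ m, (C.γ i j m - C.γ j i m) * C.γ m k l
      = ∑ b, (C.D i (C.e j b) - C.D j (C.e i b)) * C.conn b k l := by
    simp only [C.D_e, γ, Finset.sum_mul, Finset.mul_sum]
    rw [Finset.sum_comm]
    simp only [mul_assoc]
  have hq : ∀ m, C.γ j k m * C.γ i m l - C.γ i k m * C.γ j m l = ∑ a, ∑ b, C.e i a * C.e j b *
      (C.conn b k m * C.conn a m l - C.conn a k m * C.conn b m l) := by
    intro m; simp only [γ, Fin.sum_univ_three]; ring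
  simp only [C.riemann_conn, FrameCalculus.riem, frameCalculus]
  rw [hb, hD i j, hD j i]
  simp only [hq]
  simp only [D_apply C _ (C.conn _ _ _), Fin.sum_univ_three]
  ring

/-- The frame components of a covariant tensor of valence two. -/
def frameComp (T : Fin 3 → Fin 3 → A) (i j : Fin 3) : A := ∑ a, ∑ b, C.e i a * C.e j b * T a b

theorem ricci_frame (i j : Fin 3) : C.frameComp C.ricci i j = C.frameCalculus.ric i j := by
  have h : ∀ a d, C.ricci a d = ∑ b, ∑ c, (∑ k, C.e k b * C.coframe k c) * C.riemann a b d c := by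
    intro a d
    simp [C.sum_e_coframe, ricci]
  simp only [frameComp, FrameCalculus.ric, ← C.riemann_frame, h]
  simp only [Fin.sum_univ_three]
  ring

theorem riemann_bianchi (a b d c : Fin 3) :
    C.riemann a b d c + C.riemann b d a c + C.riemann d a b c = 0 := by
  simp only [riemann, Fin.sum_univ_three]
  rw [C.Γ_symm _ b d, C.Γ_symm _ a d, C.Γ_symm _ b a, C.Γ_symm _ b d, C.Γ_symm _ a d, C.Γ_symm _ b a,
    C.Γ_symm _ b d, C.Γ_symm _ a d, C.Γ_symm _ b a, C.Γ_symm _ b d, C.Γ_symm _ a d, C.Γ_symm _ b a]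
  ring

theorem riem_bianchi (i j k l : Fin 3) :
    C.frameCalculus.riem i j k l + C.frameCalculus.riem j k i l + C.frameCalculus.riem k i j l
      = 0 := by
  have h : ∀ i j k, C.frameCalculus.riem i j k l
      = ∑ c, C.coframe l c * ∑ a, ∑ b, ∑ d, C.e i a * C.e j b * C.e k d * C.riemann a b d c := by
    intro i j k
    rw [← C.riemann_frame]
    simp only [Fin.sum_univ_three]
    ring
  have h2 : ∀ c, ∑ a, ∑ b, ∑ d, C.e i a * C.e j b * C.e k d * C.riemann a b d c
      + ∑ a, ∑ b, ∑ d, C.e j a * C.e k b * C.e i d * C.riemann a b d c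
      + ∑ a, ∑ b, ∑ d, C.e k a * C.e i b * C.e j d * C.riemann a b d c = 0 := by
    intro c
    have h3 : ∑ a, ∑ b, ∑ d, C.e i a * C.e j b * C.e k d *
      (C.riemann a b d c + C.riemann b d a c + C.riemann d a b c) = 0 := by
      simp [C.riemann_bianchi]
    rw [← h3]
    simp only [Fin.sum_univ_three]
    ring
  rw [h, h, h, ← Finset.sum_add_distrib, ← Finset.sum_add_distrib]
  refine Finset.sum_eq_zero fun c _ => ?_
  rw [← mul_add, ← mul_add, h2, mul_zero]

/-- Contract the first Bianchi identity. One of its three terms drops out, because the curvature is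
trace-free in its last two indices by the antisymmetry of γ; the pair symmetry of the Riemann tensor
is not needed. -/
theorem ric_symm (i j : Fin 3) : C.frameCalculus.ric i j = C.frameCalculus.ric j i := by
  refine Finset.sum_congr rfl fun k _ => ?_
  have h1 := C.riem_bianchi i k j k
  have h2 : ∀ i j, C.frameCalculus.riem i j k k = 0 := by
    intro i j
    have g0 := C.frameCalculus.γ_diag
    have s : ∀ m i j, C.frameCalculus.γ j k m * C.frameCalculus.γ i m k
        = - (C.frameCalculus.γ j k m * C.frameCalculus.γ i k m) := fun m i j => by
      rw [C.frameCalculus.antisymm i m k]; ring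
    simp [FrameCalculus.riem, g0, s, mul_comm]
  have h3 : C.frameCalculus.riem k j i k = - C.frameCalculus.riem j k i k := by
    simp only [FrameCalculus.riem, Fin.sum_univ_three]; ring
  rw [h2, h3] at h1
  linear_combination h1

/-- The covariant derivative `∇_c T_{ab}`. -/
def covTwo (T : Fin 3 → Fin 3 → A) (c a b : Fin 3) : A :=
  C.pd c (T a b) - ∑ d, C.Γ d c a * T d b - ∑ d, C.Γ d c b * T a d

theorem covTwo_conn (T : Fin 3 → Fin 3 → A) (p a b : Fin 3) :
    ∑ q, ∑ r, C.e a q * C.e b r * C.covTwo T p q r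
      = C.pd p (C.frameComp T a b) - ∑ m, C.conn p a m * C.frameComp T m b
        - ∑ m, C.conn p b m * C.frameComp T a m := by
  have h1 : ∑ m, C.conn p a m * C.frameComp T m b
      = ∑ q, ∑ r, C.covVec (C.e a) p q * C.e b r * T q r := by
    simp only [C.covVec_e, frameComp, Fin.sum_univ_three]
    ring
  have h2 : ∑ m, C.conn p b m * C.frameComp T a m
      = ∑ q, ∑ r, C.e a q * C.covVec (C.e b) p r * T q r := by
    simp only [C.covVec_e, frameComp, Fin.sum_univ_three]
    ring
  rw [h1, h2]
  simp only [frameComp, covVec, covTwo, Fin.sum_univ_three, map_add, Derivation.leibniz, smul_eq_mul]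
  ring

theorem covTwo_frame (T : Fin 3 → Fin 3 → A) (c a b : Fin 3) :
    ∑ p, C.e c p * ∑ q, ∑ r, C.e a q * C.e b r * C.covTwo T p q r
      = C.frameCalculus.cov (C.frameComp T) c a b := by
  simp only [covTwo_conn]
  simp only [FrameCalculus.cov, frameCalculus, D_apply, γ, Fin.sum_univ_three]
  ring

/-- The inverse metric. -/
def Ginv (a b : Fin 3) : A := ∑ i, C.e i a * C.e i b

theorem Ginv_mul (a b : Fin 3) : ∑ c, C.Ginv a c * C.G c b = if a = b then 1 else 0 := by
  rw [← C.complete a b]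
  simp only [Ginv, Finset.sum_mul, Finset.mul_sum]
  rw [Finset.sum_comm]
  refine Finset.sum_congr rfl fun i _ => Finset.sum_congr rfl fun c _ => ?_
  rw [C.G_symm]; ring

theorem trace_frame (T : Fin 3 → Fin 3 → A) :
    ∑ a, ∑ b, C.Ginv a b * T a b = ∑ i, C.frameComp T i i := by
  simp only [Ginv, frameComp, Fin.sum_univ_three]
  ring

theorem frameComp_G (i j : Fin 3) : C.frameComp C.G i j = if i = j then 1 else 0 := by
  rw [← C.orth]
  exact Finset.sum_congr rfl fun a _ => Finset.sum_congr rfl fun b _ => by ring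

theorem frameComp_add_mul (T S : Fin 3 → Fin 3 → A) (r t : A) (i j : Fin 3) :
    C.frameComp (fun a b => r * T a b + t * S a b) i j
      = r * C.frameComp T i j + t * C.frameComp S i j := by
  simp only [frameComp, Fin.sum_univ_three]
  ring

/-- The determinant of the frame. -/
def det : A := ∑ a, ∑ b, ∑ c, eps A a b c * C.e 0 a * C.e 1 b * C.e 2 c

theorem vol_frame (i j k : Fin 3) :
    ∑ a, ∑ b, ∑ c, eps A a b c * C.e i a * C.e j b * C.e k c = C.det * eps A i j k := by
  simp only [det]
  fin_cases i <;> fin_cases j <;> fin_cases k <;> simp [eps, Fin.sum_univ_three] <;> ring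

theorem sum_Ginv (f g : Fin 3 → A) :
    ∑ c, ∑ p, f p * C.Ginv p c * g c = ∑ k, (∑ p, f p * C.e k p) * ∑ c, C.e k c * g c := by
  simp only [Ginv, Fin.sum_univ_three]
  ring

/-- The inverse metric is the sum of the e_i ⊗ e_i, so each contraction with it becomes a sum over a
frame index. -/
theorem sum_Ginv_Ginv (V Y : Fin 3 → Fin 3 → A) :
    ∑ c, ∑ d, ∑ p, ∑ q, V p q * C.Ginv p c * C.Ginv q d * Y c d
      = ∑ k, ∑ l, (∑ p, ∑ q, V p q * C.e k p * C.e l q) * ∑ c, ∑ d, C.e k c * C.e l d * Y c d := by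
  have h1 : ∀ c, ∑ d, ∑ p, ∑ q, V p q * C.Ginv p c * C.Ginv q d * Y c d
      = ∑ p, (∑ l, (∑ q, V p q * C.e l q) * ∑ d, C.e l d * Y c d) * C.Ginv p c := by
    intro c
    rw [Finset.sum_comm]
    refine Finset.sum_congr rfl fun p _ => ?_
    rw [← sum_Ginv]
    simp only [Finset.sum_mul]
    exact Finset.sum_congr rfl fun _ _ => Finset.sum_congr rfl fun _ _ => by ring
  have h2 : ∀ c, ∑ p, (∑ l, (∑ q, V p q * C.e l q) * ∑ d, C.e l d * Y c d) * C.Ginv p c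
      = ∑ l, ∑ p, (∑ q, V p q * C.e l q) * C.Ginv p c * ∑ d, C.e l d * Y c d := by
    intro c
    simp only [Finset.sum_mul]
    rw [Finset.sum_comm]
    exact Finset.sum_congr rfl fun _ _ => Finset.sum_congr rfl fun _ _ =>
      Finset.sum_congr rfl fun _ _ => by ring
  simp only [h1, h2]
  rw [Finset.sum_comm]
  simp only [sum_Ginv]
  rw [Finset.sum_comm]
  refine Finset.sum_congr rfl fun k _ => Finset.sum_congr rfl fun l _ => ?_
  congr 1
  · simp only [Finset.sum_mul]
    exact Finset.sum_congr rfl fun _ _ => Finset.sum_congr rfl fun _ _ => by ring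
  · simp only [Finset.mul_sum]
    exact Finset.sum_congr rfl fun _ _ => Finset.sum_congr rfl fun _ _ => by ring

/-- The factor `v * C.det` is the value of the volume form on the frame. Everything else is
tensorial, so the frame components have the form of the coordinate expression with the metric
replaced by the identity. -/
theorem dualCotton_frame (P : Fin 3 → Fin 3 → A) (v h : A) (i j : Fin 3) :
    C.frameComp (fun a b => h * ∑ c, ∑ d, ∑ p, ∑ q, v * eps A b p q * C.Ginv p c * C.Ginv q d *
        (C.covTwo P c d a - C.covTwo P d c a)) i j
      = h * ∑ k, ∑ l, (v * C.det) * eps A j k l *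
        (C.frameCalculus.cov (C.frameComp P) k l i - C.frameCalculus.cov (C.frameComp P) l k i) := by
  have hX : ∀ k l, C.frameCalculus.cov (C.frameComp P) k l i
        - C.frameCalculus.cov (C.frameComp P) l k i
      = ∑ a, C.e i a * ∑ c, ∑ d, C.e k c * C.e l d * (C.covTwo P c d a - C.covTwo P d c a) := by
    intro k l
    simp only [← C.covTwo_frame, Fin.sum_univ_three]
    ring
  have hV : ∀ k l, (v * C.det) * eps A j k l
      = ∑ b, C.e j b * ∑ p, ∑ q, v * eps A b p q * C.e k p * C.e l q := by
    intro k l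
    rw [mul_assoc, ← C.vol_frame]
    simp only [Finset.mul_sum]
    exact Finset.sum_congr rfl fun _ _ => Finset.sum_congr rfl fun _ _ =>
      Finset.sum_congr rfl fun _ _ => by ring
  simp only [hX, hV, frameComp]
  simp only [C.sum_Ginv_Ginv fun p q => v * eps A _ p q]
  generalize hW : (fun b k l => ∑ p, ∑ q, v * eps A b p q * C.e k p * C.e l q) = W
  generalize hY : (fun a k l => ∑ c, ∑ d, C.e k c * C.e l d *
    (C.covTwo P c d a - C.covTwo P d c a)) = Y
  have hW' : ∀ b k l, ∑ p, ∑ q, v * eps A b p q * C.e k p * C.e l q = W b k l := fun b k l => by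
    rw [← hW]
  have hY' : ∀ a k l, ∑ c, ∑ d, C.e k c * C.e l d * (C.covTwo P c d a - C.covTwo P d c a)
      = Y a k l := fun a k l => by rw [← hY]
  simp only [hW', hY']
  simp only [Fin.sum_univ_three]
  ring

end CoordFrame
end TMG

/-! ### The Levi-Civita connection, the field equations and the shear-free condition in a frame. -/

namespace TMG
namespace CoordFrame

variable {A : Type*} [CommRing A] [Algebra ℝ A]

theorem algebraMap_half : algebraMap ℝ A (1 / 2) * 2 = 1 := by
  rw [show (2 : A) = algebraMap ℝ A 2 from (map_ofNat _ 2).symm, ← map_mul]; norm_num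

section OfMetric

omit [Algebra ℝ A] in
theorem complete_of_orth (G e : Fin 3 → Fin 3 → A)
    (orth : ∀ i j, ∑ a, ∑ b, G a b * e i a * e j b = if i = j then 1 else 0) (a b : Fin 3) :
    ∑ i, e i a * ∑ c, G b c * e i c = if a = b then 1 else 0 := by
  have h : (Matrix.of e) * (Matrix.of G * (Matrix.of e).transpose) = 1 := by
    ext i j
    rw [Matrix.one_apply, ← orth]
    simp only [Matrix.mul_apply, Matrix.of_apply, Matrix.transpose_apply, Finset.mul_sum]
    exact Finset.sum_congr rfl fun _ _ => Finset.sum_congr rfl fun _ _ => by ring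
  have h1 : (Matrix.of G * (Matrix.of e).transpose) * Matrix.of e = 1 := mul_eq_one_comm.1 h
  have h2 := congrFun (congrFun h1 b) a
  rw [Matrix.one_apply] at h2
  simp only [Matrix.mul_apply, Matrix.of_apply, Matrix.transpose_apply] at h2
  rw [if_congr eq_comm rfl rfl, ← h2]
  exact Finset.sum_congr rfl fun _ _ => by ring

variable (pd : Fin 3 → Derivation ℝ A A) (pd_comm : ∀ a b f, pd a (pd b f) = pd b (pd a f))
  (G e : Fin 3 → Fin 3 → A) (G_symm : ∀ a b, G a b = G b a)
  (orth : ∀ i j, ∑ a, ∑ b, G a b * e i a * e j b = if i = j then 1 else 0)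

/-- The coordinate frame data with the Christoffel symbols of the metric `G`. -/
noncomputable def ofMetric : CoordFrame A where
  pd := pd
  pd_comm := pd_comm
  G := G
  e := e
  Γ c a b := algebraMap ℝ A (1 / 2) * ∑ d, (∑ i, e i c * e i d) *
    (pd a (G b d) + pd b (G a d) - pd d (G a b))
  G_symm := G_symm
  Γ_symm c a b := by
    congr 1
    refine Finset.sum_congr rfl fun d _ => ?_
    rw [G_symm a b]; ring
  orth := orth
  complete := complete_of_orth G e orth
  compat := by
    have hc := complete_of_orth G e orth
    -- Raising an index and lowering it again. The two Christoffel terms then have six derivatives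
    -- of the metric in all; four cancel and two equal `pd c (G a b)`.
    have key : ∀ (b : Fin 3) (X : Fin 3 → A),
        ∑ d, (∑ f, (∑ i, e i d * e i f) * X f) * G d b = X b := by
      intro b X
      have : ∑ d, (∑ f, (∑ i, e i d * e i f) * X f) * G d b
          = ∑ f, (∑ i, e i f * ∑ c, G b c * e i c) * X f := by
        simp only [G_symm _ b, Fin.sum_univ_three]; ring
      rw [this]; simp [hc]
    intro c a b
    have h1 : ∀ a b, ∑ d, (algebraMap ℝ A (1 / 2) * ∑ f, (∑ i, e i d * e i f) *
        (pd c (G a f) + pd a (G c f) - pd f (G c a))) * G d b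
        = algebraMap ℝ A (1 / 2) * (pd c (G a b) + pd a (G c b) - pd b (G c a)) := by
      intro a b
      rw [← key b fun f => pd c (G a f) + pd a (G c f) - pd f (G c a), Finset.mul_sum]
      exact Finset.sum_congr rfl fun _ _ => by ring
    have h2 := h1 b a
    simp only [G_symm _ a] at h2
    rw [h1, h2, G_symm c a, G_symm c b]
    linear_combination (-pd c (G a b)) * algebraMap_half (A := A)

end OfMetric

variable (C : CoordFrame A)

/-- The Ricci scalar. -/
noncomputable def scalarCurv : A := ∑ a, ∑ b, C.Ginv a b * C.ricci a b

/-- The Schouten tensor. -/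
noncomputable def schouten (a b : Fin 3) : A :=
  -(C.ricci a b - algebraMap ℝ A (1 / 3) * C.scalarCurv * C.G a b)
    - algebraMap ℝ A (1 / 12) * C.scalarCurv * C.G a b

theorem scalarCurv_frame : C.scalarCurv = ∑ k, C.frameCalculus.ric k k := by
  rw [scalarCurv, trace_frame]
  simp only [ricci_frame]

theorem schouten_frame (i j : Fin 3) : C.frameComp C.schouten i j = - C.frameCalculus.ric i j
    + if i = j then algebraMap ℝ A (1 / 4) * ∑ k, C.frameCalculus.ric k k else 0 := by
  have h : algebraMap ℝ A (1 / 4) = algebraMap ℝ A (1 / 3) - algebraMap ℝ A (1 / 12) := by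
    rw [← map_sub]; norm_num
  have : C.schouten = fun a b => (-1) * C.ricci a b
      + (algebraMap ℝ A (1 / 4) * C.scalarCurv) * C.G a b := by
    funext a b
    rw [schouten, h]; ring
  rw [this, frameComp_add_mul, ricci_frame, frameComp_G, ← scalarCurv_frame]
  split_ifs <;> ring

/-- The topological massive gravity equations imply that the scalar curvature is constant and that
the tracefree Ricci tensor satisfies the curl equation. -/
theorem curlEquation {m Λ : ℝ} (hm : m ≠ 0) {v : A} (hv : (v * C.det) * (v * C.det) = 1)
    (h : ∀ a b, C.ricci a b - algebraMap ℝ A (1 / 2) * C.scalarCurv * C.G a b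
        + algebraMap ℝ A Λ * C.G a b
      = algebraMap ℝ A (1 / m) * (algebraMap ℝ A (1 / 2) * ∑ c, ∑ d, ∑ p, ∑ q,
          v * eps A b p q * C.Ginv p c * C.Ginv q d *
            (C.covTwo C.schouten c d a - C.covTwo C.schouten d c a))) :
    C.scalarCurv = algebraMap ℝ A (6 * Λ) ∧
    C.frameCalculus.CurlEquation (fun i j => C.frameCalculus.ric i j
      - if i = j then algebraMap ℝ A (2 * Λ) else 0)
      (algebraMap ℝ A (2 * Λ)) (algebraMap ℝ A m * (v * C.det)) := by
  rw [scalarCurv_frame]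
  refine FrameCalculus.curlEquation_of_tmg C.ric_symm hm hv C.schouten_frame fun i j => ?_
  have e1 : C.frameComp (fun a b => C.ricci a b
        - algebraMap ℝ A (1 / 2) * C.scalarCurv * C.G a b + algebraMap ℝ A Λ * C.G a b) i j
      = C.frameCalculus.ric i j + (if i = j then algebraMap ℝ A Λ
        - algebraMap ℝ A (1 / 2) * ∑ k, C.frameCalculus.ric k k else 0) := by
    have : (fun a b => C.ricci a b
        - algebraMap ℝ A (1 / 2) * C.scalarCurv * C.G a b + algebraMap ℝ A Λ * C.G a b)
        = fun a b => 1 * C.ricci a b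
          + (algebraMap ℝ A Λ - algebraMap ℝ A (1 / 2) * C.scalarCurv) * C.G a b := by
      funext a b; ring
    rw [this, frameComp_add_mul, ricci_frame, frameComp_G, ← scalarCurv_frame]
    split_ifs <;> ring
  rw [← e1]
  simp only [h, ← mul_assoc (algebraMap ℝ A (1 / m))]
  rw [C.dualCotton_frame]

/-- `∇_a V_b`. -/
noncomputable def covLow (V : Fin 3 → A) (a b : Fin 3) : A := ∑ c, C.G b c * C.covVec V a c

theorem covLow_frame (i j k : Fin 3) : C.frameComp (C.covLow (C.e k)) i j = C.γ i k j := by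
  simp only [frameComp, covLow, γ, conn, coframe, Fin.sum_univ_three, C.G_symm 1 0, C.G_symm 2 0,
    C.G_symm 2 1]
  ring

theorem divergence_frame (k : Fin 3) : ∑ c, C.covVec (C.e k) c c = ∑ i, C.γ i k i := by
  simp only [C.covVec_e, γ, Fin.sum_univ_three]
  ring

/-- `u^c ∇_c u_a` for `u = e_2`. -/
noncomputable def accel (a : Fin 3) : A := ∑ c, C.e 2 c * C.covLow (C.e 2) c a

theorem accel_frame (i : Fin 3) : ∑ a, C.e i a * C.accel a = C.γ 2 2 i := by
  rw [← covLow_frame]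
  simp only [accel, frameComp, Fin.sum_univ_three]
  ring

/-- The trace-free symmetrised derivative of `u = e_2`. -/
noncomputable def shear (a b : Fin 3) : A :=
  algebraMap ℝ A (1 / 2) * (C.covLow (C.e 2) a b + C.covLow (C.e 2) b a)
    - algebraMap ℝ A (1 / 2) * (C.G a b - C.coframe 2 a * C.coframe 2 b)
      * ∑ c, C.covVec (C.e 2) c c
    - algebraMap ℝ A (1 / 2) * (C.accel a * C.coframe 2 b + C.accel b * C.coframe 2 a)

theorem shear_frame (i j : Fin 3) : C.frameComp C.shear i j
    = algebraMap ℝ A (1 / 2) * (C.γ i 2 j + C.γ j 2 i)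
    - algebraMap ℝ A (1 / 2) * ((if i = j then 1 else 0)
        - (if 2 = i then 1 else 0) * (if 2 = j then 1 else 0)) * ∑ k, C.γ k 2 k
    - algebraMap ℝ A (1 / 2) * (C.γ 2 2 i * (if 2 = j then 1 else 0)
        + C.γ 2 2 j * (if 2 = i then 1 else 0)) := by
  have h1 : C.frameComp C.shear i j = algebraMap ℝ A (1 / 2) *
        (C.frameComp (C.covLow (C.e 2)) i j + C.frameComp (C.covLow (C.e 2)) j i)
      - algebraMap ℝ A (1 / 2) * (C.frameComp C.G i j
        - (∑ a, C.coframe 2 a * C.e i a) * (∑ a, C.coframe 2 a * C.e j a)) *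
        ∑ c, C.covVec (C.e 2) c c
      - algebraMap ℝ A (1 / 2) * ((∑ a, C.e i a * C.accel a) * (∑ a, C.coframe 2 a * C.e j a)
        + (∑ a, C.e j a * C.accel a) * (∑ a, C.coframe 2 a * C.e i a)) := by
    simp only [frameComp, shear]
    generalize ∑ c, C.covVec (C.e 2) c c = d
    simp only [Fin.sum_univ_three]
    ring
  rw [h1]
  simp only [covLow_frame, frameComp_G, coframe_e, accel_frame, divergence_frame]

theorem eq_sum_frameComp (T : Fin 3 → Fin 3 → A) (a b : Fin 3) :
    T a b = ∑ i, ∑ j, C.coframe i a * C.coframe j b * C.frameComp T i j := by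
  have h := C.sum_e_coframe
  have : ∑ i, ∑ j, C.coframe i a * C.coframe j b * C.frameComp T i j
      = ∑ p, ∑ q, (∑ i, C.e i p * C.coframe i a) * (∑ j, C.e j q * C.coframe j b) * T p q := by
    simp only [frameComp, Fin.sum_univ_three]; ring
  rw [this]; simp [h]

/-- Both conditions are tensorial, hence equivalent to their frame components. The shear components
involving e_2 vanish identically, as the acceleration terms are subtracted; among the others only 00
and 01 are independent, since the tensor is symmetric and has no trace. -/
theorem shearFreeGeodesic_iff : C.frameCalculus.ShearFreeGeodesic ↔
    (∀ a, ∑ b, C.e 2 b * C.covVec (C.e 2) b a = 0) ∧ ∀ a b, C.shear a b = 0 := by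
  have hg : ∀ k, ∑ a, C.coframe k a * ∑ b, C.e 2 b * C.covVec (C.e 2) b a = C.γ 2 2 k := by
    intro k
    simp only [γ, conn, Fin.sum_univ_three]; ring
  have h22 : ∀ i, C.γ i 2 2 = 0 := fun i => C.frameCalculus.γ_diag i 2
  have hh := algebraMap_half (A := A)
  constructor
  · rintro ⟨h1, h2, h3⟩
    change ∀ k, C.γ 2 2 k = 0 at h1
    change C.γ 1 2 1 = C.γ 0 2 0 at h2
    change C.γ 1 2 0 = - C.γ 0 2 1 at h3
    refine ⟨fun a => ?_, fun a b => ?_⟩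
    · rw [C.expand (fun a => ∑ b, C.e 2 b * C.covVec (C.e 2) b a) a]
      simp [hg, h1]
    · rw [C.eq_sum_frameComp C.shear a b]
      refine Finset.sum_eq_zero fun i _ => Finset.sum_eq_zero fun j _ => ?_
      rw [shear_frame]
      fin_cases i <;> fin_cases j <;> simp [h1, h2, h3, h22, Fin.sum_univ_three]
  · rintro ⟨h1, h2⟩
    have h4 : ∀ k, C.γ 2 2 k = 0 := fun k => by rw [← hg]; simp [h1]
    have h5 : ∀ i j, C.frameComp C.shear i j = 0 := fun i j => by simp [frameComp, h2]
    have e00 := h5 0 0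
    have e01 := h5 0 1
    rw [shear_frame] at e00 e01
    simp only [Fin.sum_univ_three, h22] at e00 e01
    simp at e00 e01
    rw [show algebraMap ℝ A 2⁻¹ = algebraMap ℝ A (1/2) by norm_num] at e00 e01
    refine ⟨h4, ?_, ?_⟩
    · change C.γ 1 2 1 = C.γ 0 2 0
      linear_combination -2 * e00 + (C.γ 0 2 0 - C.γ 1 2 1) * hh
    · change C.γ 1 2 0 = - C.γ 0 2 1
      linear_combination 2 * e01 - (C.γ 0 2 1 + C.γ 1 2 0) * hh

end CoordFrame
end TMG

namespace TMG

/-! ### The ring of smooth functions on an open set -/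

/-- Extension of a function by zero. -/
noncomputable def extendZero {O : Set E3} (f : O → ℝ) (x : E3) : ℝ :=
  open Classical in if h : x ∈ O then f ⟨x, h⟩ else 0

theorem extendZero_apply {O : Set E3} (f : O → ℝ) (x : O) : extendZero f x = f x := by
  simp [extendZero]

/-- The algebra of smooth functions on a set. -/
noncomputable def SmoothFun (O : Set E3) : Subalgebra ℝ (O → ℝ) where
  -- The extension by zero turns a function on the subtype into a function on all of `E3`, to which
  -- `fderiv` applies. For open O the derivatives at points of O do not depend on the extension.
  carrier := {f | ContDiffOn ℝ ∞ (extendZero f) O}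
  mul_mem' {f g} hf hg := (ContDiffOn.mul hf hg).congr fun x hx => by simp [extendZero, hx]
  add_mem' {f g} hf hg := (ContDiffOn.add hf hg).congr fun x hx => by simp [extendZero, hx]
  algebraMap_mem' r := (contDiffOn_const (c := r)).congr fun x hx => by simp [extendZero, hx]

namespace SmoothFun

variable {O : Set E3}

/-- A smooth function as an element of the algebra. -/
noncomputable def mk (f : E3 → ℝ) (hf : ContDiffOn ℝ ∞ f O) : SmoothFun O :=
  ⟨fun x => f x, hf.congr fun x hx => by simp [extendZero, hx]⟩

theorem ext_apply {f g : SmoothFun O} (h : ∀ x : O, f.1 x = g.1 x) : f = g :=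
  Subtype.ext (funext h)

/-- Evaluation at a point. -/
noncomputable def eval (x : O) : SmoothFun O →ₐ[ℝ] ℝ :=
  (Pi.evalAlgHom ℝ (fun _ : O => ℝ) x).comp (SmoothFun O).val

theorem eval_mk (f : E3 → ℝ) (hf : ContDiffOn ℝ ∞ f O) (x : O) : eval x (mk f hf) = f x := rfl

theorem eval_ext {f g : SmoothFun O} (h : ∀ x : O, eval x f = eval x g) : f = g := ext_apply h

theorem extendZero_eq (f : SmoothFun O) {x : E3} (hx : x ∈ O) :
    extendZero f.1 x = eval ⟨x, hx⟩ f := extendZero_apply f.1 ⟨x, hx⟩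

theorem contDiffOn_pd (hO : IsOpen O) {f : E3 → ℝ} (hf : ContDiffOn ℝ ∞ f O) (a : Fin 3) :
    ContDiffOn ℝ ∞ (pd a f) O :=
  (hf.fderiv_of_isOpen hO (by simp)).clm_apply contDiffOn_const

theorem pd_congr (hO : IsOpen O) {f g : E3 → ℝ} (h : ∀ x ∈ O, f x = g x) (a : Fin 3) {x : E3}
    (hx : x ∈ O) : pd a f x = pd a g x := by
  have : f =ᶠ[𝓝 x] g := Filter.eventuallyEq_of_mem (hO.mem_nhds hx) h
  rw [pd, pd, this.fderiv_eq]

theorem differentiableAt (hO : IsOpen O) (f : SmoothFun O) (x : O) :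
    DifferentiableAt ℝ (extendZero f.1) x :=
  (ContDiffOn.contDiffAt f.2 (hO.mem_nhds x.2)).differentiableAt (by simp)

/-- Partial derivatives as derivations. -/
noncomputable def pdD (hO : IsOpen O) (a : Fin 3) : Derivation ℝ (SmoothFun O) (SmoothFun O) :=
  Derivation.mk'
    { toFun f := mk (pd a (extendZero f.1)) (contDiffOn_pd hO f.2 a)
      map_add' f g := by
        refine eval_ext fun x => ?_
        rw [map_add, eval_mk, eval_mk, eval_mk]
        rw [pd_congr hO (g := extendZero f.1 + extendZero g.1)
          (fun y hy => by simp [extendZero, hy]) a x.2]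
        rw [pd, fderiv_add (SmoothFun.differentiableAt hO f x) (SmoothFun.differentiableAt hO g x)]
        rfl
      map_smul' r f := by
        refine eval_ext fun x => ?_
        rw [map_smul, eval_mk, eval_mk]
        rw [pd_congr hO (g := r • extendZero f.1)
          (fun y hy => by simp [extendZero, hy]) a x.2]
        rw [pd, fderiv_const_smul (SmoothFun.differentiableAt hO f x)]
        rfl }
    (fun f g => by
      refine eval_ext fun x => ?_
      simp only [LinearMap.coe_mk, AddHom.coe_mk, smul_eq_mul, map_add, map_mul, eval_mk]
      rw [pd_congr hO (g := extendZero f.1 * extendZero g.1)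
          (fun y hy => by simp [extendZero, hy]) a x.2]
      rw [pd, fderiv_mul (SmoothFun.differentiableAt hO f x) (SmoothFun.differentiableAt hO g x)]
      simp [pd, extendZero_eq])

theorem eval_pdD (hO : IsOpen O) (a : Fin 3) {f : SmoothFun O} {F : E3 → ℝ}
    (h : ∀ x, eval x f = F x) (x : O) : eval x (pdD hO a f) = pd a F x := by
  change pd a (extendZero f.1) x = _
  exact pd_congr hO (fun y hy => by rw [SmoothFun.extendZero_eq f hy, h]) a x.2

theorem pd_pd_comm {f : E3 → ℝ} {x : E3} (hf : ContDiffAt ℝ ∞ f x) (a b : Fin 3) :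
    pd a (pd b f) x = pd b (pd a f) x := by
  have hs : IsSymmSndFDerivAt ℝ f x := hf.isSymmSndFDerivAt (by simp; exact WithTop.coe_le_coe.2 le_top)
  have hd : DifferentiableAt ℝ (fderiv ℝ f) x :=
    (hf.fderiv_right (m := ∞) (by simp)).differentiableAt (by simp)
  have h : ∀ a b, pd a (pd b f) x
      = fderiv ℝ (fderiv ℝ f) x (EuclideanSpace.single a 1) (EuclideanSpace.single b 1) := by
    intro a b
    change fderiv ℝ (fun y => fderiv ℝ f y (EuclideanSpace.single b 1)) x _ = _
    rw [fderiv_clm_apply hd (differentiableAt_const _)]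
    simp
  rw [h, h]
  exact hs _ _

theorem pdD_comm (hO : IsOpen O) (a b : Fin 3) (f : SmoothFun O) :
    pdD hO a (pdD hO b f) = pdD hO b (pdD hO a f) := by
  refine eval_ext fun x => ?_
  have h1 : ∀ a, ∀ y, eval y (pdD hO a f) = pd a (extendZero f.1) y := fun a y => rfl
  rw [eval_pdD hO a (h1 b), eval_pdD hO b (h1 a)]
  exact pd_pd_comm (ContDiffOn.contDiffAt f.2 (hO.mem_nhds x.2)) a b

theorem eval_algebraMap (r : ℝ) (x : O) : eval x (algebraMap ℝ (SmoothFun O) r) = r := rfl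

end SmoothFun

/-! ### The frame identities evaluated on an open set of coordinates. -/

/-- A smooth metric with a smooth orthonormal frame on an open set of coordinates. -/
structure LocalFrame (O : Set E3) (G : E3 → Matrix (Fin 3) (Fin 3) ℝ)
    (e : Fin 3 → Fin 3 → E3 → ℝ) : Prop where
  isOpen : IsOpen O
  smooth_G : ∀ a b, ContDiffOn ℝ ∞ (fun x => G x a b) O
  smooth_e : ∀ i a, ContDiffOn ℝ ∞ (e i a) O
  symm : ∀ x ∈ O, ∀ a b, G x a b = G x b a
  orth : ∀ x ∈ O, ∀ i j, ∑ a, ∑ b, G x a b * e i a x * e j b x = if i = j then 1 else 0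

namespace LocalFrame

open SmoothFun

variable {O : Set E3} {G : E3 → Matrix (Fin 3) (Fin 3) ℝ} {e : Fin 3 → Fin 3 → E3 → ℝ}
  (F : LocalFrame O G e)

/-- The coordinate frame data over the ring of smooth functions. -/
noncomputable def coord : CoordFrame (SmoothFun O) :=
  CoordFrame.ofMetric (pdD F.isOpen) (pdD_comm F.isOpen)
    (fun a b => SmoothFun.mk (fun x => G x a b) (F.smooth_G a b))
    (fun i a => SmoothFun.mk (e i a) (F.smooth_e i a))
    (fun a b => eval_ext fun x => F.symm x x.2 a b)
    (fun i j => eval_ext fun x => by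
      simp only [map_sum, map_mul, eval_mk, F.orth x x.2]
      split_ifs <;> simp)

theorem eval_G (a b : Fin 3) (x : O) : eval x (F.coord.G a b) = G x a b := rfl

theorem eval_e (i a : Fin 3) (x : O) : eval x (F.coord.e i a) = e i a x := rfl

/-- The frame expression for the inverse metric is a left inverse of the matrix of the metric. This
identifies the abstract Christoffel symbols with the coordinate ones. -/
theorem eval_Ginv (a b : Fin 3) (x : O) : eval x (F.coord.Ginv a b) = (G x)⁻¹ a b := by
  have h : (Matrix.of fun a b => eval x (F.coord.Ginv a b)) * G x = 1 := by
    ext a b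
    have h := congrArg (eval x) (F.coord.Ginv_mul a b)
    rw [map_sum] at h
    simp only [map_mul, eval_G] at h
    rw [Matrix.mul_apply, Matrix.one_apply]
    simp only [Matrix.of_apply, h]
    split_ifs <;> simp
  rw [Matrix.inv_eq_left_inv h]; rfl

theorem eval_pd (a : Fin 3) {f : SmoothFun O} {g : E3 → ℝ}
    (h : ∀ x, eval x f = g x) (x : O) : eval x (F.coord.pd a f) = pd a g x :=
  eval_pdD F.isOpen a h x

theorem eval_Γ (c a b : Fin 3) (x : O) : eval x (F.coord.Γ c a b) = christoffel G c a b x := by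
  have h : F.coord.Γ c a b = algebraMap ℝ _ (1 / 2) * ∑ d, F.coord.Ginv c d *
    (F.coord.pd a (F.coord.G b d) + F.coord.pd b (F.coord.G a d)
      - F.coord.pd d (F.coord.G a b)) := rfl
  rw [h, map_mul, eval_algebraMap, map_sum, christoffel]
  have hG : ∀ a b c (x : O), eval x (F.coord.pd a (F.coord.G b c)) = pd a (fun y => G y b c) x :=
    fun a b c x => F.eval_pd a (g := fun y => G y b c) (F.eval_G b c) x
  simp only [map_mul, map_add, map_sub, eval_Ginv, hG]

theorem eval_riemann (a b d c : Fin 3) (x : O) :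
    eval x (F.coord.riemann a b d c) = riemann G a b d c x := by
  simp only [CoordFrame.riemann, riemann, map_add, map_sub, map_sum, map_mul, eval_Γ,
    F.eval_pd _ (F.eval_Γ _ _ _)]

theorem eval_ricci (a b : Fin 3) (x : O) : eval x (F.coord.ricci a b) = ricci G a b x := by
  simp only [CoordFrame.ricci, ricci, map_sum, eval_riemann]

theorem eval_scalarCurv (x : O) : eval x F.coord.scalarCurv = scalarCurv G x := by
  simp only [CoordFrame.scalarCurv, scalarCurv, map_sum, map_mul, eval_ricci, eval_Ginv]

theorem eval_schouten (a b : Fin 3) (x : O) :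
    eval x (F.coord.schouten a b) = schouten G a b x := by
  simp only [CoordFrame.schouten, schouten, tracefreeRicci, map_sub, map_neg, map_mul,
    eval_algebraMap, eval_ricci, eval_scalarCurv, eval_G]

theorem eval_covTwo {T : Fin 3 → Fin 3 → SmoothFun O} {S : Fin 3 → Fin 3 → E3 → ℝ}
    (h : ∀ a b x, eval x (T a b) = S a b x) (c a b : Fin 3) (x : O) :
    eval x (F.coord.covTwo T c a b) = covDerivTwo G S c a b x := by
  simp only [CoordFrame.covTwo, covDerivTwo, map_sub, map_sum, map_mul, eval_Γ, h,
    F.eval_pd _ (h _ _)]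

theorem eval_covVec {V : Fin 3 → SmoothFun O} {W : Fin 3 → E3 → ℝ}
    (h : ∀ a x, eval x (V a) = W a x) (a b : Fin 3) (x : O) :
    eval x (F.coord.covVec V a b) = covDerivVec G W a b x := by
  simp only [CoordFrame.covVec, covDerivVec, map_add, map_sum, map_mul, eval_Γ, h,
    F.eval_pd _ (h _)]

theorem eval_covLow {V : Fin 3 → SmoothFun O} {W : Fin 3 → E3 → ℝ}
    (h : ∀ a x, eval x (V a) = W a x) (a b : Fin 3) (x : O) :
    eval x (F.coord.covLow V a b) = covDerivLow G W a b x := by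
  simp only [CoordFrame.covLow, covDerivLow, map_sum, map_mul, eval_G, F.eval_covVec h]

theorem eval_coframe (i a : Fin 3) (x : O) :
    eval x (F.coord.coframe i a) = lower G (e i) a x := by
  simp only [CoordFrame.coframe, lower, map_sum, map_mul, eval_G, eval_e]

theorem eval_accel (a : Fin 3) (x : O) :
    eval x (F.coord.accel a) = acceleration G (e 2) a x := by
  simp only [CoordFrame.accel, acceleration, map_sum, map_mul, eval_e, F.eval_covLow (F.eval_e 2)]

theorem shearFreeGeodesic_iff : F.coord.frameCalculus.ShearFreeGeodesic ↔
    ∀ x ∈ O, IsGeodesicAt G (e 2) x ∧ IsShearFreeAt G (e 2) x := by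
  have h1 : ∀ (x : O) a, eval x (∑ b, F.coord.e 2 b * F.coord.covVec (F.coord.e 2) b a)
      = ∑ b, e 2 b x * covDerivVec G (e 2) b a x := fun x a => by
    simp only [map_sum, map_mul, eval_e, F.eval_covVec (F.eval_e 2)]
  have h2 : ∀ (x : O) a b, eval x (F.coord.shear a b)
      = (1 / 2) * (covDerivLow G (e 2) a b x + covDerivLow G (e 2) b a x)
      - (1 / 2) * (G x a b - lower G (e 2) a x * lower G (e 2) b x) * divergence G (e 2) x
      - (1 / 2) * (acceleration G (e 2) a x * lower G (e 2) b x
        + acceleration G (e 2) b x * lower G (e 2) a x) := fun x a b => by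
    simp only [CoordFrame.shear, map_sub, map_add, map_mul, map_sum, eval_algebraMap, eval_coframe,
      eval_accel, F.eval_covLow (F.eval_e 2), F.eval_covVec (F.eval_e 2), eval_G, divergence]
  rw [CoordFrame.shearFreeGeodesic_iff]
  constructor
  · rintro ⟨h3, h4⟩ x hx
    refine ⟨fun a => ?_, fun a b => ?_⟩
    · rw [← h1 ⟨x, hx⟩, h3, map_zero]
    · rw [← h2 ⟨x, hx⟩, h4, map_zero]
  · intro h
    refine ⟨fun a => eval_ext fun x => ?_, fun a b => eval_ext fun x => ?_⟩
    · rw [h1, map_zero]; exact (h x x.2).1 a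
    · rw [h2, map_zero]; exact (h x x.2).2 a b

/-- The tensor `Φ` is of the form `φ (3 u u - g)` with a unit vector `u`. -/
structure _root_.TMG.IsUniaxial (g Φ : Matrix (Fin 3) (Fin 3) ℝ) (φ : ℝ) (u : Fin 3 → ℝ) : Prop where
  unit : ∑ a, ∑ b, g a b * u a * u b = 1
  eq : ∀ a b, Φ a b = φ * (3 * (∑ c, g a c * u c) * (∑ c, g b c * u c) - g a b)

/-- The components of the volume form, as a multiple of the Levi-Civita symbol, and the field
equations of topological massive gravity. -/
structure TMGOn (O : Set E3) (G : E3 → Matrix (Fin 3) (Fin 3) ℝ)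
    (vol : Fin 3 → Fin 3 → Fin 3 → E3 → ℝ) (v : E3 → ℝ) (m Λ : ℝ) : Prop where
  smooth_v : ContDiffOn ℝ ∞ v O
  vol_eq : ∀ x ∈ O, ∀ a b c, vol a b c x = v x * eps ℝ a b c
  field_eq : ∀ x ∈ O, ∀ a b, ricci G a b x - (1 / 2) * scalarCurv G x * G x a b + Λ * G x a b
      = (1 / m) * dualCotton G vol a b x

variable {vol : Fin 3 → Fin 3 → Fin 3 → E3 → ℝ} {v : E3 → ℝ} {m Λ : ℝ}

theorem eval_eps (i j k : Fin 3) (x : O) : eval x (eps (SmoothFun O) i j k) = eps ℝ i j k := by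
  simp only [eps]; split_ifs <;> simp

theorem eval_det (x : O) : eval x F.coord.det
    = ∑ a, ∑ b, ∑ c, eps ℝ a b c * e 0 a x * e 1 b x * e 2 c x := by
  simp only [CoordFrame.det, map_sum, map_mul, eval_eps, eval_e]

theorem curlEquation (T : TMGOn O G vol v m Λ) (hm : m ≠ 0)
    (hv : ∀ x ∈ O, |v x * ∑ a, ∑ b, ∑ c, eps ℝ a b c * e 0 a x * e 1 b x * e 2 c x| = 1) :
    F.coord.scalarCurv = algebraMap ℝ _ (6 * Λ) ∧
    F.coord.frameCalculus.CurlEquation (fun i j => F.coord.frameCalculus.ric i j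
      - if i = j then algebraMap ℝ _ (2 * Λ) else 0)
      (algebraMap ℝ _ (2 * Λ)) (algebraMap ℝ _ m * (SmoothFun.mk v T.smooth_v * F.coord.det)) := by
  refine F.coord.curlEquation hm (eval_ext fun x => ?_) fun a b => eval_ext fun x => ?_
  · simp only [map_mul, map_one, eval_mk, eval_det]
    rw [← abs_mul_abs_self, hv x x.2, one_mul]
  · simp only [map_mul, map_add, map_sub, map_sum, eval_algebraMap, eval_ricci, eval_scalarCurv,
      eval_G, eval_mk, eval_Ginv, eval_eps, F.eval_covTwo F.eval_schouten]
    rw [T.field_eq x x.2 a b, dualCotton]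
    simp only [T.vol_eq x x.2, cotton]

/-- The frame components of the tracefree Ricci tensor. -/
theorem tracefreeRicci_frame (hR : F.coord.scalarCurv = algebraMap ℝ _ (6 * Λ)) (x : O)
    (i j : Fin 3) :
    eval x (F.coord.frameCalculus.ric i j - if i = j then algebraMap ℝ _ (2 * Λ) else 0)
      = ∑ a, ∑ b, e i a x * e j b x * tracefreeRicci G a b x := by
  have hR' : scalarCurv G x = 6 * Λ := by rw [← F.eval_scalarCurv, hR, eval_algebraMap]
  have h1 : ∑ a, ∑ b, e i a x * e j b x * tracefreeRicci G a b x
      = ∑ a, ∑ b, e i a x * e j b x * ricci G a b x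
        - 2 * Λ * ∑ a, ∑ b, G x a b * e i a x * e j b x := by
    simp only [tracefreeRicci, hR', Fin.sum_univ_three]; ring
  rw [h1, F.orth x x.2, ← CoordFrame.ricci_frame]
  simp only [CoordFrame.frameComp, map_sub, map_sum, map_mul, eval_e, eval_ricci]
  split_ifs <;> simp

/-- In the presence of a shear-free congruence of geodesics, the tracefree Ricci tensor is
uniaxial. -/
theorem isUniaxial_of_shearFree (F : LocalFrame O G e) (T : TMGOn O G vol v m Λ) (hm : m ≠ 0)
    (hv : ∀ x ∈ O, |v x * ∑ a, ∑ b, ∑ c, eps ℝ a b c * e 0 a x * e 1 b x * e 2 c x| = 1)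
    (hs : ∀ x ∈ O, IsGeodesicAt G (e 2) x ∧ IsShearFreeAt G (e 2) x) {x : E3} (hx : x ∈ O) :
    ∃ φ, IsUniaxial (G x) (Matrix.of fun a b => tracefreeRicci G a b x) φ (fun a => e 2 a x) := by
  obtain ⟨hR, hc⟩ := F.curlEquation T hm hv
  have hf := F.tracefreeRicci_frame hR ⟨x, hx⟩
  generalize hΦ : (fun i j => F.coord.frameCalculus.ric i j
    - if i = j then algebraMap ℝ (SmoothFun O) (2 * Λ) else 0) = Φ at hc
  replace hf : ∀ i j, eval ⟨x, hx⟩ (Φ i j) = ∑ a, ∑ b, e i a x * e j b x * tracefreeRicci G a b x :=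
    fun i j => by rw [← hf i j, ← hΦ]
  obtain ⟨h01, h11, hd, hp⟩ := (F.shearFreeGeodesic_iff.2 hs).sq_eq_zero hc
  generalize hΨ : (fun i j => eval ⟨x, hx⟩ (Φ i j)) = Ψ
  replace hΨ : ∀ i j, eval ⟨x, hx⟩ (Φ i j) = Ψ i j := fun i j => by rw [← hΨ]
  have hd' : 5 * (Ψ 2 0 ^ 2 - Ψ 2 1 ^ 2) = 0 := by
    simpa only [map_mul, map_sub, map_pow, map_ofNat, map_zero, hΨ] using congrArg (eval ⟨x, hx⟩) hd
  have hp' : 10 * (Ψ 2 0 * Ψ 2 1) = 0 := by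
    simpa only [map_mul, map_ofNat, map_zero, hΨ] using congrArg (eval ⟨x, hx⟩) hp
  have ht : Ψ 0 0 + Ψ 1 1 + Ψ 2 2 = 0 := by
    simpa [Fin.sum_univ_three, hΨ] using congrArg (eval ⟨x, hx⟩) hc.trace
  have hsy : ∀ i j, Ψ i j = Ψ j i := fun i j => by
    simpa [hΨ] using congrArg (eval ⟨x, hx⟩) (hc.symm i j)
  have h11' : Ψ 0 0 = Ψ 1 1 := by simpa [hΨ] using congrArg (eval ⟨x, hx⟩) h11
  have h01' : Ψ 0 1 = 0 := by simpa [hΨ] using congrArg (eval ⟨x, hx⟩) h01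
  have h20 : Ψ 2 0 = 0 := by
    -- Over the reals (p + iq)² = 0 forces p = q = 0; explicitly, p⁴ = p²(p² - q²) + (pq)².
    have : (Ψ 2 0 ^ 2) ^ 2 = 0 := by
      linear_combination (1 / 5) * Ψ 2 0 ^ 2 * hd' + (1 / 10) * (Ψ 2 0 * Ψ 2 1) * hp'
    simpa using this
  have h21 : Ψ 2 1 = 0 := by
    have : Ψ 2 1 ^ 2 = 0 := by rw [h20] at hd'; linear_combination -(1 / 5) * hd'
    simpa using this
  -- The components are now diag(Ψ 0 0, Ψ 0 0, -2 Ψ 0 0), to be compared with φ(3 u u - g) =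
  -- diag(-φ, -φ, 2φ).
  refine ⟨- Ψ 0 0, F.orth x hx 2 2, fun a b => ?_⟩
  have hexp : tracefreeRicci G a b x
      = ∑ i, ∑ j, lower G (e i) a x * lower G (e j) b x * Ψ i j := by
    have h := congrArg (eval ⟨x, hx⟩) (F.coord.eq_sum_frameComp (fun a b =>
      F.coord.ricci a b - algebraMap ℝ _ (1 / 3) * F.coord.scalarCurv * F.coord.G a b) a b)
    simp only [map_sub, map_mul, map_sum, eval_ricci, eval_scalarCurv, eval_G, eval_algebraMap,
      eval_coframe, CoordFrame.frameComp, eval_e] at h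
    rw [tracefreeRicci, h]
    refine Finset.sum_congr rfl fun i _ => Finset.sum_congr rfl fun j _ => ?_
    rw [← hΨ, hf]
    rfl
  have hG : G x a b = ∑ i, lower G (e i) a x * lower G (e i) b x := by
    have h := congrArg (eval ⟨x, hx⟩) (F.coord.eq_sum_frameComp F.coord.G a b)
    simp only [CoordFrame.frameComp_G] at h
    simpa [eval_coframe, eval_G] using h
  simp only [Matrix.of_apply, hexp]
  change _ = -Ψ 0 0 * (3 * lower G (e 2) a x * lower G (e 2) b x - G x a b)
  rw [hG]
  have h22 : Ψ 2 2 = -2 * Ψ 0 0 := by linear_combination ht + h11'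
  simp only [Fin.sum_univ_three, hsy 1 0, hsy 0 2, hsy 1 2, h20, h21, h01', h22, ← h11']
  ring

/-- If the tracefree Ricci tensor is uniaxial and non-zero, then its axis is shear-free and geodesic
and its eigenvalues are constant. -/
theorem shearFree_of_isUniaxial (F : LocalFrame O G e) (T : TMGOn O G vol v m Λ) (hm : m ≠ 0)
    (hv : ∀ x ∈ O, |v x * ∑ a, ∑ b, ∑ c, eps ℝ a b c * e 0 a x * e 1 b x * e 2 c x| = 1)
    {φ : E3 → ℝ} (hφ : ContDiffOn ℝ ∞ φ O) (hφ0 : ∀ x ∈ O, φ x ≠ 0)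
    (hu : ∀ x ∈ O, IsUniaxial (G x) (Matrix.of fun a b => tracefreeRicci G a b x) (φ x)
      (fun a => e 2 a x)) :
    (∀ x ∈ O, IsGeodesicAt G (e 2) x ∧ IsShearFreeAt G (e 2) x) ∧
      ∀ x ∈ O, ∀ a, pd a φ x = 0 := by
  obtain ⟨hR, hc⟩ := F.curlEquation T hm hv
  have hφu : IsUnit (SmoothFun.mk φ hφ) := by
    refine IsUnit.of_mul_eq_one (SmoothFun.mk (fun x => (φ x)⁻¹) (hφ.inv hφ0)) ?_
    refine eval_ext fun x => ?_
    simp only [map_mul, eval_mk, map_one]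
    exact mul_inv_cancel₀ (hφ0 x x.2)
  have hMu : IsUnit (algebraMap ℝ _ m * (SmoothFun.mk v T.smooth_v * F.coord.det)) := by
    refine ((IsUnit.mk0 m hm).map _).mul (IsUnit.of_mul_eq_one
      (SmoothFun.mk v T.smooth_v * F.coord.det) (eval_ext fun x => ?_))
    simp only [map_mul, map_one, eval_mk, eval_det]
    rw [← abs_mul_abs_self, hv x x.2, one_mul]
  obtain ⟨hs, hD⟩ := hc.typeD (φ := SmoothFun.mk φ hφ) (fun i j => eval_ext fun x => by
    rw [F.tracefreeRicci_frame hR]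
    have h1 : ∀ a b, tracefreeRicci G a b x
        = φ x * (3 * (lower G (e 2) a x) * (lower G (e 2) b x) - G x a b) := (hu x x.2).eq
    have h2 : ∀ i, ∑ a, e i a x * lower G (e 2) a x = if i = 2 then 1 else 0 := by
      intro i
      rw [← F.orth x x.2 i 2]
      simp only [lower, Finset.mul_sum]
      exact Finset.sum_congr rfl fun _ _ => Finset.sum_congr rfl fun _ _ => by ring
    have h3 : ∑ a, ∑ b, e i a x * e j b x * tracefreeRicci G a b x
        = φ x * (3 * (∑ a, e i a x * lower G (e 2) a x) * (∑ a, e j a x * lower G (e 2) a x)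
          - ∑ a, ∑ b, G x a b * e i a x * e j b x) := by
      simp only [h1, Fin.sum_univ_three]; ring
    rw [h3, h2, h2, F.orth x x.2]
    simp only [map_mul, map_sub, eval_mk, map_ofNat]
    by_cases hi : i = 2 <;> by_cases hj : j = 2 <;> by_cases hij : i = j <;> simp [hi, hj, hij])
    hφu hMu
  refine ⟨F.shearFreeGeodesic_iff.1 hs, fun x hx a => ?_⟩
  -- The coordinate derivatives are combinations of the frame derivatives with coefficients in the
  -- coframe.
  have h1 : F.coord.pd a (SmoothFun.mk φ hφ) = 0 := by
    have h2 : ∀ i, ∑ b, F.coord.e i b * F.coord.pd b (SmoothFun.mk φ hφ) = 0 := fun i => by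
      rw [← CoordFrame.D_apply]; exact hD i
    have h3 : F.coord.pd a (SmoothFun.mk φ hφ) = ∑ b, (∑ i, F.coord.e i b * F.coord.coframe i a)
        * F.coord.pd b (SmoothFun.mk φ hφ) := by
      simp [CoordFrame.sum_e_coframe]
    have h4 : ∑ b, (∑ i, F.coord.e i b * F.coord.coframe i a) * F.coord.pd b (SmoothFun.mk φ hφ)
        = ∑ i, F.coord.coframe i a * ∑ b, F.coord.e i b * F.coord.pd b (SmoothFun.mk φ hφ) := by
      simp only [Fin.sum_univ_three]; ring
    rw [h3, h4]; simp [h2]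
  rw [← F.eval_pd a (eval_mk φ hφ) ⟨x, hx⟩, h1, map_zero]

end LocalFrame
end TMG

/-! ### Invariance of the curvature under changes of coordinates. -/

namespace TMG

namespace FrameCalculus

variable {A A' : Type*} [CommRing A] [Algebra ℝ A] [CommRing A'] [Algebra ℝ A']
  {F : FrameCalculus A} {F' : FrameCalculus A'} {Ψ : A →ₐ[ℝ] A'}

/-- The Koszul formula in an orthonormal frame. -/
theorem two_mul_γ (F : FrameCalculus A) (i j k : Fin 3) :
    2 * F.γ i j k = (F.γ i j k - F.γ j i k) - (F.γ j k i - F.γ k j i) + (F.γ k i j - F.γ i k j) := by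
  linear_combination F.antisymm j k i - F.antisymm k j i + F.antisymm i k j

theorem map_ric (hD : ∀ i f, F'.D i (Ψ f) = Ψ (F.D i f))
    (hγ : ∀ i j k, F'.γ i j k = Ψ (F.γ i j k)) (i j : Fin 3) : F'.ric i j = Ψ (F.ric i j) := by
  simp only [ric, riem, map_sum, map_add, map_sub, map_mul, hγ, hD]

/-- A homomorphism that intertwines the frame derivatives preserves the connection coefficients. -/
theorem map_γ (hD : ∀ i f, F'.D i (Ψ f) = Ψ (F.D i f)) (y : Fin 3 → A) (θ : Fin 3 → Fin 3 → A)
    (hy : ∀ i j, ∑ a, θ i a * F.D j (y a) = if i = j then 1 else 0) (i j k : Fin 3) :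
    F'.γ i j k = Ψ (F.γ i j k) := by
  have hc : ∀ i j l, F'.γ i j l - F'.γ j i l = Ψ (F.γ i j l - F.γ j i l) := by
    intro i j l
    -- The commutators determine the structure functions only after contraction with the derivatives
    -- of a function f. Functions y with an invertible matrix of frame derivatives isolate each of
    -- them; the Koszul formula then recovers γ.
    have h1 : ∀ f, ∑ k, (F'.γ i j k - F'.γ j i k - Ψ (F.γ i j k - F.γ j i k)) * Ψ (F.D k f) = 0 := by
      intro f
      have h2 := F'.commutator i j (Ψ f)
      have h3 := congrArg Ψ (F.commutator i j f)
      simp only [hD, map_sub, map_sum, map_mul] at h2 h3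
      simp only [sub_mul, map_sub, Finset.sum_sub_distrib] at h2 h3 ⊢
      rw [← h2, ← h3, sub_self]
    have h4 : ∑ a, Ψ (θ l a) *
        ∑ k, (F'.γ i j k - F'.γ j i k - Ψ (F.γ i j k - F.γ j i k)) * Ψ (F.D k (y a))
        = ∑ k, (F'.γ i j k - F'.γ j i k - Ψ (F.γ i j k - F.γ j i k))
          * Ψ (∑ a, θ l a * F.D k (y a)) := by
      simp only [map_sum, map_mul, Finset.mul_sum]
      rw [Finset.sum_comm]
      exact Finset.sum_congr rfl fun _ _ => Finset.sum_congr rfl fun _ _ => by ring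
    simp only [h1, hy, mul_zero, Finset.sum_const_zero] at h4
    have h5 : ∀ k, Ψ (if l = k then 1 else 0) = if l = k then 1 else 0 := fun k => by
      split_ifs <;> simp
    simp only [h5, mul_ite, mul_one, mul_zero, Finset.sum_ite_eq, Finset.mem_univ, if_true] at h4
    exact sub_eq_zero.1 h4.symm
  have h2 : 2 * (F'.γ i j k - Ψ (F.γ i j k)) = 0 := by
    have e1 := F'.two_mul_γ i j k
    have e2 := congrArg Ψ (F.two_mul_γ i j k)
    rw [hc, hc, hc] at e1
    simp only [map_mul, map_ofNat, map_add, map_sub] at e1 e2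
    linear_combination e1 - e2
  exact sub_eq_zero.1 (eq_zero_of_two_mul h2)

end FrameCalculus

namespace SmoothFun

/-- The pullback of smooth functions. -/
noncomputable def pullback {O O' : Set E3} (ψ : E3 → E3) (hψ : ContDiffOn ℝ ∞ ψ O')
    (hm : Set.MapsTo ψ O' O) : SmoothFun O →ₐ[ℝ] SmoothFun O' where
  toFun f := mk (extendZero f.1 ∘ ψ) (ContDiffOn.comp f.2 hψ hm)
  map_one' := eval_ext fun x => by
    simpa [eval_mk] using (extendZero_eq (1 : SmoothFun O) (hm x.2)).trans (map_one _)
  map_zero' := eval_ext fun x => by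
    simpa [eval_mk] using (extendZero_eq (0 : SmoothFun O) (hm x.2)).trans (map_zero _)
  map_mul' f g := eval_ext fun x => by
    simp only [eval_mk, map_mul, Function.comp_apply]
    rw [extendZero_eq _ (hm x.2), extendZero_eq _ (hm x.2), extendZero_eq _ (hm x.2), map_mul]
  map_add' f g := eval_ext fun x => by
    simp only [eval_mk, map_add, Function.comp_apply]
    rw [extendZero_eq _ (hm x.2), extendZero_eq _ (hm x.2), extendZero_eq _ (hm x.2), map_add]
  commutes' r := eval_ext fun x => by
    simp only [eval_mk, Function.comp_apply, eval_algebraMap]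
    rw [extendZero_eq _ (hm x.2), eval_algebraMap]

theorem eval_pullback {O O' : Set E3} {ψ : E3 → E3} (hψ : ContDiffOn ℝ ∞ ψ O')
    (hm : Set.MapsTo ψ O' O) (f : SmoothFun O) (y : O') :
    eval y (pullback ψ hψ hm f) = eval ⟨ψ y, hm y.2⟩ f :=
  extendZero_eq f (hm y.2)

end SmoothFun

/-- The Jacobian matrix `∂ψ^c/∂y^a`. -/
noncomputable def jac (ψ : E3 → E3) (y : E3) (c a : Fin 3) : ℝ := pd a (fun z => ψ z c) y

theorem jac_eq {ψ : E3 → E3} {y : E3} (hψ : DifferentiableAt ℝ ψ y) (c a : Fin 3) :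
    jac ψ y c a = fderiv ℝ ψ y (EuclideanSpace.single a 1) c := by
  have : HasFDerivAt (fun z => ψ z c)
      ((EuclideanSpace.proj (𝕜 := ℝ) c).comp (fderiv ℝ ψ y)) y :=
    (EuclideanSpace.proj (𝕜 := ℝ) c).hasFDerivAt.comp y hψ.hasFDerivAt
  rw [jac, pd, this.fderiv]; rfl

theorem fderiv_eq_sum_pd (f : E3 → ℝ) (x w : E3) : fderiv ℝ f x w = ∑ c, w c * pd c f x := by
  have : w = ∑ c, w c • EuclideanSpace.single c (1 : ℝ) := by
    ext i; simp [Pi.single_apply]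
  conv_lhs => rw [this]
  simp [pd]

theorem pd_comp {f : E3 → ℝ} {ψ : E3 → E3} {y : E3} (hf : DifferentiableAt ℝ f (ψ y))
    (hψ : DifferentiableAt ℝ ψ y) (a : Fin 3) :
    pd a (f ∘ ψ) y = ∑ c, jac ψ y c a * pd c f (ψ y) := by
  rw [pd, fderiv_comp y hf hψ, ContinuousLinearMap.comp_apply, fderiv_eq_sum_pd]
  simp only [jac_eq hψ]

theorem pd_coord (a c : Fin 3) (y : E3) : pd a (fun z => z c) y = if c = a then 1 else 0 := by
  have : HasFDerivAt (fun z : E3 => z c) (EuclideanSpace.proj (𝕜 := ℝ) c) y :=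
    (EuclideanSpace.proj (𝕜 := ℝ) c).hasFDerivAt
  rw [pd, this.fderiv]
  simp

theorem contDiffOn_coord (a : Fin 3) (O : Set E3) : ContDiffOn ℝ ∞ (fun x : E3 => x a) O :=
  (EuclideanSpace.proj (𝕜 := ℝ) a).contDiff.contDiffOn

/-- A change of coordinates from `O'` to `O`. -/
structure CoordChange (O' O : Set E3) (ψ χ : E3 → E3) : Prop where
  isOpen' : IsOpen O'
  isOpen : IsOpen O
  smooth : ContDiffOn ℝ ∞ ψ O'
  smooth_inv : ContDiffOn ℝ ∞ χ O
  mapsTo : Set.MapsTo ψ O' O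
  mapsTo_inv : Set.MapsTo χ O O'
  left_inv : ∀ y ∈ O', χ (ψ y) = y
  right_inv : ∀ x ∈ O, ψ (χ x) = x

namespace CoordChange

variable {O O' : Set E3} {ψ χ : E3 → E3}

theorem symm (h : CoordChange O' O ψ χ) : CoordChange O O' χ ψ :=
  ⟨h.isOpen, h.isOpen', h.smooth_inv, h.smooth, h.mapsTo_inv, h.mapsTo, h.right_inv, h.left_inv⟩

theorem differentiableAt (h : CoordChange O' O ψ χ) {y : E3} (hy : y ∈ O') :
    DifferentiableAt ℝ ψ y :=
  (h.smooth.contDiffAt (h.isOpen'.mem_nhds hy)).differentiableAt (by simp)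

theorem differentiableAt_inv (h : CoordChange O' O ψ χ) {x : E3} (hx : x ∈ O) :
    DifferentiableAt ℝ χ x := h.symm.differentiableAt hx

theorem jac_inv_mul (h : CoordChange O' O ψ χ) {y : E3} (hy : y ∈ O') (a b : Fin 3) :
    ∑ c, jac χ (ψ y) a c * jac ψ y c b = if a = b then 1 else 0 := by
  rw [← pd_coord b a y]
  have h1 : DifferentiableAt ℝ (fun z => χ z a) (ψ y) :=
    (EuclideanSpace.proj (𝕜 := ℝ) a).differentiableAt.comp _
      (h.differentiableAt_inv (h.mapsTo hy))
  have h2 := pd_comp h1 (h.differentiableAt hy) b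
  rw [SmoothFun.pd_congr h.isOpen' (f := fun z => z a) (g := (fun z => χ z a) ∘ ψ)
    (fun z hz => by simp [h.left_inv z hz]) b hy, h2]
  exact Finset.sum_congr rfl fun _ _ => mul_comm _ _

theorem jac_mul_inv (h : CoordChange O' O ψ χ) {y : E3} (hy : y ∈ O') (a b : Fin 3) :
    ∑ c, jac ψ y a c * jac χ (ψ y) c b = if a = b then 1 else 0 := by
  have := h.symm.jac_inv_mul (h.mapsTo hy) a b
  rwa [h.left_inv y hy] at this

theorem contDiffOn_jac (h : CoordChange O' O ψ χ) (c a : Fin 3) :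
    ContDiffOn ℝ ∞ (fun y => jac ψ y c a) O' :=
  SmoothFun.contDiffOn_pd h.isOpen'
    ((EuclideanSpace.proj (𝕜 := ℝ) c).contDiff.comp_contDiffOn h.smooth) a

/-- The transformed frame. -/
noncomputable def frame (ψ χ : E3 → E3) (e : Fin 3 → Fin 3 → E3 → ℝ) (i a : Fin 3) (y : E3) : ℝ :=
  ∑ b, jac χ (ψ y) a b * e i b (ψ y)

variable {G G' : E3 → Matrix (Fin 3) (Fin 3) ℝ} {e : Fin 3 → Fin 3 → E3 → ℝ}

theorem jac_frame (h : CoordChange O' O ψ χ) {y : E3} (hy : y ∈ O') (i c : Fin 3) :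
    ∑ a, jac ψ y c a * frame ψ χ e i a y = e i c (ψ y) := by
  have h1 := h.jac_mul_inv hy c
  have h2 : ∑ a, jac ψ y c a * frame ψ χ e i a y
      = ∑ b, (∑ a, jac ψ y c a * jac χ (ψ y) a b) * e i b (ψ y) := by
    simp only [frame, Fin.sum_univ_three]; ring
  rw [h2]; simp [h1]

theorem localFrame (h : CoordChange O' O ψ χ) (F : LocalFrame O G e)
    (hG : ∀ y ∈ O', ∀ a b, G' y a b = ∑ c, ∑ d, jac ψ y c a * jac ψ y d b * G (ψ y) c d) :
    LocalFrame O' G' (frame ψ χ e) where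
  isOpen := h.isOpen'
  smooth_G a b := by
    have h1 : ContDiffOn ℝ ∞
        (fun y => ∑ c, ∑ d, jac ψ y c a * jac ψ y d b * G (ψ y) c d) O' :=
      ContDiffOn.sum fun c _ => ContDiffOn.sum fun d _ =>
        ((h.contDiffOn_jac c a).mul (h.contDiffOn_jac d b)).mul
          ((F.smooth_G c d).comp h.smooth h.mapsTo)
    exact h1.congr fun y hy => hG y hy a b
  smooth_e i a := by
    refine ContDiffOn.sum fun b _ => ContDiffOn.mul ?_ ((F.smooth_e i b).comp h.smooth h.mapsTo)
    exact (h.symm.contDiffOn_jac a b).comp h.smooth h.mapsTo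
  symm y hy a b := by
    rw [hG y hy, hG y hy, Finset.sum_comm]
    refine Finset.sum_congr rfl fun _ _ => Finset.sum_congr rfl fun _ _ => ?_
    rw [F.symm _ (h.mapsTo hy)]; ring
  orth y hy i j := by
    rw [← F.orth _ (h.mapsTo hy)]
    simp only [← h.jac_frame hy, hG y hy, Fin.sum_univ_three]
    ring

/-- The frame is carried along with the coordinates. By the chain rule, pullback intertwines the
frame derivatives, and these determine γ and hence the Ricci components. The inhomogeneous
transformation law of the Christoffel symbols is thus avoided. -/
theorem ric_eq (h : CoordChange O' O ψ χ) (F : LocalFrame O G e)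
    (hG : ∀ y ∈ O', ∀ a b, G' y a b = ∑ c, ∑ d, jac ψ y c a * jac ψ y d b * G (ψ y) c d)
    (i j : Fin 3) : (h.localFrame F hG).coord.frameCalculus.ric i j
      = SmoothFun.pullback ψ h.smooth h.mapsTo (F.coord.frameCalculus.ric i j) := by
  have hD : ∀ i f, (h.localFrame F hG).coord.frameCalculus.D i
        (SmoothFun.pullback ψ h.smooth h.mapsTo f)
      = SmoothFun.pullback ψ h.smooth h.mapsTo (F.coord.frameCalculus.D i f) := by
    intro i f
    refine SmoothFun.eval_ext fun y => ?_
    change SmoothFun.eval y ((h.localFrame F hG).coord.D i _)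
      = SmoothFun.eval y (SmoothFun.pullback ψ h.smooth h.mapsTo (F.coord.D i f))
    rw [CoordFrame.D_apply, CoordFrame.D_apply, SmoothFun.eval_pullback]
    have h1 : ∀ a, SmoothFun.eval y ((h.localFrame F hG).coord.pd a
        (SmoothFun.pullback ψ h.smooth h.mapsTo f)) = pd a (extendZero f.1 ∘ ψ) y := fun a =>
      (h.localFrame F hG).eval_pd a (fun z => rfl) y
    have h2 : ∀ a, SmoothFun.eval ⟨ψ y, h.mapsTo y.2⟩ (F.coord.pd a f)
        = pd a (extendZero f.1) (ψ y) := fun a => 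
      F.eval_pd a (fun z => (SmoothFun.extendZero_eq f z.2).symm) ⟨ψ y, h.mapsTo y.2⟩
    simp only [map_sum, map_mul, h1, h2, LocalFrame.eval_e, ← h.jac_frame y.2 (e := e)]
    simp only [pd_comp (SmoothFun.differentiableAt h.isOpen f ⟨ψ y, h.mapsTo y.2⟩)
      (h.differentiableAt y.2), Fin.sum_univ_three]
    ring
  -- The coordinate functions serve as y: their frame derivatives are the components of the frame,
  -- inverted by the coframe.
  refine FrameCalculus.map_ric hD (FrameCalculus.map_γ hD
    (fun a => SmoothFun.mk (fun x => x a) (contDiffOn_coord a O))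
    F.coord.coframe fun i j => ?_) i j
  rw [← F.coord.coframe_e]
  refine Finset.sum_congr rfl fun a _ => ?_
  congr 1
  change F.coord.D j _ = _
  refine SmoothFun.eval_ext fun x => ?_
  rw [CoordFrame.D_apply, map_sum]
  simp only [map_mul, F.eval_pd _ (SmoothFun.eval_mk _ _), pd_coord, LocalFrame.eval_e]
  simp

/-- The frame components are scalars and agree in both charts, so only the coframe, which is
multiplied by the Jacobian, contributes to the transformation. -/
theorem tracefreeRicci_eq (h : CoordChange O' O ψ χ) (F : LocalFrame O G e)
    (hG : ∀ y ∈ O', ∀ a b, G' y a b = ∑ c, ∑ d, jac ψ y c a * jac ψ y d b * G (ψ y) c d)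
    {y : E3} (hy : y ∈ O') (a b : Fin 3) : tracefreeRicci G' a b y
      = ∑ c, ∑ d, jac ψ y c a * jac ψ y d b * tracefreeRicci G c d (ψ y) := by
  set F' := h.localFrame F hG with hF'
  have hr : ∀ i j, SmoothFun.eval ⟨y, hy⟩ (F'.coord.frameCalculus.ric i j)
      = SmoothFun.eval ⟨ψ y, h.mapsTo hy⟩ (F.coord.frameCalculus.ric i j) := fun i j => by
    rw [hF', h.ric_eq F hG, SmoothFun.eval_pullback]
  have hs : scalarCurv G' y = scalarCurv G (ψ y) := by
    rw [← F'.eval_scalarCurv ⟨y, hy⟩, ← F.eval_scalarCurv ⟨ψ y, h.mapsTo hy⟩]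
    simp only [CoordFrame.scalarCurv_frame, map_sum, hr]
  have hl : ∀ i a, lower G' (frame ψ χ e i) a y = ∑ c, jac ψ y c a * lower G (e i) c (ψ y) := by
    intro i a
    simp only [lower, ← h.jac_frame hy (e := e), hG y hy, Fin.sum_univ_three]
    ring
  have hric : ricci G' a b y = ∑ c, ∑ d, jac ψ y c a * jac ψ y d b * ricci G c d (ψ y) := by
    have e1 := fun a b => congrArg (SmoothFun.eval ⟨y, hy⟩)
      (F'.coord.eq_sum_frameComp F'.coord.ricci a b)
    have e2 := fun a b => congrArg (SmoothFun.eval ⟨ψ y, h.mapsTo hy⟩)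
      (F.coord.eq_sum_frameComp F.coord.ricci a b)
    simp only [map_sum, map_mul, CoordFrame.ricci_frame, LocalFrame.eval_coframe,
      LocalFrame.eval_ricci, hr, hl] at e1 e2
    simp only [e1, e2]
    generalize (fun i j => SmoothFun.eval ⟨ψ y, h.mapsTo hy⟩ (F.coord.frameCalculus.ric i j)) = R
    simp only [Fin.sum_univ_three]
    ring
  simp only [tracefreeRicci, hric, hs, hG y hy, Fin.sum_univ_three]
  ring

end CoordChange
end TMG

/-! ### Symmetric bilinear forms and smooth Gram–Schmidt orthonormalisation. -/

namespace TMG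

/-- The bilinear form of a matrix. -/
def bil (g : Matrix (Fin 3) (Fin 3) ℝ) (v w : Fin 3 → ℝ) : ℝ := ∑ a, ∑ b, g a b * v a * w b

theorem bil_add_left (g : Matrix (Fin 3) (Fin 3) ℝ) (v v' w : Fin 3 → ℝ) :
    bil g (v + v') w = bil g v w + bil g v' w := by
  simp only [bil, Fin.sum_univ_three, Pi.add_apply]; ring

theorem bil_smul_left (g : Matrix (Fin 3) (Fin 3) ℝ) (r : ℝ) (v w : Fin 3 → ℝ) :
    bil g (r • v) w = r * bil g v w := by
  simp only [bil, Fin.sum_univ_three, Pi.smul_apply, smul_eq_mul]; ring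

theorem bil_symm {g : Matrix (Fin 3) (Fin 3) ℝ} (hg : ∀ a b, g a b = g b a) (v w : Fin 3 → ℝ) :
    bil g v w = bil g w v := by
  simp only [bil, Fin.sum_univ_three, hg 1 0, hg 2 0, hg 2 1]; ring

theorem bil_smul_right (g : Matrix (Fin 3) (Fin 3) ℝ) (r : ℝ) (v w : Fin 3 → ℝ) :
    bil g v (r • w) = r * bil g v w := by
  simp only [bil, Fin.sum_univ_three, Pi.smul_apply, smul_eq_mul]; ring

theorem bil_sub_left (g : Matrix (Fin 3) (Fin 3) ℝ) (v v' w : Fin 3 → ℝ) :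
    bil g (v - v') w = bil g v w - bil g v' w := by
  simp only [bil, Fin.sum_univ_three, Pi.sub_apply]; ring

theorem bil_sum_left (g : Matrix (Fin 3) (Fin 3) ℝ) {k : ℕ} (v : Fin k → Fin 3 → ℝ)
    (w : Fin 3 → ℝ) : bil g (∑ i, v i) w = ∑ i, bil g (v i) w := by
  have h0 : bil g 0 w = 0 := by simp [bil]
  exact map_sum (⟨⟨fun v => bil g v w, h0⟩, fun v v' => bil_add_left g v v' w⟩ :
    (Fin 3 → ℝ) →+ ℝ) v _

/-- A symmetric and positive definite matrix. -/
structure IsMetric (g : Matrix (Fin 3) (Fin 3) ℝ) : Prop where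
  symm : ∀ a b, g a b = g b a
  pos : ∀ v, v ≠ 0 → 0 < bil g v v

/-- A smooth Riemannian metric in coordinates. -/
structure LocalMetric (O : Set E3) (G : E3 → Matrix (Fin 3) (Fin 3) ℝ) : Prop where
  isOpen : IsOpen O
  smooth : ∀ a b, ContDiffOn ℝ ∞ (fun x => G x a b) O
  isMetric : ∀ x ∈ O, IsMetric (G x)

namespace LocalMetric

variable {O : Set E3} {G : E3 → Matrix (Fin 3) (Fin 3) ℝ}

theorem mono (h : LocalMetric O G) {O' : Set E3} (hO' : IsOpen O') (hs : O' ⊆ O) :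
    LocalMetric O' G :=
  ⟨hO', fun a b => (h.smooth a b).mono hs, fun x hx => h.isMetric x (hs hx)⟩

theorem contDiffOn_bil (h : LocalMetric O G) {v w : Fin 3 → E3 → ℝ}
    (hv : ∀ a, ContDiffOn ℝ ∞ (v a) O) (hw : ∀ a, ContDiffOn ℝ ∞ (w a) O) :
    ContDiffOn ℝ ∞ (fun x => bil (G x) (fun a => v a x) (fun a => w a x)) O :=
  ContDiffOn.sum fun a _ => ContDiffOn.sum fun b _ => ((h.smooth a b).mul (hv a)).mul (hw b)

/-- The Gram–Schmidt step. -/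
theorem exists_orthonormal (h : LocalMetric O G) {k : ℕ} (hk : k < 3) {f : Fin k → Fin 3 → E3 → ℝ}
    (hf : ∀ i a, ContDiffOn ℝ ∞ (f i a) O)
    (ho : ∀ x ∈ O, ∀ i j, bil (G x) (fun a => f i a x) (fun a => f j a x) = if i = j then 1 else 0)
    {x₀ : E3} (hx₀ : x₀ ∈ O) :
    ∃ O' ⊆ O, IsOpen O' ∧ x₀ ∈ O' ∧ ∃ w : Fin 3 → E3 → ℝ, (∀ a, ContDiffOn ℝ ∞ (w a) O') ∧
      ∀ x ∈ O', bil (G x) (fun a => w a x) (fun a => w a x) = 1 ∧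
        ∀ i, bil (G x) (fun a => w a x) (fun a => f i a x) = 0 := by
  obtain ⟨v, hv⟩ : ∃ v : Fin 3 → ℝ, v ∉ Submodule.span ℝ (Set.range fun i a => f i a x₀) := by
    by_contra! hc
    have h1 : Submodule.span ℝ (Set.range fun i a => f i a x₀) = ⊤ := by
      rw [eq_top_iff]; exact fun v _ => hc v
    have h2 := finrank_range_le_card (R := ℝ) (fun (i : Fin k) (a : Fin 3) => f i a x₀)
    rw [Set.finrank, h1, finrank_top] at h2
    simp at h2
    omega
  -- The constant vector v is independent of the given fields at x₀. Subtracting its projection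
  -- leaves N, with q = g(N, N) positive at x₀ and hence on a neighbourhood, where N can be
  -- normalised smoothly.
  set N : Fin 3 → E3 → ℝ := fun a x =>
    v a - ∑ i, bil (G x) v (fun b => f i b x) * f i a x with hN
  have hNs : ∀ a, ContDiffOn ℝ ∞ (N a) O := fun a =>
    contDiffOn_const.sub (ContDiffOn.sum fun i _ =>
      (h.contDiffOn_bil (fun _ => contDiffOn_const) (hf i)).mul (hf i a))
  have hNv : ∀ x, (fun a => N a x)
      = v - ∑ i, bil (G x) v (fun b => f i b x) • (fun a => f i a x) := by
    intro x; funext a; simp [hN, Finset.sum_apply]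
  set q : E3 → ℝ := fun x => bil (G x) (fun a => N a x) (fun a => N a x)
  have hq : ContDiffOn ℝ ∞ q O := h.contDiffOn_bil hNs hNs
  have hq0 : 0 < q x₀ := by
    refine (h.isMetric x₀ hx₀).pos _ fun h0 => hv ?_
    rw [hNv, sub_eq_zero] at h0
    rw [h0]
    exact Submodule.sum_mem _ fun i _ => Submodule.smul_mem _ _ (Submodule.subset_span ⟨i, rfl⟩)
  refine ⟨O ∩ q ⁻¹' Set.Ioi 0, Set.inter_subset_left,
    hq.continuousOn.isOpen_inter_preimage h.isOpen isOpen_Ioi, ⟨hx₀, hq0⟩,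
    fun a x => (Real.sqrt (q x))⁻¹ * N a x, fun a => ?_, fun x hx => ?_⟩
  · refine ContDiffOn.mul (ContDiffOn.inv (ContDiffOn.sqrt (hq.mono Set.inter_subset_left)
      fun x hx => (ne_of_gt hx.2)) fun x hx => ?_) ((hNs a).mono Set.inter_subset_left)
    exact (Real.sqrt_pos.2 hx.2).ne'
  · have hw : (fun a => (Real.sqrt (q x))⁻¹ * N a x) = (Real.sqrt (q x))⁻¹ • fun a => N a x := rfl
    rw [hw]
    have hs := Real.mul_self_sqrt (le_of_lt hx.2)
    have hs0 := (Real.sqrt_pos.2 hx.2).ne'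
    refine ⟨?_, fun i => ?_⟩
    · rw [bil_smul_left, bil_smul_right]
      change _ * (_ * q x) = 1
      field_simp
      linarith [hs]
    · rw [bil_smul_left, hNv, bil_sub_left, bil_sum_left]
      simp only [bil_smul_left, ho x hx.1]
      simp

/-- A smooth unit vector field extends locally to an orthonormal frame. -/
theorem exists_localFrame (h : LocalMetric O G) {u : Fin 3 → E3 → ℝ}
    (hu : ∀ a, ContDiffOn ℝ ∞ (u a) O)
    (hu1 : ∀ x ∈ O, bil (G x) (fun a => u a x) (fun a => u a x) = 1) {x₀ : E3} (hx₀ : x₀ ∈ O) :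
    ∃ O' ⊆ O, x₀ ∈ O' ∧ ∃ e, LocalFrame O' G e ∧ e 2 = u := by
  obtain ⟨O₁, hO₁, ho₁, hx₁, w, hw, hw1⟩ := h.exists_orthonormal (k := 1) (by norm_num)
    (f := fun _ => u) (fun _ => hu) (fun x hx i j => by simp [hu1 x hx, Subsingleton.elim i j]) hx₀
  have h₁ := h.mono ho₁ hO₁
  obtain ⟨O₂, hO₂, ho₂, hx₂, z, hz, hz1⟩ := h₁.exists_orthonormal (k := 2) (by norm_num)
    (f := ![u, w]) (fun i a => by
      fin_cases i
      · exact (hu a).mono hO₁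
      · exact hw a) (fun x hx i j => by
      have s := bil_symm (h₁.isMetric x hx).symm
      have e1 := hu1 x (hO₁ hx)
      have e2 := (hw1 x hx).1
      have e3 := (hw1 x hx).2 0
      have e4 := e3
      rw [s] at e4
      fin_cases i <;> fin_cases j <;> simp [e1, e2, e3, e4]) hx₁
  refine ⟨O₂, hO₂.trans hO₁, hx₂, ![z, w, u], ⟨ho₂, fun a b => (h₁.smooth a b).mono hO₂, ?_,
    fun x hx => (h₁.isMetric x (hO₂ hx)).symm, ?_⟩, rfl⟩
  · intro i a
    fin_cases i
    · exact hz a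
    · exact (hw a).mono hO₂
    · exact (hu a).mono (hO₂.trans hO₁)
  · intro x hx i j
    have s := bil_symm (h₁.isMetric x (hO₂ hx)).symm
    have e1 := hu1 x (hO₁ (hO₂ hx))
    have e2 := (hw1 x (hO₂ hx)).1
    have e3 := (hw1 x (hO₂ hx)).2 0
    have e4 := e3
    rw [s] at e4
    have e5 := (hz1 x hx).1
    have e6 := (hz1 x hx).2 0
    have e7 := (hz1 x hx).2 1
    have e8 := e6
    have e9 := e7
    rw [s] at e8 e9
    change bil (G x) (fun a => (![z, w, u] : Fin 3 → Fin 3 → E3 → ℝ) i a x)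
      (fun a => (![z, w, u] : Fin 3 → Fin 3 → E3 → ℝ) j a x) = _
    simp at e6 e7 e8 e9
    fin_cases i <;> fin_cases j <;> simp [e1, e2, e3, e4, e5, e6, e7, e8, e9]

theorem exists_localFrame' (h : LocalMetric O G) {x₀ : E3} (hx₀ : x₀ ∈ O) :
    ∃ O' ⊆ O, x₀ ∈ O' ∧ ∃ e, LocalFrame O' G e := by
  obtain ⟨O₁, hO₁, ho₁, hx₁, w, hw, hw1⟩ := h.exists_orthonormal (k := 0) (by norm_num)
    (f := Fin.elim0) (fun i => i.elim0) (fun _ _ i => i.elim0) hx₀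
  obtain ⟨O₂, hO₂, hx₂, e, he, -⟩ := (h.mono ho₁ hO₁).exists_localFrame hw
    (fun x hx => (hw1 x hx).1) hx₁
  exact ⟨O₂, hO₂.trans hO₁, hx₂, e, he⟩

end LocalMetric
end TMG

/-! ### Pointwise algebra of the quartic: algebraically special means uniaxial. -/

namespace TMG

/-- An orthonormal basis for the bilinear form `g`. -/
def IsOrthonormal (g : Matrix (Fin 3) (Fin 3) ℝ) (e : Fin 3 → Fin 3 → ℝ) : Prop :=
  ∀ i j, bil g (e i) (e j) = if i = j then 1 else 0

theorem cbil_sum (B : Matrix (Fin 3) (Fin 3) ℝ) (e : Fin 3 → Fin 3 → ℝ) (c d : Fin 3 → ℂ) :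
    cbil B (fun a => ∑ i, c i * e i a) (fun a => ∑ i, d i * e i a)
      = ∑ i, ∑ j, c i * d j * (bil B (e i) (e j) : ℝ) := by
  simp only [cbil, bil, Fin.sum_univ_three]
  push_cast
  ring

theorem IsOrthonormal.cbil {g : Matrix (Fin 3) (Fin 3) ℝ} {e : Fin 3 → Fin 3 → ℝ}
    (he : IsOrthonormal g e) (c d : Fin 3 → ℂ) :
    cbil g (fun a => ∑ i, c i * e i a) (fun a => ∑ i, d i * e i a) = ∑ i, c i * d i := by
  rw [cbil_sum]
  simp only [he _ _]
  simp [Fin.sum_univ_three]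

theorem IsOrthonormal.complete {g : Matrix (Fin 3) (Fin 3) ℝ} {e : Fin 3 → Fin 3 → ℝ}
    (he : IsOrthonormal g e) (a b : Fin 3) :
    ∑ i, e i a * ∑ c, g b c * e i c = if a = b then 1 else 0 :=
  CoordFrame.complete_of_orth (fun a b => g a b) e he a b

theorem IsOrthonormal.exists_expand {g : Matrix (Fin 3) (Fin 3) ℝ} {e : Fin 3 → Fin 3 → ℝ}
    (he : IsOrthonormal g e) (v : Fin 3 → ℂ) : ∃ c : Fin 3 → ℂ, v = fun a => ∑ i, c i * e i a := by
  refine ⟨fun i => ∑ b, (∑ c, g b c * e i c : ℝ) * v b, funext fun a => ?_⟩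
  have h1 : ∑ i, (∑ b, (∑ c, g b c * e i c : ℝ) * v b) * (e i a : ℂ)
      = ∑ b, ((∑ i, e i a * ∑ c, g b c * e i c : ℝ) : ℂ) * v b := by
    simp only [Fin.sum_univ_three]; push_cast; ring
  have h2 : ∀ b, ((∑ i, e i a * ∑ c, g b c * e i c : ℝ) : ℂ) = if a = b then 1 else 0 := by
    intro b
    rw [he.complete]
    split_ifs <;> simp
  rw [h1]
  simp [h2]

/-- An inner product at a point is treated as a constant metric, so that the smooth Gram–Schmidt
process also provides pointwise orthonormal bases. -/
theorem isMetric_localMetric {g : Matrix (Fin 3) (Fin 3) ℝ} (hg : IsMetric g) :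
    LocalMetric Set.univ (fun _ => g) :=
  ⟨isOpen_univ, fun _ _ => contDiffOn_const, fun _ _ => hg⟩

theorem IsMetric.exists_isOrthonormal {g : Matrix (Fin 3) (Fin 3) ℝ} (hg : IsMetric g)
    {u : Fin 3 → ℝ} (hu : bil g u u = 1) : ∃ e, IsOrthonormal g e ∧ e 2 = u := by
  obtain ⟨O', -, hx, e, he, h2⟩ := (isMetric_localMetric hg).exists_localFrame
    (u := fun a _ => u a) (fun _ => contDiffOn_const) (fun _ _ => hu) (Set.mem_univ 0)
  exact ⟨fun i a => e i a 0, fun i j => he.orth 0 hx i j, by funext a; simp [h2]⟩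

theorem IsMetric.exists_isOrthonormal_pair {g : Matrix (Fin 3) (Fin 3) ℝ} (hg : IsMetric g)
    {p q : Fin 3 → ℝ} (hp : bil g p p = 1) (hq : bil g q q = 1) (hpq : bil g p q = 0) :
    ∃ e, IsOrthonormal g e ∧ e 0 = p ∧ e 1 = q := by
  have hqp : bil g q p = 0 := by rw [bil_symm hg.symm, hpq]
  obtain ⟨O', -, -, hx, w, -, hw⟩ := (isMetric_localMetric hg).exists_orthonormal (k := 2)
    (by norm_num) (f := ![fun a _ => p a, fun a _ => q a])
    (fun i a => by fin_cases i <;> exact contDiffOn_const)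
    (fun x _ i j => by fin_cases i <;> fin_cases j <;> simp [hp, hq, hpq, hqp]) (Set.mem_univ 0)
  obtain ⟨h1, h2⟩ := hw 0 hx
  have h3 := h2 0
  have h4 := h2 1
  simp at h3 h4
  have h5 := h3
  have h6 := h4
  rw [bil_symm hg.symm] at h5 h6
  refine ⟨![p, q, fun a => w a 0], fun i j => ?_, rfl, rfl⟩
  fin_cases i <;> fin_cases j <;> simp [hp, hq, hpq, hqp, h1, h3, h4, h5, h6]

/-- A tensor with two equal eigenvalues is uniaxial. -/
theorem IsOrthonormal.isUniaxial {g Φ : Matrix (Fin 3) (Fin 3) ℝ} {e : Fin 3 → Fin 3 → ℝ}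
    (he : IsOrthonormal g e) (hs : ∀ i j, Φ i j = Φ j i)
    (h11 : bil Φ (e 0) (e 0) = bil Φ (e 1) (e 1)) (h01 : bil Φ (e 0) (e 1) = 0)
    (h02 : bil Φ (e 0) (e 2) = 0) (h12 : bil Φ (e 1) (e 2) = 0)
    (ht : ∑ i, bil Φ (e i) (e i) = 0) :
    IsUniaxial g Φ (- bil Φ (e 0) (e 0)) (e 2) := by
  refine ⟨he 2 2, fun a b => ?_⟩
  set θ : Fin 3 → Fin 3 → ℝ := fun i a => ∑ c, g a c * e i c with hθ
  have hc : ∀ a b, ∑ i, e i a * θ i b = if a = b then 1 else 0 := he.complete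
  have hexp : ∀ T : Matrix (Fin 3) (Fin 3) ℝ,
      T a b = ∑ i, ∑ j, θ i a * θ j b * bil T (e i) (e j) := by
    intro T
    have : ∑ i, ∑ j, θ i a * θ j b * bil T (e i) (e j)
        = ∑ p, ∑ q, (∑ i, e i p * θ i a) * (∑ j, e j q * θ j b) * T p q := by
      simp only [bil, Fin.sum_univ_three]; ring
    rw [this]; simp [hc]
  have h10 : bil Φ (e 1) (e 0) = 0 := by rw [bil_symm hs, h01]
  have h20 : bil Φ (e 2) (e 0) = 0 := by rw [bil_symm hs, h02]
  have h21 : bil Φ (e 2) (e 1) = 0 := by rw [bil_symm hs, h12]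
  have h22 : bil Φ (e 2) (e 2) = -2 * bil Φ (e 0) (e 0) := by
    rw [Fin.sum_univ_three] at ht; linear_combination ht + h11
  change _ = _ * (3 * θ 2 a * θ 2 b - _)
  rw [hexp Φ, hexp g]
  simp only [he _ _, Fin.sum_univ_three, h01, h02, h12, h10, h20, h21, h22, ← h11]
  simp
  ring

theorem cbil_smul_add (B : Matrix (Fin 3) (Fin 3) ℝ) (k l n v : Fin 3 → ℂ) (r s t : ℂ) :
    cbil B (fun a => r * k a + s * l a + t * n a) v
      = r * cbil B k v + s * cbil B l v + t * cbil B n v := by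
  simp only [cbil, Fin.sum_univ_three]; ring

theorem cbil_symm {B : Matrix (Fin 3) (Fin 3) ℝ} (hB : ∀ a b, B a b = B b a) (v w : Fin 3 → ℂ) :
    cbil B v w = cbil B w v := by
  simp only [cbil, Fin.sum_univ_three, hB 1 0, hB 2 0, hB 2 1]; ring

theorem eval_ricciPoly (Φ : Matrix (Fin 3) (Fin 3) ℝ) (k l n : Fin 3 → ℂ) (z : ℂ) :
    (ricciPoly Φ k l n).eval z = 1 / 2 * cbil Φ (fun a => 1 * k a + z ^ 2 * l a + 2 * z * n a)
      (fun a => 1 * k a + z ^ 2 * l a + 2 * z * n a) := by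
  simp only [ricciPoly, nullVec, cbil, Polynomial.eval_mul, Polynomial.eval_finsetSum,
    Polynomial.eval_add, Polynomial.eval_C, Polynomial.eval_X, Polynomial.eval_pow,
    Polynomial.eval_ofNat]
  congr 1
  exact Finset.sum_congr rfl fun _ _ => Finset.sum_congr rfl fun _ _ => by ring

theorem eval_derivative_ricciPoly {Φ : Matrix (Fin 3) (Fin 3) ℝ} (hs : ∀ a b, Φ a b = Φ b a)
    (k l n : Fin 3 → ℂ) (z : ℂ) :
    (ricciPoly Φ k l n).derivative.eval z
      = 2 * cbil Φ (fun a => 1 * k a + z ^ 2 * l a + 2 * z * n a)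
          (fun a => 0 * k a + z * l a + 1 * n a) := by
  simp only [ricciPoly, nullVec, cbil, Polynomial.derivative_mul, Polynomial.derivative_C,
    Polynomial.derivative_add, Polynomial.derivative_X,
    Polynomial.derivative_pow, Polynomial.eval_mul,
    Polynomial.eval_add, Polynomial.eval_C, Polynomial.eval_X, Polynomial.eval_pow,
    Polynomial.eval_ofNat, Polynomial.derivative_ofNat, Fin.sum_univ_three, hs 1 0, hs 2 0, hs 2 1]
  simp
  ring

theorem cbil_self_eq {g : Matrix (Fin 3) (Fin 3) ℝ} (hg : ∀ a b, g a b = g b a) (k : Fin 3 → ℂ) :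
    cbil g k k = ((bil g (fun a => (k a).re) (fun a => (k a).re)
      - bil g (fun a => (k a).im) (fun a => (k a).im) : ℝ) : ℂ)
      + 2 * ((bil g (fun a => (k a).re) (fun a => (k a).im) : ℝ) : ℂ) * Complex.I := by
  obtain ⟨x, y, rfl⟩ : ∃ x y : Fin 3 → ℝ, k = fun a => (x a : ℂ) + y a * Complex.I :=
    ⟨fun a => (k a).re, fun a => (k a).im, funext fun a => (Complex.re_add_im _).symm⟩
  simp [cbil, bil, Fin.sum_univ_three, hg 1 0, hg 2 0, hg 2 1]
  linear_combination ((g 0 0 : ℂ) * y 0 ^ 2 + g 1 1 * y 1 ^ 2 + g 2 2 * y 2 ^ 2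
      + 2 * g 0 1 * y 0 * y 1 + 2 * g 0 2 * y 0 * y 2 + 2 * g 1 2 * y 1 * y 2) * Complex.I_sq

/-- An algebraically special tracefree tensor is uniaxial. -/
theorem IsAlgSpecial.exists_isUniaxial {g Φ : Matrix (Fin 3) (Fin 3) ℝ} (hg : IsMetric g)
    (hs : ∀ a b, Φ a b = Φ b a)
    (ht : ∀ e, IsOrthonormal g e → ∑ i, bil Φ (e i) (e i) = 0) (h : IsAlgSpecial g Φ) :
    ∃ φ u, IsUniaxial g Φ φ u := by
  obtain ⟨k', l, n', hf, z, P, hP⟩ := h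
  have h1 := eval_ricciPoly Φ k' l n' z
  have h2 := eval_derivative_ricciPoly hs k' l n' z
  rw [hP] at h1 h2
  simp [Polynomial.derivative_pow] at h1 h2
  -- Here k = ξ(z) is the null vector of the multiple root and n = ξ'(z)/2, so the vanishing of the
  -- quartic and of its derivative reads Φ(k, k) = Φ(k, n) = 0. The factors 1 and 0 fit the shape of
  -- `cbil_smul_add`.
  set k : Fin 3 → ℂ := fun a => 1 * k' a + z ^ 2 * l a + 2 * z * n' a with hk
  set n : Fin 3 → ℂ := fun a => 0 * k' a + z * l a + 1 * n' a with hn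
  have sg := cbil_symm hg.symm
  have hΦkk : cbil Φ k k = 0 := by simpa [hk] using h1
  have hΦkn : cbil Φ k n = 0 := by simpa [hk, hn] using h2
  have kx : ∀ v, cbil g k v = 1 * cbil g k' v + z ^ 2 * cbil g l v + 2 * z * cbil g n' v :=
    fun v => cbil_smul_add g k' l n' v _ _ _
  have nx : ∀ v, cbil g n v = 0 * cbil g k' v + z * cbil g l v + 1 * cbil g n' v :=
    fun v => cbil_smul_add g k' l n' v _ _ _
  have hkk : cbil g k k = 0 := by
    rw [kx, sg k', sg l, sg n', kx, kx, kx, hf.kk, sg k' l, sg n' l, sg n' k']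
    simp only [sg l k', hf.kl, hf.kn, hf.ln, hf.ll, hf.nn]; ring
  have hkn : cbil g k n = 0 := by
    rw [kx, sg k', sg l, sg n', nx, nx, nx, hf.kk, sg k' l, sg n' l, sg n' k']
    simp only [sg l k', hf.kl, hf.kn, hf.ln, hf.ll, hf.nn]; ring
  have hnn : cbil g n n = -(1 / 2) := by
    rw [nx, sg k', sg l, sg n', nx, nx, nx, hf.kk, sg k' l, sg n' l, sg n' k']
    simp only [sg l k', hf.kl, hf.kn, hf.ln, hf.ll, hf.nn]; ring
  have hkl : cbil g k l = 1 := by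
    rw [kx, hf.kl, hf.ll, sg n', hf.ln]; ring
  clear_value k n
  have hre : cbil g k k = ((bil g (fun a => (k a).re) (fun a => (k a).re)
      - bil g (fun a => (k a).im) (fun a => (k a).im) : ℝ) : ℂ)
      + 2 * ((bil g (fun a => (k a).re) (fun a => (k a).im) : ℝ) : ℂ) * Complex.I := by
    exact cbil_self_eq hg.symm k
  set p : Fin 3 → ℝ := fun a => (k a).re with hp
  set q : Fin 3 → ℝ := fun a => (k a).im with hq
  rw [hkk] at hre
  have hre1 := congrArg Complex.re hre
  have hre2 := congrArg Complex.im hre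
  simp at hre1 hre2
  -- As k is null, its real and imaginary parts are orthogonal and of equal length N. This length is
  -- not zero because g(k, l) = 1. Hence k = N(e_0 + i e_1).
  have hp0 : 0 < bil g p p := by
    refine hg.pos _ fun h0 => ?_
    have hq0 : q = 0 := by
      by_contra hq0
      have := hg.pos q hq0
      rw [h0] at hre1
      simp [bil] at hre1 this
      linarith
    have hk0 : k = 0 := by
      funext a
      exact Complex.ext (congrFun h0 a) (congrFun hq0 a)
    rw [hk0] at hkl
    simp [cbil] at hkl
  set N := Real.sqrt (bil g p p) with hN
  have hN0 : N ≠ 0 := (Real.sqrt_pos.2 hp0).ne'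
  have hNN : N * N = bil g p p := Real.mul_self_sqrt hp0.le
  obtain ⟨e, he, he0, he1⟩ := hg.exists_isOrthonormal_pair (p := N⁻¹ • p) (q := N⁻¹ • q)
    (by rw [bil_smul_left, bil_smul_right, ← hNN]; field_simp)
    (by rw [bil_smul_left, bil_smul_right, show bil g q q = N * N by linarith]; field_simp)
    (by rw [bil_smul_left, bil_smul_right, hre2]; simp)
  have hkc : k = fun a => ∑ i, (![(N : ℂ), N * Complex.I, 0] : Fin 3 → ℂ) i * e i a := by
    funext a
    have h3 : p a = N * e 0 a := by rw [he0]; simp [hN0]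
    have h4 : q a = N * e 1 a := by rw [he1]; simp [hN0]
    rw [← Complex.re_add_im (k a)]
    change (p a : ℂ) + q a * _ = _
    rw [h3, h4]
    simp [Fin.sum_univ_three]; ring
  obtain ⟨d, hd⟩ := he.exists_expand n
  rw [hkc, hd, he.cbil] at hkn
  rw [hd, he.cbil] at hnn
  rw [hkc, cbil_sum] at hΦkk
  rw [hkc, hd, cbil_sum] at hΦkn
  simp [Fin.sum_univ_three] at hkn hnn hΦkk hΦkn
  have hNc : (N : ℂ) ≠ 0 := by exact_mod_cast hN0
  have hI := Complex.I_sq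
  have s10 := bil_symm hs (e 1) (e 0)
  -- Orthogonality to k makes the part of n in the plane of e_0 and e_1 a multiple of k. This part
  -- is null, so g(n, n) = -1/2 forces d 2 ≠ 0.
  have d0 : d 0 = - Complex.I * d 1 := mul_left_cancel₀ hNc (by linear_combination hkn)
  rw [d0] at hnn hΦkn
  have d2 : d 2 ≠ 0 := by
    intro h0
    rw [h0] at hnn
    have : (-(1 / 2) : ℂ) = 0 := by linear_combination -hnn + d 1 ^ 2 * hI
    norm_num at this
  -- Φ(k, k) is N² times this expression. Removing the k-part of n from Φ(k, n) leaves N d_2 (Φ_02 +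
  -- iΦ_12). Since Φ is real, the real and imaginary parts vanish separately.
  have hkk' : ((bil Φ (e 0) (e 0) - bil Φ (e 1) (e 1) : ℝ) : ℂ)
      + ((2 * bil Φ (e 0) (e 1) : ℝ) : ℂ) * Complex.I = 0 := by
    refine mul_left_cancel₀ (mul_ne_zero hNc hNc) ?_
    rw [s10] at hΦkk
    push_cast
    linear_combination hΦkk - (N : ℂ) * N * bil Φ (e 1) (e 1) * hI
  have hkn' : ((bil Φ (e 0) (e 2) : ℝ) : ℂ) + ((bil Φ (e 1) (e 2) : ℝ) : ℂ) * Complex.I = 0 := by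
    refine mul_left_cancel₀ (mul_ne_zero hNc d2) ?_
    rw [s10] at hΦkn
    push_cast at hkk'
    linear_combination hΦkn + N * Complex.I * d 1 * hkk' - N * d 1 * bil Φ (e 0) (e 1) * hI
  have c1 := congrArg Complex.re hkk'
  have c2 := congrArg Complex.im hkk'
  have c3 := congrArg Complex.re hkn'
  have c4 := congrArg Complex.im hkn'
  simp at c1 c2 c3 c4
  exact ⟨_, _, he.isUniaxial hs (by linarith) c2 c3 c4 (ht e he)⟩

/-- For null ξ only the first term of φ(3 u u - g) contributes, so the quartic is (3/2) φ g(u, ξ)².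
In the frame below, with r² = 1/2, g(u, ξ) = r(1 + z²), which puts the two double roots at ±i, away
from infinity. -/
theorem IsUniaxial.exists_ricciPoly {g Φ : Matrix (Fin 3) (Fin 3) ℝ} (hg : IsMetric g) {φ : ℝ}
    {u : Fin 3 → ℝ} (h : IsUniaxial g Φ φ u) : ∃ k l n, IsAdaptedFrame g k l n ∧
      ricciPoly Φ k l n = Polynomial.C (3 / 4 * φ : ℂ) * (Polynomial.X - Polynomial.C Complex.I) ^ 2
        * (Polynomial.X - Polynomial.C (-Complex.I)) ^ 2 := by
  obtain ⟨e, he, h2⟩ := hg.exists_isOrthonormal h.unit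
  have hI := Complex.I_sq
  obtain ⟨r, hr⟩ : ∃ r : ℂ, r ^ 2 = 1 / 2 := IsAlgClosed.exists_pow_nat_eq _ (by norm_num)
  refine ⟨fun a => ∑ i, (![r * Complex.I, 0, r] : Fin 3 → ℂ) i * e i a,
    fun a => ∑ i, (![-r * Complex.I, 0, r] : Fin 3 → ℂ) i * e i a,
    fun a => ∑ i, (![0, r * Complex.I, 0] : Fin 3 → ℂ) i * e i a,
    ⟨?_, ?_, ?_, ?_, ?_, ?_⟩, Polynomial.funext fun z => ?_⟩
  · rw [he.cbil]; simp [Fin.sum_univ_three]; linear_combination r ^ 2 * hI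
  · rw [he.cbil]; simp [Fin.sum_univ_three]; linear_combination r ^ 2 * hI
  · rw [he.cbil]; simp [Fin.sum_univ_three]; linear_combination -r ^ 2 * hI + 2 * hr
  · rw [he.cbil]; simp [Fin.sum_univ_three]
  · rw [he.cbil]; simp [Fin.sum_univ_three]
  · rw [he.cbil]; simp [Fin.sum_univ_three]; linear_combination r ^ 2 * hI - hr
  · rw [eval_ricciPoly]
    have h3 : (fun a => 1 * (∑ i, (![r * Complex.I, 0, r] : Fin 3 → ℂ) i * e i a)
        + z ^ 2 * (∑ i, (![-r * Complex.I, 0, r] : Fin 3 → ℂ) i * e i a)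
        + 2 * z * (∑ i, (![0, r * Complex.I, 0] : Fin 3 → ℂ) i * e i a))
        = fun a => ∑ i, (![r * Complex.I * (1 - z ^ 2), 2 * z * r * Complex.I, r * (1 + z ^ 2)] :
          Fin 3 → ℂ) i * e i a := by
      funext a; simp [Fin.sum_univ_three]; ring
    rw [h3, cbil_sum]
    have h4 : ∀ i j, bil Φ (e i) (e j)
        = φ * (3 * bil g (e i) (e 2) * bil g (e j) (e 2) - bil g (e i) (e j)) := by
      intro i j
      rw [h2]
      simp only [bil, h.eq, Fin.sum_univ_three]; ring
    simp only [h4, he _ _, Fin.sum_univ_three]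
    simp
    linear_combination (r ^ 2 * (-φ * z ^ 2 - z ^ 4 * φ / 2 - φ / 2) + 3 / 2 * z ^ 2 * φ
      - 3 / 4 * φ * (Complex.I ^ 2 - 1)) * hI + φ * (3 * z ^ 2 + 3 / 2 * z ^ 4 + 3 / 2) * hr

theorem IsUniaxial.isAlgSpecial {g Φ : Matrix (Fin 3) (Fin 3) ℝ} (hg : IsMetric g) {φ : ℝ}
    {u : Fin 3 → ℝ} (h : IsUniaxial g Φ φ u) : IsAlgSpecial g Φ := by
  obtain ⟨k, l, n, hf, hP⟩ := h.exists_ricciPoly hg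
  refine ⟨k, l, n, hf, Complex.I, ?_⟩
  rw [hP]
  exact Dvd.dvd.mul_right (Dvd.intro_left _ rfl) _

theorem IsUniaxial.isPetrovD {g Φ : Matrix (Fin 3) (Fin 3) ℝ} (hg : IsMetric g) {φ : ℝ}
    {u : Fin 3 → ℝ} (h : IsUniaxial g Φ φ u) (hφ : φ ≠ 0) : IsPetrovD g Φ := by
  obtain ⟨k, l, n, hf, hP⟩ := h.exists_ricciPoly hg
  refine ⟨k, l, n, hf, Complex.I, -Complex.I, 3 / 4 * φ, ?_, ?_, hP⟩
  · intro h
    have := congrArg Complex.im h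
    norm_num at this
  · have : (φ : ℂ) ≠ 0 := by exact_mod_cast hφ
    simpa using this

theorem IsPetrovD.isAlgSpecial {g Φ : Matrix (Fin 3) (Fin 3) ℝ} (h : IsPetrovD g Φ) :
    IsAlgSpecial g Φ := by
  obtain ⟨k, l, n, hf, z, w, c, -, -, hP⟩ := h
  refine ⟨k, l, n, hf, z, ?_⟩
  rw [hP]
  exact Dvd.dvd.mul_right (Dvd.intro_left _ rfl) _

end TMG

/-! ### Vector fields on the manifold and their components in a chart. -/

namespace TMG

variable {M : Type*} [TopologicalSpace M] [ChartedSpace E3 M]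
  {e e' : OpenPartialHomeomorph M E3}

theorem mdifferentiable_of_mem_maximalAtlas (he : e ∈ IsManifold.maximalAtlas (𝓡 3) ∞ M) :
    e.MDifferentiable (𝓡 3) (𝓡 3) :=
  ⟨(contMDiffOn_of_mem_maximalAtlas he).mdifferentiableOn (by simp),
    (contMDiffOn_symm_of_mem_maximalAtlas he).mdifferentiableOn (by simp)⟩

theorem tangentMapWithin_open {N N' : Type*} [TopologicalSpace N] [ChartedSpace E3 N]
    [TopologicalSpace N'] [ChartedSpace E3 N'] {f : N → N'} {S : Set N} (hS : IsOpen S)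
    {u : ∀ q : N, TangentSpace (𝓡 3) q} {q : N} (hq : q ∈ S) :
    tangentMapWithin (𝓡 3) (𝓡 3) f S ⟨q, u q⟩ = ⟨f q, mfderiv (𝓡 3) (𝓡 3) f q (u q)⟩ := by
  simp only [tangentMapWithin]
  rw [mfderivWithin_of_isOpen hS hq]

theorem eq_sum_single (w : E3) : w = ∑ a, w a • (EuclideanSpace.single a (1 : ℝ) : E3) := by
  ext b
  simp [Fin.sum_univ_three]
  fin_cases b <;> simp

theorem mfderiv_symm_apply (x w : E3) :
    (mfderiv (𝓡 3) (𝓡 3) e.symm x : E3 →L[ℝ] TangentSpace (𝓡 3) (e.symm x)) w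
      = ∑ a, w a • coordVec e x a := by
  let L : E3 →L[ℝ] E3 := mfderiv (𝓡 3) (𝓡 3) e.symm x
  calc L w = L (∑ a, w a • (EuclideanSpace.single a (1 : ℝ) : E3)) :=
        congrArg L (eq_sum_single w)
    _ = ∑ a, w a • L (EuclideanSpace.single a 1) := by rw [map_sum]; simp only [map_smul]

/-- A vector field is the combination of the coordinate vectors with its components. -/
theorem eq_sum_vecComp (he : e ∈ IsManifold.maximalAtlas (𝓡 3) ∞ M)
    (u : ∀ q : M, TangentSpace (𝓡 3) q) {x : E3} (hx : x ∈ e.target) :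
    u (e.symm x) = ∑ a, vecComp u e a x • coordVec e x a := by
  have h := (mdifferentiable_of_mem_maximalAtlas he).symm_comp_deriv (e.map_target hx)
  rw [e.right_inv hx] at h
  exact (DFunLike.congr_fun h (u (e.symm x))).symm.trans (mfderiv_symm_apply (e := e) x _)

variable [IsManifold (𝓡 3) ∞ M]

/-- The push-forward of a smooth vector field by the inverse of a chart. -/
theorem contMDiffOn_symm_push (he : e ∈ IsManifold.maximalAtlas (𝓡 3) ∞ M) {S : Set E3}
    (hS : S ⊆ e.target) {w : E3 → E3} (hw : ContDiffOn ℝ ∞ w S) :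
    ContMDiffOn (𝓡 3) (𝓡 3).tangent ∞
      (fun x => (⟨e.symm x, mfderiv (𝓡 3) (𝓡 3) e.symm x (w x)⟩ : TangentBundle (𝓡 3) M)) S := by
  have h1 := (contMDiffOn_symm_of_mem_maximalAtlas he).contMDiffOn_tangentMapWithin
    (m := ∞) (by simp) e.open_target.uniqueMDiffOn
  have h2 : ContMDiffOn (𝓡 3) (𝓡 3).tangent ∞
      (fun x => (⟨x, w x⟩ : TangentBundle (𝓡 3) E3)) S :=
    contMDiffOn_vectorSpace_iff_contDiffOn.2 hw
  refine (h1.comp h2 fun x hx => hS hx).congr fun x hx => ?_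
  exact (tangentMapWithin_open e.open_target (u := w) (hS hx)).symm

/-- The components of a smooth vector field in a chart are smooth. -/
theorem contDiffOn_vecComp (he : e ∈ IsManifold.maximalAtlas (𝓡 3) ∞ M) {U : Set M}
    {u : ∀ q : M, TangentSpace (𝓡 3) q}
    (hu : ContMDiffOn (𝓡 3) (𝓡 3).tangent ∞ (fun q => (⟨q, u q⟩ : TangentBundle (𝓡 3) M)) U)
    (a : Fin 3) : ContDiffOn ℝ ∞ (vecComp u e a) (e.target ∩ e.symm ⁻¹' U) := by
  have h1 := (contMDiffOn_of_mem_maximalAtlas he).contMDiffOn_tangentMapWithin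
    (m := ∞) (by simp) e.open_source.uniqueMDiffOn
  have h2 : ContMDiffOn (𝓡 3) (𝓡 3).tangent ∞
      (fun x => (⟨e.symm x, u (e.symm x)⟩ : TangentBundle (𝓡 3) M)) (e.target ∩ e.symm ⁻¹' U) :=
    hu.comp ((contMDiffOn_symm_of_mem_maximalAtlas he).mono Set.inter_subset_left) fun x hx => hx.2
  have h3 : ContMDiffOn (𝓡 3) (𝓡 3).tangent ∞
      (fun x => (⟨x, mfderiv (𝓡 3) (𝓡 3) e (e.symm x) (u (e.symm x))⟩ : TangentBundle (𝓡 3) E3))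
      (e.target ∩ e.symm ⁻¹' U) := by
    refine (h1.comp h2 fun x hx => e.map_target hx.1).congr fun x hx => ?_
    have := tangentMapWithin_open (f := e) e.open_source (u := u) (e.map_target hx.1)
    simp only [Function.comp]
    refine Eq.trans ?_ this.symm
    rw [e.right_inv hx.1]
  have h4 : ContDiffOn ℝ ∞ (fun x => (mfderiv (𝓡 3) (𝓡 3) e (e.symm x) (u (e.symm x)) : E3))
      (e.target ∩ e.symm ⁻¹' U) := contMDiffOn_vectorSpace_iff_contDiffOn.1 h3
  exact (EuclideanSpace.proj (𝕜 := ℝ) a).contDiff.comp_contDiffOn h4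

end TMG

/-! ### Components of the metric and of the volume form in a chart. -/

namespace TMG

theorem AlternatingMap.eq_mul_det {V : Type*} [AddCommGroup V] [Module ℝ V]
    (f : V [⋀^Fin 3]→ₗ[ℝ] ℝ) (c : Fin 3 → V) (hc : LinearIndependent ℝ c)
    (hs : ⊤ ≤ Submodule.span ℝ (Set.range c)) (A : Matrix (Fin 3) (Fin 3) ℝ) :
    f (fun i => ∑ j, A i j • c j) = f c * A.det := by
  have h := f.eq_smul_basis_det (Module.Basis.mk hc hs)
  have h2 : (Module.Basis.mk hc hs).toMatrix (fun i => ∑ j, A i j • c j) = A.transpose := by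
    ext i j
    rw [Module.Basis.toMatrix_apply, map_sum]
    have : ∀ k, (Module.Basis.mk hc hs).repr (c k) = Finsupp.single k 1 := by
      intro k
      have := (Module.Basis.mk hc hs).repr_self k
      rwa [Module.Basis.mk_apply] at this
    simp [this, Finsupp.single_apply]
  conv_lhs => rw [h]
  simp only [AlternatingMap.smul_apply, Module.Basis.det_apply, h2, Matrix.det_transpose,
    Module.Basis.coe_mk, smul_eq_mul]

variable {M : Type*} [TopologicalSpace M] [ChartedSpace E3 M]
  {e e' : OpenPartialHomeomorph M E3}

theorem sum_coordVec_injective (he : e ∈ IsManifold.maximalAtlas (𝓡 3) ∞ M) {x : E3}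
    (hx : x ∈ e.target) {v : Fin 3 → ℝ} (hv : ∑ a, v a • coordVec e x a = 0) : v = 0 := by
  have h := (mdifferentiable_of_mem_maximalAtlas he).symm.mfderiv_injective hx
  have h2 : (mfderiv (𝓡 3) (𝓡 3) e.symm x : E3 →L[ℝ] TangentSpace (𝓡 3) (e.symm x))
      (WithLp.toLp 2 v) = 0 := by
    rw [mfderiv_symm_apply]; exact hv
  have h3 : (WithLp.toLp 2 v : E3) = 0 := h (h2.trans (map_zero _).symm)
  funext a
  exact congrArg (fun w : E3 => w a) h3

theorem coordVec_linearIndependent (he : e ∈ IsManifold.maximalAtlas (𝓡 3) ∞ M) {x : E3}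
    (hx : x ∈ e.target) : LinearIndependent ℝ (coordVec e x) :=
  Fintype.linearIndependent_iff.2 fun _ hv => congrFun (sum_coordVec_injective he hx hv)

theorem exists_eq_sum_coordVec (he : e ∈ IsManifold.maximalAtlas (𝓡 3) ∞ M) {x : E3}
    (hx : x ∈ e.target) (w : TangentSpace (𝓡 3) (e.symm x)) :
    ∃ v : Fin 3 → ℝ, w = ∑ a, v a • coordVec e x a := by
  obtain ⟨w', hw⟩ := (mdifferentiable_of_mem_maximalAtlas he).symm.mfderiv_surjective hx w
  let w₀ : E3 := w'
  exact ⟨fun a => w₀ a, hw.symm.trans (mfderiv_symm_apply (e := e) x w₀)⟩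

theorem span_coordVec (he : e ∈ IsManifold.maximalAtlas (𝓡 3) ∞ M) {x : E3}
    (hx : x ∈ e.target) : ⊤ ≤ Submodule.span ℝ (Set.range (coordVec e x)) := by
  intro w _
  obtain ⟨v, rfl⟩ := exists_eq_sum_coordVec he hx w
  exact Submodule.sum_mem _ fun a _ => Submodule.smul_mem _ _ (Submodule.subset_span ⟨a, rfl⟩)

variable [IsManifold (𝓡 3) ∞ M]

theorem inner_sum_coordVec (g : Metric M) (x : E3) (v w : Fin 3 → ℝ) :
    g.inner (e.symm x) (∑ a, v a • coordVec e x a) (∑ a, w a • coordVec e x a)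
      = bil (metricComp g e x) v w := by
  simp only [map_sum, map_smul, sum_apply, smul_apply,
    bil, metricComp, Matrix.of_apply, smul_eq_mul]
  simp only [Fin.sum_univ_three]
  ring

/-- The components of a Riemannian metric in a chart. -/
theorem localMetric_metricComp (g : Metric M) (he : e ∈ IsManifold.maximalAtlas (𝓡 3) ∞ M) :
    LocalMetric e.target (metricComp g e) where
  isOpen := e.open_target
  smooth a b := by
    have hc : ∀ a, ContMDiffOn (𝓡 3) (𝓡 3).tangent ∞
        (fun x => (⟨e.symm x, coordVec e x a⟩ : TangentBundle (𝓡 3) M)) e.target := fun a =>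
      contMDiffOn_symm_push he subset_rfl (w := fun _ => EuclideanSpace.single a 1) contDiffOn_const
    have h1 : ContMDiffOn (𝓡 3) ((𝓡 3).prod 𝓘(ℝ)) ∞ (fun x => Bundle.TotalSpace.mk' ℝ
        (E := Bundle.Trivial M ℝ) (e.symm x)
        (g.inner (e.symm x) (coordVec e x a) (coordVec e x b))) e.target := by
      apply ContMDiffOn.clm_bundle_apply₂ (F₁ := E3) (F₂ := E3)
      · exact g.contMDiff.comp_contMDiffOn (contMDiffOn_symm_of_mem_maximalAtlas he)
      · exact hc a
      · exact hc b
    refine contMDiffOn_iff_contDiffOn.1 fun x hx => ?_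
    have h2 := h1 x hx
    simp only [Bundle.contMDiffWithinAt_totalSpace] at h2
    exact h2.2
  isMetric x hx :=
    { symm := fun a b => g.symm _ _ _
      pos := fun v hv => by
        rw [← inner_sum_coordVec]
        exact g.pos _ _ fun h => hv (sum_coordVec_injective he hx h) }

theorem bil_vecComp (g : Metric M) (he : e ∈ IsManifold.maximalAtlas (𝓡 3) ∞ M)
    (u w : ∀ q : M, TangentSpace (𝓡 3) q) {x : E3} (hx : x ∈ e.target) :
    bil (metricComp g e x) (fun a => vecComp u e a x) (fun a => vecComp w e a x)
      = g.inner (e.symm x) (u (e.symm x)) (w (e.symm x)) := by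
  rw [← inner_sum_coordVec, ← eq_sum_vecComp he u hx, ← eq_sum_vecComp he w hx]

theorem VolumeForm.form_sum {g : Metric M} (vol : VolumeForm g)
    (he : e ∈ IsManifold.maximalAtlas (𝓡 3) ∞ M) {x : E3} (hx : x ∈ e.target)
    (A : Matrix (Fin 3) (Fin 3) ℝ) : vol.form (e.symm x) (fun i => ∑ j, A i j • coordVec e x j)
      = vol.form (e.symm x) (coordVec e x) * A.det :=
  AlternatingMap.eq_mul_det _ _ (coordVec_linearIndependent he hx) (span_coordVec he hx) A

/-- An alternating 3-form in dimension three is fixed by one value. The matrix selecting the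
coordinate vectors a, b, c has the Levi-Civita symbol as its determinant. -/
theorem volComp_eq {g : Metric M} (vol : VolumeForm g)
    (he : e ∈ IsManifold.maximalAtlas (𝓡 3) ∞ M) {x : E3} (hx : x ∈ e.target) (a b c : Fin 3) :
    volComp vol e a b c x = vol.form (e.symm x) (coordVec e x) * eps ℝ a b c := by
  have h := vol.form_sum he hx (Matrix.of fun i j => if ![a, b, c] i = j then 1 else 0)
  have h2 : (fun i => ∑ j, (Matrix.of fun i j => if ![a, b, c] i = j then (1 : ℝ) else 0) i j •
      coordVec e x j) = ![coordVec e x a, coordVec e x b, coordVec e x c] := by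
    funext i
    simp only [Matrix.of_apply, ite_smul, one_smul, zero_smul, Finset.sum_ite_eq,
      Finset.mem_univ, if_true]
    fin_cases i <;> rfl
  rw [h2] at h
  rw [volComp, h]
  congr 1
  rw [Matrix.det_fin_three]
  fin_cases a <;> fin_cases b <;> fin_cases c <;> simp [eps]

theorem SolvesTMG.tmgOn {g : Metric M} {vol : VolumeForm g} {m Λ : ℝ} (h : SolvesTMG g vol m Λ)
    (he : e ∈ IsManifold.maximalAtlas (𝓡 3) ∞ M) :
    LocalFrame.TMGOn e.target (metricComp g e) (volComp vol e)
      (fun x => vol.form (e.symm x) (coordVec e x))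
      m Λ where
  smooth_v := vol.smooth e he
  vol_eq _ hx a b c := volComp_eq vol he hx a b c
  field_eq _ hx a b := h e he _ hx a b

/-- The expression in the absolute value is the volume form evaluated on the orthonormal frame, so
the normalisation applies. -/
theorem VolumeForm.abs_mul_det {g : Metric M} (vol : VolumeForm g)
    (he : e ∈ IsManifold.maximalAtlas (𝓡 3) ∞ M) {O : Set E3} (hO : O ⊆ e.target)
    {f : Fin 3 → Fin 3 → E3 → ℝ} (F : LocalFrame O (metricComp g e) f) {x : E3} (hx : x ∈ O) :
    |vol.form (e.symm x) (coordVec e x) *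
      ∑ a, ∑ b, ∑ c, eps ℝ a b c * f 0 a x * f 1 b x * f 2 c x| = 1 := by
  have h := vol.normalised (e.symm x) (fun i => ∑ j, f i j x • coordVec e x j) fun i j => by
    rw [inner_sum_coordVec]; exact F.orth x hx i j
  have h2 := vol.form_sum he (hO hx) (Matrix.of fun i j => f i j x)
  simp only [Matrix.of_apply] at h2
  rw [h2] at h
  rw [← h, Matrix.det_fin_three]
  congr 2
  simp [Fin.sum_univ_three, eps]
  ring

end TMG

/-! ### Uniqueness and covariance of the eigenvalue parameter and the axis. -/

namespace TMG

theorem IsOrthonormal.inv {g : Matrix (Fin 3) (Fin 3) ℝ} {e : Fin 3 → Fin 3 → ℝ}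
    (hg : ∀ a b, g a b = g b a) (he : IsOrthonormal g e) (a b : Fin 3) :
    g⁻¹ a b = ∑ i, e i a * e i b := by
  have : (Matrix.of fun a b => ∑ i, e i a * e i b) * g = 1 := by
    ext a b
    rw [Matrix.one_apply, ← he.complete, Matrix.mul_apply]
    simp only [Matrix.of_apply, Fin.sum_univ_three, hg b]
    ring
  rw [Matrix.inv_eq_left_inv this, Matrix.of_apply]

theorem IsUniaxial.bil_eq {g Φ : Matrix (Fin 3) (Fin 3) ℝ} (hg : ∀ a b, g a b = g b a) {φ : ℝ}
    {u : Fin 3 → ℝ} (h : IsUniaxial g Φ φ u) (v w : Fin 3 → ℝ) :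
    bil Φ v w = φ * (3 * bil g u v * bil g u w - bil g v w) := by
  simp only [bil, h.eq, Fin.sum_univ_three, hg 1 0, hg 2 0, hg 2 1]; ring

/-- Put c = g(u, u'). Comparing Φ(u, u') gives c(φ - φ') = 0. If c = 0, comparing Φ(u, u) and Φ(u',
u') gives 2φ = -φ' and -φ = 2φ', so both vanish. -/
theorem IsUniaxial.unique {g Φ : Matrix (Fin 3) (Fin 3) ℝ} (hg : ∀ a b, g a b = g b a) {φ φ' : ℝ}
    {u u' : Fin 3 → ℝ} (h : IsUniaxial g Φ φ u) (h' : IsUniaxial g Φ φ' u') : φ = φ' := by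
  have hu : bil g u u = 1 := h.unit
  have hu' : bil g u' u' = 1 := h'.unit
  have h1 := (h.bil_eq hg u u).symm.trans (h'.bil_eq hg u u)
  have h2 := (h.bil_eq hg u' u').symm.trans (h'.bil_eq hg u' u')
  have h3 := (h.bil_eq hg u u').symm.trans (h'.bil_eq hg u u')
  rw [bil_symm hg u' u] at *
  rw [hu] at h1 h3
  rw [hu'] at h2 h3
  rw [hu] at *
  by_cases hc : bil g u u' = 0
  · rw [hc] at h1 h2
    linarith
  · have : bil g u u' * (φ - φ') = 0 := by linear_combination h3 / 2
    rcases mul_eq_zero.1 this with h | h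
    · exact absurd h hc
    · linarith

/-- For φ ≠ 0 the two values of Φ(u, u) give g(u, u')² = 1, the equality case of the Cauchy–Schwarz
inequality. -/
theorem IsUniaxial.axis_unique {g Φ : Matrix (Fin 3) (Fin 3) ℝ} (hg : IsMetric g) {φ φ' : ℝ}
    {u u' : Fin 3 → ℝ} (h : IsUniaxial g Φ φ u) (h' : IsUniaxial g Φ φ' u') (hφ : φ ≠ 0) :
    u' = u ∨ u' = -u := by
  obtain rfl := h.unique hg.symm h'
  have hu : bil g u u = 1 := h.unit
  have hu' : bil g u' u' = 1 := h'.unit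
  have h1 := (h.bil_eq hg.symm u u).symm.trans (h'.bil_eq hg.symm u u)
  rw [hu, bil_symm hg.symm u' u] at h1
  have h2 : bil g u u' * bil g u u' = 1 := by
    have := mul_left_cancel₀ hφ h1
    linarith
  have key : ∀ c : ℝ, c * bil g u u' = 1 → c * c = 1 → u' = c • u := by
    intro c h3 h4
    by_contra hne
    have := hg.pos (u' - c • u) (sub_ne_zero.2 hne)
    rw [bil_sub_left, bil_symm hg.symm u', bil_symm hg.symm (c • u), bil_sub_left, bil_sub_left,
      bil_smul_left, bil_smul_left, bil_smul_right, bil_smul_right, bil_symm hg.symm u' u, hu, hu'] at this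
    nlinarith
  rcases mul_self_eq_one_iff.1 h2 with h3 | h3
  · left; simpa using key 1 (by rw [h3]; norm_num) (by norm_num)
  · right; simpa using key (-1) (by rw [h3]; norm_num) (by norm_num)

theorem IsUniaxial.ne_zero {g Φ : Matrix (Fin 3) (Fin 3) ℝ} (hg : ∀ a b, g a b = g b a) {φ : ℝ}
    {u : Fin 3 → ℝ} (h : IsUniaxial g Φ φ u) : Φ ≠ 0 ↔ φ ≠ 0 := by
  refine not_congr ⟨fun h0 => ?_, fun h0 => ?_⟩
  · have h1 := h.bil_eq hg u u
    have hu : bil g u u = 1 := h.unit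
    rw [hu, h0] at h1
    simp [bil] at h1
    norm_num at h1
    exact h1
  · ext a b
    rw [h.eq, h0]; simp

theorem IsUniaxial.neg {g Φ : Matrix (Fin 3) (Fin 3) ℝ} {φ : ℝ}
    {u : Fin 3 → ℝ} (h : IsUniaxial g Φ φ u) : IsUniaxial g Φ φ (-u) where
  unit := by simpa using h.unit
  eq a b := by simpa using h.eq a b

theorem IsUniaxial.transform {g Φ g' Φ' J : Matrix (Fin 3) (Fin 3) ℝ} {φ : ℝ}
    {u u' : Fin 3 → ℝ} (h : IsUniaxial g Φ φ u)
    (hg : ∀ a b, g' a b = ∑ c, ∑ d, J c a * J d b * g c d)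
    (hΦ : ∀ a b, Φ' a b = ∑ c, ∑ d, J c a * J d b * Φ c d) (hu : ∀ c, u c = ∑ a, J c a * u' a) :
    IsUniaxial g' Φ' φ u' := by
  have h1 : ∀ a, ∑ c, g' a c * u' c = ∑ d, J d a * ∑ f, g d f * u f := by
    intro a
    simp only [hg, hu, Fin.sum_univ_three]; ring
  refine ⟨?_, fun a b => ?_⟩
  · rw [← h.unit]
    simp only [hg, hu, Fin.sum_univ_three]; ring
  · rw [h1, h1, hΦ, hg]
    simp only [h.eq, Fin.sum_univ_three]; ring

namespace LocalFrame

variable {O : Set E3} {G : E3 → Matrix (Fin 3) (Fin 3) ℝ} {f : Fin 3 → Fin 3 → E3 → ℝ}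

theorem ricci_symm (F : LocalFrame O G f) {x : E3} (hx : x ∈ O) (a b : Fin 3) :
    ricci G a b x = ricci G b a x := by
  rw [← F.eval_ricci a b ⟨x, hx⟩, ← F.eval_ricci b a ⟨x, hx⟩, F.coord.eq_sum_frameComp F.coord.ricci a b,
    F.coord.eq_sum_frameComp F.coord.ricci b a, Finset.sum_comm]
  simp only [CoordFrame.ricci_frame]
  refine congrArg _ ?_
  refine Finset.sum_congr rfl fun i _ => Finset.sum_congr rfl fun j _ => ?_
  rw [F.coord.ric_symm]; ring

theorem tracefreeRicci_symm (F : LocalFrame O G f) {x : E3} (hx : x ∈ O) (a b : Fin 3) :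
    tracefreeRicci G a b x = tracefreeRicci G b a x := by
  rw [tracefreeRicci, tracefreeRicci, F.ricci_symm hx, F.symm x hx]

theorem contDiffOn_tracefreeRicci (F : LocalFrame O G f) (a b : Fin 3) :
    ContDiffOn ℝ ∞ (tracefreeRicci G a b) O := by
  refine (F.coord.ricci a b - algebraMap ℝ (SmoothFun O) (1 / 3) * F.coord.scalarCurv *
    F.coord.G a b).2.congr fun x hx => ?_
  rw [SmoothFun.extendZero_eq _ hx]
  simp only [map_sub, map_mul, F.eval_ricci, F.eval_scalarCurv, F.eval_G, SmoothFun.eval_algebraMap]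
  rfl

end LocalFrame

theorem tracefreeRicci_trace {G : E3 → Matrix (Fin 3) (Fin 3) ℝ} {x : E3}
    (hG : ∀ a b, G x a b = G x b a) {e : Fin 3 → Fin 3 → ℝ} (he : IsOrthonormal (G x) e) :
    ∑ i, bil (Matrix.of fun a b => tracefreeRicci G a b x) (e i) (e i) = 0 := by
  have h1 : scalarCurv G x = ∑ a, ∑ b, (∑ i, e i a * e i b) * ricci G a b x := by
    simp only [scalarCurv, he.inv hG]
  have h2 : ∑ i, bil (Matrix.of fun a b => tracefreeRicci G a b x) (e i) (e i)
      = (∑ a, ∑ b, (∑ i, e i a * e i b) * ricci G a b x)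
        - 1 / 3 * scalarCurv G x * ∑ i, bil (G x) (e i) (e i) := by
    simp only [bil, tracefreeRicci, Matrix.of_apply, Fin.sum_univ_three]; ring
  rw [h2, ← h1]
  simp [he _ _]
  ring

end TMG

/-! ### Transition laws between charts and chart-independence of the uniaxial form. -/

namespace TMG

theorem fderiv_apply_eq_sum_jac {ψ : E3 → E3} {y : E3} (hψ : DifferentiableAt ℝ ψ y) (w : E3)
    (c : Fin 3) : fderiv ℝ ψ y w c = ∑ a, jac ψ y c a * w a := by
  conv_lhs => rw [eq_sum_single w, Fin.sum_univ_three, map_add, map_add, map_smul, map_smul, map_smul]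
  simp only [jac_eq hψ, Fin.sum_univ_three, PiLp.add_apply, PiLp.smul_apply, smul_eq_mul]
  ring

theorem LocalFrame.mono {O : Set E3} {G : E3 → Matrix (Fin 3) (Fin 3) ℝ}
    {f : Fin 3 → Fin 3 → E3 → ℝ} (F : LocalFrame O G f) {O' : Set E3} (hO' : IsOpen O')
    (hs : O' ⊆ O) : LocalFrame O' G f :=
  ⟨hO', fun a b => (F.smooth_G a b).mono hs, fun i a => (F.smooth_e i a).mono hs,
    fun x hx => F.symm x (hs hx), fun x hx => F.orth x (hs hx)⟩

variable {M : Type*} [TopologicalSpace M] [ChartedSpace E3 M]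
  {e e' : OpenPartialHomeomorph M E3}

theorem coordChange_of_mem_maximalAtlas (he : e ∈ IsManifold.maximalAtlas (𝓡 3) ∞ M)
    (he' : e' ∈ IsManifold.maximalAtlas (𝓡 3) ∞ M) :
    CoordChange (e'.target ∩ e'.symm ⁻¹' e.source) (e.target ∩ e.symm ⁻¹' e'.source)
      (e ∘ e'.symm) (e' ∘ e.symm) where
  isOpen' := e'.isOpen_inter_preimage_symm e.open_source
  isOpen := e.isOpen_inter_preimage_symm e'.open_source
  smooth := contMDiffOn_iff_contDiffOn.1 ((contMDiffOn_of_mem_maximalAtlas he).comp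
    ((contMDiffOn_symm_of_mem_maximalAtlas he').mono Set.inter_subset_left) fun _ hx => hx.2)
  smooth_inv := contMDiffOn_iff_contDiffOn.1 ((contMDiffOn_of_mem_maximalAtlas he').comp
    ((contMDiffOn_symm_of_mem_maximalAtlas he).mono Set.inter_subset_left) fun _ hx => hx.2)
  mapsTo y hy := ⟨e.map_source hy.2, by
    simp [e.left_inv hy.2, e'.map_target hy.1]⟩
  mapsTo_inv y hy := ⟨e'.map_source hy.2, by
    simp [e'.left_inv hy.2, e.map_target hy.1]⟩
  left_inv y hy := by simp [e.left_inv hy.2, e'.right_inv hy.1]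
  right_inv y hy := by simp [e'.left_inv hy.2, e.right_inv hy.1]

theorem vecComp_congr_point (u : ∀ q : M, TangentSpace (𝓡 3) q) (a : Fin 3) {p q : M}
    (h : p = q) : (show E3 from mfderiv (𝓡 3) (𝓡 3) e p (u p)) a
      = (show E3 from mfderiv (𝓡 3) (𝓡 3) e q (u q)) a := by
  rw [h]

theorem vecComp_apply (u : ∀ q : M, TangentSpace (𝓡 3) q) (a : Fin 3) {q : M}
    (hq : q ∈ e.source) :
    vecComp u e a (e q) = (show E3 from mfderiv (𝓡 3) (𝓡 3) e q (u q)) a :=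
  vecComp_congr_point u a (e.left_inv hq)

/-- The transformation law of vector components. -/
theorem vecComp_transition (he : e ∈ IsManifold.maximalAtlas (𝓡 3) ∞ M)
    (he' : e' ∈ IsManifold.maximalAtlas (𝓡 3) ∞ M) (u : ∀ q : M, TangentSpace (𝓡 3) q) {q : M}
    (hq : q ∈ e.source) (hq' : q ∈ e'.source) (c : Fin 3) :
    vecComp u e c (e q) = ∑ a, jac (e ∘ e'.symm) (e' q) c a * vecComp u e' a (e' q) := by
  have h := coordChange_of_mem_maximalAtlas he he'
  have hy : e' q ∈ e'.target ∩ e'.symm ⁻¹' e.source :=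
    ⟨e'.map_source hq', by simpa [e'.left_inv hq'] using hq⟩
  have hψ := h.differentiableAt hy
  have h1 : mfderiv (𝓡 3) (𝓡 3) e q
      = (mfderiv (𝓡 3) (𝓡 3) (e ∘ e'.symm) (e' q)).comp (mfderiv (𝓡 3) (𝓡 3) e' q) := by
    rw [← mfderiv_comp q hψ.mdifferentiableAt
      ((mdifferentiable_of_mem_maximalAtlas he').mdifferentiableAt hq')]
    refine Filter.EventuallyEq.mfderiv_eq ?_
    filter_upwards [e'.open_source.mem_nhds hq'] with p hp
    simp [e'.left_inv hp]
  rw [vecComp_apply u c hq, h1]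
  simp only [vecComp_apply u _ hq']
  rw [mfderiv_eq_fderiv]
  exact fderiv_apply_eq_sum_jac hψ _ c

theorem vecComp_eq (he : e ∈ IsManifold.maximalAtlas (𝓡 3) ∞ M)
    {u : ∀ q : M, TangentSpace (𝓡 3) q} {x : E3} (hx : x ∈ e.target) {v : Fin 3 → ℝ}
    (hu : u (e.symm x) = ∑ a, v a • coordVec e x a) (a : Fin 3) : vecComp u e a x = v a := by
  have h := hu.symm.trans (eq_sum_vecComp he u hx)
  have h2 : ∑ a, (v a - vecComp u e a x) • coordVec e x a = 0 := by
    simp only [sub_smul, Finset.sum_sub_distrib, h, sub_self]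
  have := congrFun (sum_coordVec_injective he hx h2) a
  simp at this
  linarith

variable [IsManifold (𝓡 3) ∞ M]

/-- The transformation law of the components of the metric. -/
theorem metricComp_transition (g : Metric M) (he : e ∈ IsManifold.maximalAtlas (𝓡 3) ∞ M)
    (he' : e' ∈ IsManifold.maximalAtlas (𝓡 3) ∞ M) {y : E3}
    (hy : y ∈ e'.target ∩ e'.symm ⁻¹' e.source) (a b : Fin 3) :
    metricComp g e' y a b = ∑ c, ∑ d, jac (e ∘ e'.symm) y c a * jac (e ∘ e'.symm) y d b *
      metricComp g e ((e ∘ e'.symm) y) c d := by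
  -- All tangent spaces are the model space `E3`, so a coordinate vector at one point can be viewed
  -- as a constant field. Only its value at that point is used.
  let u : Fin 3 → ∀ q : M, TangentSpace (𝓡 3) q := fun a _ => (coordVec e' y a : E3)
  have h1 : ∀ a b, vecComp (u a) e' b y = if b = a then 1 else 0 := fun a b =>
    vecComp_eq he' hy.1 (v := fun b => if b = a then 1 else 0) (by simp [u]) b
  have h2 : ∀ a c, vecComp (u a) e c ((e ∘ e'.symm) y) = jac (e ∘ e'.symm) y c a := by
    intro a c
    have := vecComp_transition he he' (u a) hy.2 (e'.map_target hy.1) c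
    rw [e'.right_inv hy.1] at this
    rw [Function.comp_apply, this]
    simp [h1]
  have hx : (e ∘ e'.symm) y ∈ e.target := e.map_source hy.2
  have h3 := bil_vecComp g he (u a) (u b) hx
  simp only [h2] at h3
  have h4 : e.symm ((e ∘ e'.symm) y) = e'.symm y := e.left_inv hy.2
  rw [h4, ← bil_vecComp g he' (u a) (u b) hy.1] at h3
  simp only [h1] at h3
  have h5 : bil (metricComp g e' y) (fun b => if b = a then 1 else 0)
      (fun c => if c = b then 1 else 0) = metricComp g e' y a b := by simp [bil]
  rw [← h5, ← h3, bil]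
  refine Finset.sum_congr rfl fun _ _ => Finset.sum_congr rfl fun _ _ => by ring

/-- The tracefree Ricci tensor at `q` is uniaxial with eigenvalue parameter `φ` and axis `u`. -/
def UniaxialAt (g : Metric M) (q : M) (φ : ℝ) (u : ∀ q : M, TangentSpace (𝓡 3) q) : Prop :=
  ∀ e ∈ IsManifold.maximalAtlas (𝓡 3) ∞ M, q ∈ e.source →
    IsUniaxial (metricComp g e (e q)) (tracefreeRicciComp g e (e q)) φ
      (fun a => vecComp u e a (e q))

/-- One chart suffices: g, Φ and u all transform by the Jacobian. For Φ this requires an orthonormal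
frame, hence the passage to a smaller overlap on which one exists. -/
theorem uniaxialAt_of_chart {g : Metric M} (he : e ∈ IsManifold.maximalAtlas (𝓡 3) ∞ M) {q : M}
    (hq : q ∈ e.source) {φ : ℝ} {u : ∀ q : M, TangentSpace (𝓡 3) q}
    (h : IsUniaxial (metricComp g e (e q)) (tracefreeRicciComp g e (e q)) φ
      (fun a => vecComp u e a (e q))) : UniaxialAt g q φ u := by
  intro e' he' hq'
  have hy : e' q ∈ e'.target ∩ e'.symm ⁻¹' e.source :=
    ⟨e'.map_source hq', by simpa [e'.left_inv hq'] using hq⟩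
  have hψ : (e ∘ e'.symm) (e' q) = e q := by simp [e'.left_inv hq']
  have hc := coordChange_of_mem_maximalAtlas he he'
  obtain ⟨O, hO, hqO, f, F⟩ := (localMetric_metricComp g he).exists_localFrame' (e.map_source hq)
  set O₁ := e.target ∩ e.symm ⁻¹' e'.source with hO₁
  have hc' : CoordChange ((e'.target ∩ e'.symm ⁻¹' e.source) ∩ (e ∘ e'.symm) ⁻¹' O) (O₁ ∩ O)
      (e ∘ e'.symm) (e' ∘ e.symm) := 
    { isOpen' := hc.smooth.continuousOn.isOpen_inter_preimage hc.isOpen' F.isOpen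
      isOpen := hc.isOpen.inter F.isOpen
      smooth := hc.smooth.mono Set.inter_subset_left
      smooth_inv := hc.smooth_inv.mono Set.inter_subset_left
      mapsTo := fun y hy => ⟨hc.mapsTo hy.1, hy.2⟩
      mapsTo_inv := fun x hx => ⟨hc.mapsTo_inv hx.1, by
        rw [Set.mem_preimage, hc.right_inv x hx.1]; exact hx.2⟩
      left_inv := fun y hy => hc.left_inv y hy.1
      right_inv := fun x hx => hc.right_inv x hx.1 }
  have F' : LocalFrame (O₁ ∩ O) (metricComp g e) f :=
    F.mono (hc.isOpen.inter F.isOpen) Set.inter_subset_right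
  refine h.transform (J := Matrix.of fun c a => jac (e ∘ e'.symm) (e' q) c a) (fun a b => ?_)
    (fun a b => ?_) fun c => vecComp_transition he he' u hq hq' c
  · rw [metricComp_transition g he he' hy, hψ]; rfl
  · have := hc'.tracefreeRicci_eq F' (fun y hy => metricComp_transition g he he' hy.1)
      (y := e' q) ⟨hy, by rw [Set.mem_preimage, hψ]; exact hqO⟩ a b
    rw [hψ] at this
    exact this

end TMG

/-! ### Smoothness of the eigenvalue parameter and of the axis. -/

namespace TMG

section Pointwise

variable {g Φ : Matrix (Fin 3) (Fin 3) ℝ} {e : Fin 3 → Fin 3 → ℝ} {φ : ℝ} {u : Fin 3 → ℝ}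

theorem IsOrthonormal.eq_sum (he : IsOrthonormal g e) (hg : ∀ a b, g a b = g b a) (v : Fin 3 → ℝ)
    (a : Fin 3) : v a = ∑ i, bil g v (e i) * e i a := by
  have h : ∑ i, bil g v (e i) * e i a = ∑ b, (∑ i, e i a * ∑ c, g b c * e i c) * v b := by
    simp only [bil, Fin.sum_univ_three, hg 1 0, hg 2 0, hg 2 1]; ring
  rw [h]
  simp [he.complete]

theorem IsOrthonormal.parseval (he : IsOrthonormal g e) (hg : ∀ a b, g a b = g b a)
    (v : Fin 3 → ℝ) : ∑ i, bil g v (e i) * bil g v (e i) = bil g v v := by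
  have h : ∑ i, bil g v (e i) * bil g v (e i) = ∑ a, (∑ i, bil g v (e i) * e i a) *
      ∑ b, g a b * v b := by
    simp only [bil, Fin.sum_univ_three, hg 1 0, hg 2 0, hg 2 1]; ring
  rw [h]
  simp only [← he.eq_sum hg v]
  simp only [bil, Finset.mul_sum]
  exact Finset.sum_congr rfl fun _ _ => Finset.sum_congr rfl fun _ _ => by ring

theorem IsUniaxial.bil_frame (h : IsUniaxial g Φ φ u) (hg : ∀ a b, g a b = g b a)
    (he : IsOrthonormal g e) (i j : Fin 3) : bil Φ (e i) (e j)
      = φ * (3 * bil g u (e i) * bil g u (e j) - if i = j then 1 else 0) := by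
  rw [h.bil_eq hg, he]

/-- The eigenvalues are -φ, -φ, 2φ, so the traces of Φ² and Φ³ are 6φ² and 6φ³. Their quotient
exhibits φ as a smooth function wherever Φ ≠ 0. -/
theorem IsUniaxial.sum_sq (h : IsUniaxial g Φ φ u) (hg : ∀ a b, g a b = g b a)
    (he : IsOrthonormal g e) : ∑ i, ∑ j, bil Φ (e i) (e j) * bil Φ (e i) (e j) = 6 * φ ^ 2 := by
  have h1 := (he.parseval hg u).trans h.unit
  simp only [h.bil_frame hg he]
  simp only [Fin.sum_univ_three] at h1 ⊢
  simp only [Fin.isValue, if_true, Fin.reduceEq, if_false]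
  generalize bil g u (e 0) = x at *
  generalize bil g u (e 1) = y at *
  generalize bil g u (e 2) = z at *
  linear_combination φ ^ 2 * (9 * (x * x + y * y + z * z) + 3) * h1

theorem IsUniaxial.sum_cube (h : IsUniaxial g Φ φ u) (hg : ∀ a b, g a b = g b a)
    (he : IsOrthonormal g e) : ∑ i, ∑ j, ∑ k, bil Φ (e i) (e j) * bil Φ (e j) (e k) *
      bil Φ (e k) (e i) = 6 * φ ^ 3 := by
  have h1 := (he.parseval hg u).trans h.unit
  simp only [h.bil_frame hg he]
  simp only [Fin.sum_univ_three] at h1 ⊢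
  simp only [Fin.isValue, if_true, Fin.reduceEq, if_false]
  generalize bil g u (e 0) = x at *
  generalize bil g u (e 1) = y at *
  generalize bil g u (e 2) = z at *
  linear_combination φ ^ 3 * (27 * (x * x + y * y + z * z) ^ 2 + 9) * h1

/-- The axis of a uniaxial tensor, expressed by its components in an orthonormal frame. -/
theorem IsUniaxial.axis_formula (h : IsUniaxial g Φ φ u) (hg : ∀ a b, g a b = g b a)
    (he : IsOrthonormal g e) (hφ : φ ≠ 0) {k : Fin 3} {W : Fin 3 → ℝ}
    (hW : ∀ i, W i = (bil Φ (e i) (e k) / φ + if i = k then 1 else 0) / 3) (hk : 0 < W k) :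
    -- The tensor (Φ/φ + g)/3 is u ⊗ u, so W_i = u_i u_k, and W_i/√W_k is u_i up to the sign of u_k.
    -- This recovers the axis from Φ by a smooth formula.
    IsUniaxial g Φ φ fun a => ∑ i, W i * (√(W k))⁻¹ * e i a := by
  have h1 : ∀ i, W i = bil g u (e i) * bil g u (e k) := by
    intro i
    rw [hW, h.bil_frame hg he]
    field_simp
    ring
  have h2 : bil g u (e k) ≠ 0 := by
    intro h0
    rw [h1, h0] at hk
    simp at hk
  have h3 : √(W k) = |bil g u (e k)| := by rw [h1, Real.sqrt_mul_self_eq_abs]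
  rcases abs_choice (bil g u (e k)) with h4 | h4
  · convert h using 1
    funext a
    rw [he.eq_sum hg u a]
    refine Finset.sum_congr rfl fun i _ => ?_
    rw [h3, h4, h1, mul_inv_cancel_right₀ h2]
  · convert h.neg using 1
    funext a
    rw [Pi.neg_apply, he.eq_sum hg u a, ← Finset.sum_neg_distrib]
    refine Finset.sum_congr rfl fun i _ => ?_
    rw [h3, h4, h1, inv_neg, mul_neg, mul_inv_cancel_right₀ h2, neg_mul]

end Pointwise

namespace LocalFrame

variable {O : Set E3} {G : E3 → Matrix (Fin 3) (Fin 3) ℝ} {f : Fin 3 → Fin 3 → E3 → ℝ}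

theorem contDiffOn_bil_tracefreeRicci (F : LocalFrame O G f) (i j : Fin 3) :
    ContDiffOn ℝ ∞ (fun x => bil (Matrix.of fun a b => tracefreeRicci G a b x)
      (fun a => f i a x) (fun a => f j a x)) O :=
  ContDiffOn.sum fun a _ => ContDiffOn.sum fun b _ =>
    ((F.contDiffOn_tracefreeRicci a b).mul (F.smooth_e i a)).mul (F.smooth_e j b)

/-- The axis of a non-zero uniaxial tracefree Ricci tensor can locally be chosen smoothly. -/
theorem exists_smooth_axis (F : LocalFrame O G f)
    (h : ∀ x ∈ O, ∃ φ u, IsUniaxial (G x) (Matrix.of fun a b => tracefreeRicci G a b x) φ u)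
    {x₀ : E3} (hx₀ : x₀ ∈ O) (h0 : (Matrix.of fun a b => tracefreeRicci G a b x₀) ≠ 0) :
    ∃ O' ⊆ O, IsOpen O' ∧ x₀ ∈ O' ∧ ∃ (φ : E3 → ℝ) (u : Fin 3 → E3 → ℝ), ContDiffOn ℝ ∞ φ O' ∧
      (∀ a, ContDiffOn ℝ ∞ (u a) O') ∧ ∀ x ∈ O', φ x ≠ 0 ∧ IsUniaxial (G x)
        (Matrix.of fun a b => tracefreeRicci G a b x) (φ x) (fun a => u a x) := by
  set B : Fin 3 → Fin 3 → E3 → ℝ := fun i j x => bil (Matrix.of fun a b => tracefreeRicci G a b x)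
      (fun a => f i a x) (fun a => f j a x) with hB
  have hBs : ∀ i j, ContDiffOn ℝ ∞ (B i j) O := F.contDiffOn_bil_tracefreeRicci
  have horth : ∀ x ∈ O, IsOrthonormal (G x) fun i a => f i a x := fun x hx => F.orth x hx
  set T2 : E3 → ℝ := fun x => ∑ i, ∑ j, B i j x * B i j x with hT2
  set T3 : E3 → ℝ := fun x => ∑ i, ∑ j, ∑ k, B i j x * B j k x * B k i x with hT3
  have hT2s : ContDiffOn ℝ ∞ T2 O := ContDiffOn.sum fun i _ => ContDiffOn.sum fun j _ =>
    (hBs i j).mul (hBs i j)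
  have hT3s : ContDiffOn ℝ ∞ T3 O := ContDiffOn.sum fun i _ => ContDiffOn.sum fun j _ =>
    ContDiffOn.sum fun k _ => ((hBs i j).mul (hBs j k)).mul (hBs k i)
  set φ : E3 → ℝ := fun x => T3 x / T2 x with hφ
  set O₁ := O ∩ T2 ⁻¹' {0}ᶜ with hO₁
  have ho₁ : IsOpen O₁ := hT2s.continuousOn.isOpen_inter_preimage F.isOpen isOpen_compl_singleton
  have hφs : ContDiffOn ℝ ∞ φ O₁ := (hT3s.mono Set.inter_subset_left).div
    (hT2s.mono Set.inter_subset_left) fun x hx => hx.2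
  have hu : ∀ x ∈ O₁, ∃ u, φ x ≠ 0 ∧
      IsUniaxial (G x) (Matrix.of fun a b => tracefreeRicci G a b x) (φ x) u := by
    intro x hx
    obtain ⟨φ', u, hu⟩ := h x hx.1
    have h2 : T2 x = 6 * φ' ^ 2 := hu.sum_sq (F.symm x hx.1) (horth x hx.1)
    have h3 : T3 x = 6 * φ' ^ 3 := hu.sum_cube (F.symm x hx.1) (horth x hx.1)
    have h4 : φ' ≠ 0 := by
      rintro rfl
      exact hx.2 (by rw [h2]; simp)
    have h5 : φ x = φ' := by
      simp only [hφ, h2, h3]; field_simp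
    exact ⟨u, by rwa [h5], by rwa [h5]⟩
  have hx₁ : x₀ ∈ O₁ := by
    obtain ⟨φ', u, hu⟩ := h x₀ hx₀
    refine ⟨hx₀, ?_⟩
    have h2 : T2 x₀ = 6 * φ' ^ 2 := hu.sum_sq (F.symm x₀ hx₀) (horth x₀ hx₀)
    have := (hu.ne_zero (F.symm x₀ hx₀)).1 h0
    simp [h2, this]
  set W : Fin 3 → Fin 3 → E3 → ℝ := fun k i x => (B i k x / φ x + if i = k then 1 else 0) / 3
    with hW
  have hWs : ∀ k i, ContDiffOn ℝ ∞ (W k i) O₁ := fun k i =>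
    ((((hBs i k).mono Set.inter_subset_left).div hφs fun x hx => (hu x hx).choose_spec.1).add
      contDiffOn_const).div_const 3
  -- The diagonal entries u_k² add up to 1, so one of them is positive at x₀ and remains so nearby.
  obtain ⟨k, hk⟩ : ∃ k, 0 < W k k x₀ := by
    obtain ⟨u, h1, h2⟩ := hu x₀ hx₁
    have h3 : ∑ k, W k k x₀ = 1 := by
      have h4 := ((horth x₀ hx₀).parseval (F.symm x₀ hx₀) u).trans h2.unit
      rw [← h4]
      refine Finset.sum_congr rfl fun k _ => ?_
      have := h2.bil_frame (F.symm x₀ hx₀) (horth x₀ hx₀) k k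
      simp only [hW, hB, this]
      field_simp
      ring
    by_contra! hc
    have := Finset.sum_nonpos fun k (_ : k ∈ Finset.univ) => hc k
    linarith
  refine ⟨O₁ ∩ W k k ⁻¹' Set.Ioi 0, fun x hx => hx.1.1,
    (hWs k k).continuousOn.isOpen_inter_preimage ho₁ isOpen_Ioi, ⟨hx₁, hk⟩, φ,
    fun a x => ∑ i, W k i x * (√(W k k x))⁻¹ * f i a x, hφs.mono Set.inter_subset_left,
    fun a => ContDiffOn.sum fun i _ => (((hWs k i).mono Set.inter_subset_left).mul ?_).mul
      ((F.smooth_e i a).mono fun x hx => hx.1.1), fun x hx => ?_⟩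
  · exact ((hWs k k).mono Set.inter_subset_left |>.sqrt fun x hx => (ne_of_gt hx.2)).inv
      fun x hx => (Real.sqrt_pos.2 hx.2).ne'
  · obtain ⟨u, h1, h2⟩ := hu x hx.1
    exact ⟨h1, h2.axis_formula (F.symm x hx.1.1) (horth x hx.1.1) h1 (W := fun i => W k i x)
      (fun i => rfl) hx.2⟩

end LocalFrame

end TMG

/-! ### The local results on the manifold. -/

namespace TMG

variable {M : Type*} [TopologicalSpace M] [ChartedSpace E3 M] [IsManifold (𝓡 3) ∞ M]
  {e e' : OpenPartialHomeomorph M E3} {g : Metric M} {vol : VolumeForm g} {m Λ : ℝ}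

theorem LocalFrame.TMGOn.mono {O O' : Set E3} {G : E3 → Matrix (Fin 3) (Fin 3) ℝ}
    {vol : Fin 3 → Fin 3 → Fin 3 → E3 → ℝ} {v : E3 → ℝ} {m Λ : ℝ}
    (T : LocalFrame.TMGOn O G vol v m Λ) (h : O' ⊆ O) : LocalFrame.TMGOn O' G vol v m Λ :=
  ⟨T.smooth_v.mono h, fun x hx => T.vol_eq x (h hx), fun x hx => T.field_eq x (h hx)⟩

/-- A shear-free geodesic unit vector field is an axis of the tracefree Ricci tensor. -/
theorem SolvesTMG.isUniaxial_of_shearFree (hT : SolvesTMG g vol m Λ) (hm : m ≠ 0)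
    (he : e ∈ IsManifold.maximalAtlas (𝓡 3) ∞ M) {O : Set E3} (hO : IsOpen O) (hOe : O ⊆ e.target)
    {u : Fin 3 → E3 → ℝ} (hu : ∀ a, ContDiffOn ℝ ∞ (u a) O)
    (hu1 : ∀ x ∈ O, bil (metricComp g e x) (fun a => u a x) (fun a => u a x) = 1)
    (hs : ∀ x ∈ O, IsGeodesicAt (metricComp g e) u x ∧ IsShearFreeAt (metricComp g e) u x)
    {x : E3} (hx : x ∈ O) :
    ∃ φ, IsUniaxial (metricComp g e x) (tracefreeRicciComp g e x) φ fun a => u a x := by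
  obtain ⟨O', hO', hx', f, F, rfl⟩ :=
    ((localMetric_metricComp g he).mono hO hOe).exists_localFrame hu hu1 hx
  exact F.isUniaxial_of_shearFree ((hT.tmgOn he).mono (hO'.trans hOe)) hm
    (fun x hx => vol.abs_mul_det he (hO'.trans hOe) F hx) (fun x hx => hs x (hO' hx)) hx'

/-- A smooth axis of a non-zero uniaxial tracefree Ricci tensor is shear-free and geodesic. -/
theorem SolvesTMG.shearFree_of_isUniaxial (hT : SolvesTMG g vol m Λ) (hm : m ≠ 0)
    (he : e ∈ IsManifold.maximalAtlas (𝓡 3) ∞ M) {O : Set E3} (hO : IsOpen O) (hOe : O ⊆ e.target)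
    {u : Fin 3 → E3 → ℝ} (hu : ∀ a, ContDiffOn ℝ ∞ (u a) O) {φ : E3 → ℝ} (hφ : ContDiffOn ℝ ∞ φ O)
    (h : ∀ x ∈ O, φ x ≠ 0 ∧
      IsUniaxial (metricComp g e x) (tracefreeRicciComp g e x) (φ x) fun a => u a x)
    {x : E3} (hx : x ∈ O) :
    (IsGeodesicAt (metricComp g e) u x ∧ IsShearFreeAt (metricComp g e) u x) ∧
      ∀ a, pd a φ x = 0 := by
  obtain ⟨O', hO', hx', f, F, rfl⟩ := ((localMetric_metricComp g he).mono hO hOe).exists_localFrame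
    hu (fun x hx => (h x hx).2.unit) hx
  have := F.shearFree_of_isUniaxial ((hT.tmgOn he).mono (hO'.trans hOe)) hm
    (fun x hx => vol.abs_mul_det he (hO'.trans hOe) F hx) (hφ.mono hO')
    (fun x hx => (h x (hO' hx)).1) fun x hx => (h x (hO' hx)).2
  exact ⟨this.1 x hx', this.2 x hx'⟩

theorem fderiv_eq_zero_of_pd {φ : E3 → ℝ} {x : E3} (h : ∀ a, pd a φ x = 0) : fderiv ℝ φ x = 0 := by
  ext w
  rw [fderiv_eq_sum_pd]
  simp [h]

theorem exists_uniaxialAt_of_isUniaxial (he : e ∈ IsManifold.maximalAtlas (𝓡 3) ∞ M) {q : M}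
    (hq : q ∈ e.source) {φ : ℝ} {v : Fin 3 → ℝ}
    (h : IsUniaxial (metricComp g e (e q)) (tracefreeRicciComp g e (e q)) φ v) :
    ∃ u, UniaxialAt g q φ u := by
  -- Only the value of the field at q matters, so a constant element of the model space is enough.
  let w : E3 := ∑ a, v a • (coordVec e (e q) a : E3)
  refine ⟨fun _ => w, uniaxialAt_of_chart he hq ?_⟩
  convert h using 1
  exact funext (vecComp_eq he (e.map_source hq) rfl)

/-- A tracefree Ricci tensor which is algebraically special in one chart is uniaxial. -/
theorem exists_uniaxialAt_of_isAlgSpecial (he : e ∈ IsManifold.maximalAtlas (𝓡 3) ∞ M) {q : M}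
    (hq : q ∈ e.source) (h : IsAlgSpecial (metricComp g e (e q)) (tracefreeRicciComp g e (e q))) :
    ∃ φ u, UniaxialAt g q φ u := by
  have hL := localMetric_metricComp g he
  have hx := e.map_source hq
  obtain ⟨O, hO, hqO, f, F⟩ := hL.exists_localFrame' hx
  obtain ⟨φ, v, hv⟩ := h.exists_isUniaxial (hL.isMetric _ hx)
    (fun a b => F.tracefreeRicci_symm hqO a b)
    fun _ hb => tracefreeRicci_trace (hL.isMetric _ hx).symm hb
  exact ⟨φ, exists_uniaxialAt_of_isUniaxial he hq hv⟩

theorem AlgSpecialAt.exists_uniaxialAt {q : M} (h : AlgSpecialAt g q) :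
    ∃ φ u, UniaxialAt g q φ u :=
  exists_uniaxialAt_of_isAlgSpecial (IsManifold.chart_mem_maximalAtlas q) (mem_chart_source E3 q)
    (h _ (IsManifold.chart_mem_maximalAtlas q) (mem_chart_source E3 q))

theorem UniaxialAt.algSpecialAt {q : M} {φ : ℝ} {u : ∀ q : M, TangentSpace (𝓡 3) q}
    (h : UniaxialAt g q φ u) : AlgSpecialAt g q := fun e he hq =>
  (h e he hq).isAlgSpecial ((localMetric_metricComp g he).isMetric _ (e.map_source hq))

theorem UniaxialAt.petrovDAt {q : M} {φ : ℝ} {u : ∀ q : M, TangentSpace (𝓡 3) q}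
    (h : UniaxialAt g q φ u) (hφ : φ ≠ 0) : PetrovDAt g q := fun e he hq =>
  (h e he hq).isPetrovD ((localMetric_metricComp g he).isMetric _ (e.map_source hq)) hφ

theorem PetrovDAt.algSpecialAt {q : M} (h : PetrovDAt g q) : AlgSpecialAt g q :=
  fun e he hq => (h e he hq).isAlgSpecial

theorem UniaxialAt.unique {q : M} {φ φ' : ℝ} {u u' : ∀ q : M, TangentSpace (𝓡 3) q}
    (h : UniaxialAt g q φ u) (h' : UniaxialAt g q φ' u') : φ = φ' := by
  have he := IsManifold.chart_mem_maximalAtlas (I := 𝓡 3) (n := ∞) q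
  have hq := mem_chart_source E3 q
  exact (h _ he hq).unique
    ((localMetric_metricComp g he).isMetric _ ((chartAt E3 q).map_source hq)).symm (h' _ he hq)

theorem UniaxialAt.axis_unique {q : M} {φ φ' : ℝ} {u u' : ∀ q : M, TangentSpace (𝓡 3) q}
    (h : UniaxialAt g q φ u) (h' : UniaxialAt g q φ' u') (hφ : φ ≠ 0) :
    u' q = u q ∨ u' q = -u q := by
  have he := IsManifold.chart_mem_maximalAtlas (I := 𝓡 3) (n := ∞) q
  have hq := mem_chart_source E3 q
  have hx := (chartAt E3 q).map_source hq
  obtain ⟨c, key⟩ : ∃ c : Fin 3 → E3, ∀ u : ∀ q : M, TangentSpace (𝓡 3) q,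
      (u q : E3) = ∑ a, vecComp u (chartAt E3 q) a (chartAt E3 q q) • c a := by
    refine ⟨fun a => coordVec (chartAt E3 q) (chartAt E3 q q) a, fun u => ?_⟩
    have h1 := eq_sum_vecComp he u hx
    have h2 : ∀ p, p = q → (u p : E3) = (u q : E3) := by rintro _ rfl; rfl
    exact (h2 _ ((chartAt E3 q).left_inv hq)).symm.trans h1
  rcases (h _ he hq).axis_unique ((localMetric_metricComp g he).isMetric _ hx) (h' _ he hq) hφ
    with h1 | h1
  · left
    refine (key u').trans (Eq.trans ?_ (key u).symm)
    exact Finset.sum_congr rfl fun a _ => by rw [congrFun h1 a]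
  · right
    refine (key u').trans (Eq.trans ?_ (congrArg (fun w : E3 => -w) (key u)).symm)
    rw [← Finset.sum_neg_distrib]
    exact Finset.sum_congr rfl fun a _ => by rw [congrFun h1 a, Pi.neg_apply, neg_smul]

theorem UniaxialAt.tracefreeRicciVanishesAt_iff {q : M} {φ : ℝ}
    {u : ∀ q : M, TangentSpace (𝓡 3) q} (h : UniaxialAt g q φ u) :
    TracefreeRicciVanishesAt g q ↔ φ = 0 := by
  have key : ∀ e ∈ IsManifold.maximalAtlas (𝓡 3) ∞ M, q ∈ e.source →
      (tracefreeRicciComp g e (e q) = 0 ↔ φ = 0) := fun e he hq => not_iff_not.1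
    ((h e he hq).ne_zero ((localMetric_metricComp g he).isMetric _ (e.map_source hq)).symm)
  have he := IsManifold.chart_mem_maximalAtlas (I := 𝓡 3) (n := ∞) q
  exact ⟨fun h => (key _ he (mem_chart_source E3 q)).1 (h _ he (mem_chart_source E3 q)),
    fun h e he hq => (key e he hq).2 h⟩

end TMG

/-! ### The global argument on connected components. -/

namespace TMG

variable {M : Type*} [TopologicalSpace M] [ChartedSpace E3 M] [IsManifold (𝓡 3) ∞ M]
  {e : OpenPartialHomeomorph M E3} {g : Metric M} {vol : VolumeForm g} {m Λ : ℝ}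

/-- In topological massive gravity, a shear-free congruence of geodesics forces the tracefree
Ricci tensor to be uniaxial. -/
theorem SolvesTMG.algSpecialAt (hT : SolvesTMG g vol m Λ) (hm : m ≠ 0)
    (h : AdmitsShearFreeGeodesicCongruence g) (p : M) : AlgSpecialAt g p := by
  obtain ⟨L, hL⟩ := h
  obtain ⟨U, hU, hp, u, hu, h⟩ := hL p
  have he := IsManifold.chart_mem_maximalAtlas (I := 𝓡 3) (n := ∞) p
  have hps := mem_chart_source E3 p
  set e := chartAt E3 p
  have hx : e p ∈ e.target ∩ e.symm ⁻¹' U :=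
    ⟨e.map_source hps, by simpa [e.left_inv hps] using hp⟩
  obtain ⟨φ, hφ⟩ := hT.isUniaxial_of_shearFree hm he (e.isOpen_inter_preimage_symm hU)
    Set.inter_subset_left (contDiffOn_vecComp he hu)
    (fun x hx => by rw [bil_vecComp g he u u hx.1]; exact (h _ hx.2).1)
    (fun x hx => by
      have := (h _ hx.2).2.2 e he (e.map_target hx.1)
      rwa [e.right_inv hx.1] at this) hx
  exact (uniaxialAt_of_chart he hps hφ).algSpecialAt

/-- Where the tracefree Ricci tensor is algebraically special and does not vanish, it has locally
constant eigenvalues and a smooth axis. -/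
theorem SolvesTMG.exists_local_axis (hT : SolvesTMG g vol m Λ) (hm : m ≠ 0)
    (h : ∀ q : M, AlgSpecialAt g q) {p : M} {φ : ℝ} {w : ∀ q : M, TangentSpace (𝓡 3) q}
    (hp : UniaxialAt g p φ w) (hφ : φ ≠ 0) :
    ∃ U : Set M, IsOpen U ∧ p ∈ U ∧ ∃ u : ∀ q : M, TangentSpace (𝓡 3) q,
      ContMDiffOn (𝓡 3) (𝓡 3).tangent ∞ (fun q => (⟨q, u q⟩ : TangentBundle (𝓡 3) M)) U ∧
      ∀ q ∈ U, UniaxialAt g q φ u := by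
  have he := IsManifold.chart_mem_maximalAtlas (I := 𝓡 3) (n := ∞) p
  have hps := mem_chart_source E3 p
  set e := chartAt E3 p
  have hL := localMetric_metricComp g he
  have hx := e.map_source hps
  obtain ⟨O, hO, hqO, f, F⟩ := hL.exists_localFrame' hx
  obtain ⟨O', hO', ho', hx', ψ, u, hψ, hu, hψu⟩ := F.exists_smooth_axis (fun x hx => by
      obtain ⟨φ, u, hu⟩ := (h (e.symm x)).exists_uniaxialAt
      have := hu e he (e.map_target (hO hx))
      rw [e.right_inv (hO hx)] at this
      exact ⟨_, _, this⟩) hqO (((hp e he hps).ne_zero (hL.isMetric _ hx).symm).2 hφ)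
  have hOe : O' ⊆ e.target := hO'.trans hO
  obtain ⟨r, hr, hball⟩ := Metric.isOpen_iff.1 ho' _ hx'
  -- The curl equation makes all partial derivatives of ψ vanish; a ball is convex, so ψ is constant
  -- on it.
  have hconst : ∀ x ∈ Metric.ball (e p) r, ψ x = φ := by
    intro x hx
    have h0 : ψ (e p) = φ := (hψu _ hx').2.unique (hL.isMetric _ (hOe hx')).symm (hp e he hps)
    rw [← h0]
    refine (convex_ball (e p) r).is_const_of_fderivWithin_eq_zero (𝕜 := ℝ)
      ((hψ.mono hball).differentiableOn (by simp)) (fun y hy => ?_) hx (Metric.mem_ball_self hr)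
    rw [fderivWithin_of_isOpen Metric.isOpen_ball hy]
    exact fderiv_eq_zero_of_pd
      (hT.shearFree_of_isUniaxial hm he ho' hOe hu hψ hψu (hball hy)).2
  have hbt : Metric.ball (e p) r ⊆ e.target := hball.trans hOe
  let W : E3 → E3 := fun x => WithLp.toLp 2 fun a => u a x
  have hW : ContDiffOn ℝ ∞ W (Metric.ball (e p) r) :=
    contDiffOn_euclidean.2 fun a => (hu a).mono hball
  let v : ∀ q : M, TangentSpace (𝓡 3) q := fun q =>
    (mfderiv (𝓡 3) (𝓡 3) e.symm (e q) (W (e q)) : E3)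
  refine ⟨e.source ∩ e ⁻¹' Metric.ball (e p) r, e.isOpen_inter_preimage Metric.isOpen_ball,
    ⟨hps, Metric.mem_ball_self hr⟩, v, ?_, fun q hq => uniaxialAt_of_chart he hq.1 ?_⟩
  · refine ((contMDiffOn_symm_push he hbt hW).comp
      ((contMDiffOn_of_mem_maximalAtlas he).mono Set.inter_subset_left)
      fun q hq => hq.2).congr fun q hq => ?_
    have key : ∀ (p q : M) (w : E3), p = q → (⟨q, (w : E3)⟩ : TangentBundle (𝓡 3) M)
        = ⟨p, (w : E3)⟩ := by rintro _ _ _ rfl; rfl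
    exact key _ _ _ (e.left_inv hq.1)
  · have hvc : ∀ a, vecComp v e a (e q) = u a (e q) := by
      refine vecComp_eq he (hbt hq.2) ?_
      have h1 : (v (e.symm (e q)) : E3) = v q := by
        have h2 : ∀ p, p = q → (v p : E3) = (v q : E3) := by rintro _ rfl; rfl
        exact h2 _ (e.left_inv hq.1)
      exact h1.trans (mfderiv_symm_apply (e := e) (e q) (W (e q)))
    have := (hψu _ (hball hq.2)).2
    rw [hconst _ hq.2] at this
    simp only [hvc]
    exact this

/-- A nowhere vanishing algebraically special tracefree Ricci tensor gives rise to a shear-free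
congruence of geodesics. -/
theorem SolvesTMG.admitsShearFreeGeodesicCongruence (hT : SolvesTMG g vol m Λ) (hm : m ≠ 0)
    (h : ∀ q : M, AlgSpecialAt g q) (h0 : ∀ q : M, ¬ TracefreeRicciVanishesAt g q) :
    AdmitsShearFreeGeodesicCongruence g := by
  choose φ w hw using fun q => (h q).exists_uniaxialAt
  have hφ : ∀ q, φ q ≠ 0 := fun q h1 => h0 q ((hw q).tracefreeRicciVanishesAt_iff.2 h1)
  -- The axes are chosen point by point with arbitrary signs. Only the lines they span are used, and
  -- these agree with the span of any smooth local axis.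
  refine ⟨fun q => Submodule.span ℝ {w q q}, fun p => ?_⟩
  obtain ⟨U, hU, hp, u, hu, hUu⟩ := hT.exists_local_axis hm h (hw p) (hφ p)
  refine ⟨U, hU, hp, u, hu, fun q hq => ⟨?_, ?_, fun e he hqe => ?_⟩⟩
  · have he := IsManifold.chart_mem_maximalAtlas (I := 𝓡 3) (n := ∞) q
    have hqs := mem_chart_source E3 q
    set e := chartAt E3 q
    have h1 := bil_vecComp g he u u (e.map_source hqs)
    rw [e.left_inv hqs] at h1
    rw [← h1]
    exact (hUu q hq e he hqs).unit
  · rcases (hw q).axis_unique (hUu q hq) (hφ q) with h1 | h1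
    · rw [h1]
    · rw [h1, ← Set.neg_singleton, Submodule.span_neg]
  · have := hT.shearFree_of_isUniaxial hm he (e.isOpen_inter_preimage_symm hU)
      Set.inter_subset_left (contDiffOn_vecComp he hu) (φ := fun _ => φ p) contDiffOn_const
      (fun x hx => ⟨hφ p, by
        have := hUu _ hx.2 e he (e.map_target hx.1)
        rwa [e.right_inv hx.1] at this⟩)
      (x := e q) ⟨e.map_source hqe, by simpa [e.left_inv hqe] using hq⟩
    exact this.1

/-- φ² is one sixth of the squared norm of Φ and so is continuous even where Φ vanishes; there the
smooth formula for φ itself is not available. -/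
theorem continuous_uniaxial_sq {φ : M → ℝ} {w : M → ∀ q : M, TangentSpace (𝓡 3) q}
    (hw : ∀ q, UniaxialAt g q (φ q) (w q)) : Continuous fun q => φ q ^ 2 := by
  refine continuous_iff_continuousAt.2 fun p => ?_
  have he := IsManifold.chart_mem_maximalAtlas (I := 𝓡 3) (n := ∞) p
  have hps := mem_chart_source E3 p
  set e := chartAt E3 p
  have hL := localMetric_metricComp g he
  obtain ⟨O, hO, hqO, f, F⟩ := hL.exists_localFrame' (e.map_source hps)
  have h1 : ContDiffOn ℝ ∞ (fun x => 1 / 6 * ∑ i, ∑ j,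
      bil (tracefreeRicciComp g e x) (fun a => f i a x) (fun a => f j a x) *
      bil (tracefreeRicciComp g e x) (fun a => f i a x) (fun a => f j a x)) O :=
    contDiffOn_const.mul (ContDiffOn.sum fun i _ => ContDiffOn.sum fun j _ =>
      (F.contDiffOn_bil_tracefreeRicci i j).mul (F.contDiffOn_bil_tracefreeRicci i j))
  have h2 := (h1.continuousOn.continuousAt (F.isOpen.mem_nhds hqO)).comp (e.continuousAt hps)
  refine h2.congr ?_
  filter_upwards [(e.isOpen_inter_preimage F.isOpen).mem_nhds ⟨hps, hqO⟩] with q hq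
  have h3 := (hw q e he hq.1).sum_sq (F.symm _ hq.2) (F.orth _ hq.2)
  simp only [Function.comp_apply]
  rw [h3]
  ring

/-- If the tracefree Ricci tensor is algebraically special and non-zero somewhere in each
component, it vanishes nowhere. -/
theorem SolvesTMG.not_tracefreeRicciVanishesAt (hT : SolvesTMG g vol m Λ) (hm : m ≠ 0)
    (h : ∀ q : M, AlgSpecialAt g q) {p q : M} (hq : q ∈ connectedComponent p)
    (hq0 : ¬ TracefreeRicciVanishesAt g q) : ¬ TracefreeRicciVanishesAt g p := by
  choose φ w hw using fun q => (h q).exists_uniaxialAt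
  have hc : φ q ≠ 0 := fun h1 => hq0 ((hw q).tracefreeRicciVanishesAt_iff.2 h1)
  have hopen : ∀ c : ℝ, c ≠ 0 → IsOpen {p | φ p = c} := by
    intro c hc
    refine isOpen_iff_mem_nhds.2 fun r (hr : φ r = c) => ?_
    obtain ⟨U, hU, hrU, u, -, hUu⟩ := hT.exists_local_axis hm h (hw r) (by rwa [hr])
    filter_upwards [hU.mem_nhds hrU] with s hs
    exact ((hw s).unique (hUu s hs)).trans hr
  have hclosed : IsClosed {p | φ p = φ q} := by
    -- At this stage only φ² is known to be continuous on all of M. Its level set consists of the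
    -- level sets of φ for c and -c; both are open since φ is locally constant where it is not zero,
    -- so each is also closed.
    have h1 : {p | φ p = φ q} = {p | φ p ^ 2 = φ q ^ 2} ∩ {p | φ p = -φ q}ᶜ := by
      ext r
      simp only [Set.mem_ofPred_eq, Set.mem_inter_iff, Set.mem_compl_iff, sq_eq_sq_iff_eq_or_eq_neg]
      constructor
      · intro h1
        refine ⟨Or.inl h1, fun h2 => hc ?_⟩
        linarith
      · rintro ⟨h1 | h1, h2⟩
        exacts [h1, absurd h1 h2]
    rw [h1]
    exact (isClosed_eq (continuous_uniaxial_sq hw) continuous_const).inter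
      (hopen _ (neg_ne_zero.2 hc)).isClosed_compl
  have hp : φ p = φ q := (isPreconnected_connectedComponent (x := p)).subset_isClopen
    ⟨hclosed, hopen _ hc⟩ ⟨q, hq, rfl⟩ mem_connectedComponent
  rw [(hw p).tracefreeRicciVanishesAt_iff, hp]
  exact hc

theorem SolvesTMG.goldbergSachs (hT : SolvesTMG g vol m Λ) (hm : m ≠ 0) :
    (AdmitsShearFreeGeodesicCongruence g → ∀ p : M, AlgSpecialAt g p) ∧
    ((∀ p : M, ∃ q ∈ connectedComponent p, ¬ TracefreeRicciVanishesAt g q) →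
      (AdmitsShearFreeGeodesicCongruence g ↔ ∀ p : M, AlgSpecialAt g p) ∧
      ((∀ p : M, AlgSpecialAt g p) ↔ ∀ p : M, PetrovDAt g p)) := by
  refine ⟨fun h => hT.algSpecialAt hm h, fun h0 => ?_⟩
  have hne : (∀ p : M, AlgSpecialAt g p) → ∀ p : M, ¬ TracefreeRicciVanishesAt g p := by
    intro h p
    obtain ⟨q, hq, hq0⟩ := h0 p
    exact hT.not_tracefreeRicciVanishesAt hm h hq hq0
  refine ⟨⟨fun h => hT.algSpecialAt hm h,
    fun h => hT.admitsShearFreeGeodesicCongruence hm h (hne h)⟩,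
    fun h p => ?_, fun h p => (h p).algSpecialAt⟩
  obtain ⟨φ, u, hu⟩ := (h p).exists_uniaxialAt
  exact hu.petrovDAt fun h1 => hne h p (hu.tracefreeRicciVanishesAt_iff.2 h1)

end TMG

theorem mainTheorem3 {M : Type*} [TopologicalSpace M] [ChartedSpace TMG.E3 M]
    [IsManifold (𝓡 3) ∞ M] (g : TMG.Metric M) (vol : TMG.VolumeForm g)
    (m Λ : ℝ) (hm : m ≠ 0) (hTMG : TMG.SolvesTMG g vol m Λ) :
    (TMG.AdmitsShearFreeGeodesicCongruence g → ∀ p : M, TMG.AlgSpecialAt g p) ∧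
    ((∀ p : M, ∃ q ∈ connectedComponent p, ¬ TMG.TracefreeRicciVanishesAt g q) →
      (TMG.AdmitsShearFreeGeodesicCongruence g ↔ ∀ p : M, TMG.AlgSpecialAt g p) ∧
      ((∀ p : M, TMG.AlgSpecialAt g p) ↔ ∀ p : M, TMG.PetrovDAt g p)) := 
  hTMG.goldbergSachs hm
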